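/- Let $f,w:\{1,\dots,n\}\to\mathbb R$ with all $w_i>0$, let $\delta>0$ and $U=\max_i|f_i|$. For $p>1$ the $L_p$ isotonic regression of $(f,w)$ is the non-decreasing $g$ that minimizes $\sum_i w_i|f_i-g_i|^p$; $\mathrm{strict}_{\downarrow1}(f)$ is its limit as $p\searrow1$. For a finite non-empty family $S$ of values $y$ with weights $w_y>0$, let $\mathrm{mean}_{\downarrow1}(S)$ be the limit, as $p\searrow 1$, of the minimizer $c$ of $\sum_{y\in S}w_y|y-c|^p$. Time is the number of steps on a real RAM on which each arithmetic operation, real power, comparison and array access costs one step. **Algorithm.** The vertices are grouped into blocks of consecutive vertices; each block has a vertical extent, with ends $a\le b$. Initially every vertex is a block with extent $[\min f,\max f]$. In an iteration a splitting value $\hat y$ is chosen for each extent that is to be split. For each block $S$ with this extent one computes from its original data values the total weight $W$, the weights $S_<,S_=,S_>$ of the data values less than, equal to, greater than $\hat y$, and the products $P_<,P_>$ of $|\hat y-y|^{w_y}$ over its data values $y<\hat y$ and $y>\hat y$ respectively. A block is then partitioned, that is, its extent becomes $(a,\hat y)$, the point $\hat y$, or $(\hat y,b)$, as follows. If $S_=>0$: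 the point if $S_<,S_><W/2$; otherwise $(a,\hat y)$ if $S_<\ge W/2$, and $(\hat y,b)$ if not. If $S_==0$ and $S_<=S_>$ (Jackson's formula): the point if $P_<=P_>$, $(a,\hat y)$ if $P_<>P_>$, $(\hat y,b)$ if $P_<<P_>$. If $S_==0$ and $S_<\ne S_>$: $(a,\hat y)$ if $S_<>W/2$, and $(\hat y,b)$ if not. The blocks are processed from left to right (pool adjacent violators): as long as the new extent of the preceding block is above the new extent of the current one, the two unpartitioned blocks are merged, sums being added and products multiplied, and the union is partitioned. In the first phase $\hat y$ is the median of the distinct data values of $f$ remaining in the extent (which are sorted once at the start by merge sort), until no data values remain in any extent; in the second phase $\hat y=(a+b)/2$, until $b-a\le\delta$ for every block. The output is, for every vertex $i$, the extent with ends $a_i\le b_i$ of its block. **Claim.** 1. For every non-empty $S$ as above, $\mathrm{mean}_{\downarrow1}(S)$ exists and is unique. For every $\hat y$, one pass over the original data values of a block computes its sums and products, merging maintains them, and the partitioning rule decides from them correctly whether $\mathrm{mean}_{\downarrow1}(S)$ is less than, equal to, or greater than $\hat y$. 2. For all $n,f,w,\delta$ as above, $g=\mathrm{strict}_{\downarrow1}(f)$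 exists and is unique, the algorithm halts, and its output satisfies $a_i\le g_i\le b_i$ and $b_i-a_i\le\delta$ for all $i$, with $(a_i)$ and $(b_i)$ non-decreasing; if $g_i$ is one of the values of $f$, then $a_i=b_i=g_i$. 3. The worst-case time is $\Theta(n\log\max\{n,U/\delta\})$: there are absolute constants $c,C>0$ such that for $n\ge2$ the time is at most $C\,n\log\max\{n,U/\delta\}$ on every input, and for all $n\ge3$, $U\ge0$ and $\delta>0$ there is an input with $\max_i|f_i|=U$ on which the time is at least $c\,n\log\max\{n,U/\delta\}$. -/

import Mathlib

open Filter Topology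

noncomputable section

namespace StrictIso

/-! ### Isotonic regression and its limit as `p ↘ 1` -/

/-- The weighted `L_p` error `∑ w(v) |f(v) - g(v)|^p` (without the `p`-th root). -/
def lpError {V : Type*} [Fintype V] (p : ℝ) (f w g : V → ℝ) : ℝ :=
  ∑ v, w v * |f v - g v| ^ p

/-- `g` is an `L_p` isotonic regression of the weighted function `(f, w)`. -/
def IsLpRegression {V : Type*} [Fintype V] [Preorder V] (p : ℝ) (f w g : V → ℝ) : Prop :=
  Monotone g ∧ ∀ h : V → ℝ, Monotone h → lpError p f w g ≤ lpError p f w h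

/-- `g` is the limit of `L_p` isotonic regressions of `(f, w)` as `p` decreases to `1`. -/
def IsStrictDownOne {V : Type*} [Fintype V] [Preorder V] (f w g : V → ℝ) : Prop :=
  ∃ r : ℝ → V → ℝ, (∀ p, 1 < p → IsLpRegression p f w (r p)) ∧
    Tendsto r (𝓝[>] 1) (𝓝 g)

/-- `c` is a weighted `L_p` mean of the finite family `S` of pairs (value, weight). -/
def IsLpMean (p : ℝ) (S : List (ℝ × ℝ)) (c : ℝ) : Prop :=
  ∀ z : ℝ, (S.map fun q => q.2 * |q.1 - c| ^ p).sum ≤ (S.map fun q => q.2 * |q.1 - z| ^ p).sum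

/-- `c` is the limit of weighted `L_p` means of `S` as `p` decreases to `1`. -/
def IsMeanDownOne (S : List (ℝ × ℝ)) (c : ℝ) : Prop :=
  ∃ m : ℝ → ℝ, (∀ p, 1 < p → IsLpMean p S (m p)) ∧ Tendsto m (𝓝[>] 1) (𝓝 c)

/-! ### Step counting

A unit-cost real RAM. Computations carry a step counter and may diverge (`none`).
Every arithmetic operation, power, comparison and array access on reals or indices is one step,
and so is every call of a program function; that step pays for the bounded amount of pattern
matching and record or list-cell construction which the body of the function performs. -/

/-- Possibly divergent computations with a step counter. -/
abbrev RAM := StateT ℕ Option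

def tick : RAM Unit := fun t => some ((), t + 1)

def addR (x y : ℝ) : RAM ℝ := do tick; pure (x + y)
def subR (x y : ℝ) : RAM ℝ := do tick; pure (x - y)
def mulR (x y : ℝ) : RAM ℝ := do tick; pure (x * y)
def halfR (x : ℝ) : RAM ℝ := do tick; pure (x / 2)
def powR (x y : ℝ) : RAM ℝ := do tick; pure (x ^ y)
def ltR (x y : ℝ) : RAM Bool := do tick; pure (decide (x < y))
def leR (x y : ℝ) : RAM Bool := do tick; pure (decide (x ≤ y))
def addN (i j : ℕ) : RAM ℕ := do tick; pure (i + j)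
def predN (i : ℕ) : RAM ℕ := do tick; pure (i - 1)
def halfN (i : ℕ) : RAM ℕ := do tick; pure (i / 2)
def ltN (i j : ℕ) : RAM Bool := do tick; pure (decide (i < j))
def readA (A : Array ℝ) (i : ℕ) : RAM ℝ := do tick; pure (A.getD i 0)

/-! ### Sorting the distinct data values -/

/-- Deal a list alternately into two lists. -/
def split : List ℝ → RAM (List ℝ × List ℝ)
  | [] => do tick; pure ([], [])
  | x :: l => do
    tick
    let (p, q) ← split l
    pure (x :: q, p)

/-- Merge two strictly increasing lists, keeping one copy of common values. -/
def merge (xs ys : List ℝ) : RAM (List ℝ) := do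
  tick
  match xs, ys with
  | [], ys => pure ys
  | x :: xs, [] => pure (x :: xs)
  | x :: xs, y :: ys =>
    if ← ltR x y then
      let r ← merge xs (y :: ys)
      pure (x :: r)
    else if ← ltR y x then
      let r ← merge (x :: xs) ys
      pure (y :: r)
    else
      merge xs (y :: ys)
  partial_fixpoint

/-- Merge sort; the result lists the distinct values in increasing order. -/
def sortDistinct (l : List ℝ) : RAM (List ℝ) := do
  tick
  match l with
  | [] => pure []
  | [x] => pure [x]
  | x :: y :: l => do
    let (p, q) ← split (x :: y :: l)
    let p' ← sortDistinct p
    let q' ← sortDistinct q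
    merge p' q'
  partial_fixpoint

/-- The data values of a list of pairs (value, weight). -/
def values : List (ℝ × ℝ) → RAM (List ℝ)
  | [] => do tick; pure []
  | (y, _) :: l => do
    tick
    let r ← values l
    pure (y :: r)

/-- Write a list into an array. -/
def fillArray : List ℝ → Array ℝ → RAM (Array ℝ)
  | [], A => do tick; pure A
  | x :: l, A => do
    tick
    fillArray l (A.push x)

/-! ### Boxes and their partitioning -/

/-- A box: `len` consecutive vertices (the boxes are kept in the order of the vertices, so the
lengths determine the horizontal extents) and the vertical extent from `a` to `b`.
The data values that are still candidates inside the extent are those with ranks `lo ≤ k < hi`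
in the sorted array of distinct data values. -/
structure Box where
  len : ℕ
  a : ℝ
  b : ℝ
  lo : ℕ
  hi : ℕ

/-- A splitting value `y` for a vertical extent; the candidates below it are those of rank
`< hiBelow`, and those above it have rank `≥ loAbove`. -/
structure Cut where
  y : ℝ
  hiBelow : ℕ
  loAbove : ℕ

/-- The numbers kept for a block relative to a splitting value `ŷ`: the total weight `W`, the
weights `Slt`, `Seq`, `Sgt` of the data values `< ŷ`, `= ŷ`, `> ŷ`, and the products `Plt`, `Pgt`
of `|ŷ - y|^w` over the data values `y < ŷ` and `y > ŷ`. -/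
@[ext] structure Stats where
  W : ℝ
  Slt : ℝ
  Seq : ℝ
  Sgt : ℝ
  Plt : ℝ
  Pgt : ℝ

/-- The statistics of the weighted data values `S` relative to `y`, as mathematical quantities. -/
def Stats.of (y : ℝ) (S : List (ℝ × ℝ)) : Stats where
  W := (S.map Prod.snd).sum
  Slt := ((S.filter fun q => decide (q.1 < y)).map Prod.snd).sum
  Seq := ((S.filter fun q => decide (q.1 = y)).map Prod.snd).sum
  Sgt := ((S.filter fun q => decide (y < q.1)).map Prod.snd).sum
  Plt := ((S.filter fun q => decide (q.1 < y)).map fun q => |y - q.1| ^ q.2).prod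
  Pgt := ((S.filter fun q => decide (y < q.1)).map fun q => |y - q.1| ^ q.2).prod

def Stats.empty : Stats := ⟨0, 0, 0, 0, 1, 1⟩

/-- Add one data point to the statistics. -/
def addPoint (y v w : ℝ) (s : Stats) : RAM Stats := do
  tick
  let W ← addR s.W w
  if ← ltR v y then
    let S ← addR s.Slt w
    let d ← subR y v
    let e ← powR d w
    let P ← mulR s.Plt e
    pure { s with W := W, Slt := S, Plt := P }
  else if ← ltR y v then
    let S ← addR s.Sgt w
    let d ← subR v y
    let e ← powR d w
    let P ← mulR s.Pgt e
    pure { s with W := W, Sgt := S, Pgt := P }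
  else
    let S ← addR s.Seq w
    pure { s with W := W, Seq := S }

/-- Read the next `k` points of the original data, accumulating their statistics relative
to `y`; the unread data are returned as well. -/
def scan (y : ℝ) : ℕ → List (ℝ × ℝ) → Stats → RAM (Stats × List (ℝ × ℝ))
  | k + 1, (v, w) :: data, s => do
    tick
    let s' ← addPoint y v w s
    scan y k data s'
  | _, data, s => do tick; pure (s, data)

/-- Pass over the next `k` data points. -/
def skip : ℕ → List (ℝ × ℝ) → RAM (List (ℝ × ℝ))
  | k + 1, _ :: data => do tick; skip k data
  | _, data => do tick; pure data

/-- The statistics of the union of two adjacent blocks, in constant time. -/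
def mergeStats (s t : Stats) : RAM Stats := do
  tick
  let W ← addR s.W t.W
  let L ← addR s.Slt t.Slt
  let E ← addR s.Seq t.Seq
  let G ← addR s.Sgt t.Sgt
  let P ← mulR s.Plt t.Plt
  let Q ← mulR s.Pgt t.Pgt
  pure ⟨W, L, E, G, P, Q⟩

/-- Decide from its statistics whether the regression value of a block is below, at, or above
the splitting value. -/
def locate (s : Stats) : RAM Ordering := do
  tick
  let half ← halfR s.W
  if ← ltR 0 s.Seq then
    if (← ltR s.Slt half) && (← ltR s.Sgt half) then pure .eq
    else if ← leR half s.Slt then pure .lt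
    else pure .gt
  else if (← leR s.Slt s.Sgt) && (← leR s.Sgt s.Slt) then
    if ← ltR s.Pgt s.Plt then pure .lt
    else if ← ltR s.Plt s.Pgt then pure .gt
    else pure .eq
  else if ← ltR half s.Slt then pure .lt
  else pure .gt

/-- A block during one iteration: its box before the partitioning, the splitting value of this
iteration (`none` if the box is not to be partitioned) and its statistics. -/
structure Block where
  box : Box
  cut : Option Cut
  stats : Stats

/-- The box that results from partitioning a block. -/
def partitionBlock (B : Block) : RAM Box := do
  tick
  match B.cut with
  | none => pure B.box
  | some c =>
    match ← locate B.stats with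
    | .lt => pure { B.box with b := c.y, hi := c.hiBelow }
    | .eq => pure { B.box with a := c.y, b := c.y, lo := 0, hi := 0 }
    | .gt => pure { B.box with a := c.y, lo := c.loAbove }

/-! ### Pool adjacent violators -/

/-- Whether the vertical extent of `X` is above that of `Y`. -/
def isAbove (X Y : Box) : RAM Bool := do
  tick
  pure ((← leR Y.b X.a) && (← ltR Y.a X.b))

/-- The unpartitioned union of two adjacent blocks with the same vertical extent. -/
def mergeBlocks (A B : Block) : RAM Block := do
  tick
  let s ← mergeStats A.stats B.stats
  let k ← addN A.box.len B.box.len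
  pure { B with box := { B.box with len := k }, stats := s }

/-- Partition the block `B` and compare it with its predecessors (on a stack, nearest first, each
with the box that its partitioning gave); as long as the predecessor is above, merge the two
unpartitioned blocks and partition the union. -/
def pool (B : Block) : List (Block × Box) → RAM (List (Block × Box))
  | [] => do
    tick
    let X ← partitionBlock B
    pure [(B, X)]
  | (A, Y) :: stack => do
    tick
    let X ← partitionBlock B
    if ← isAbove Y X then
      let C ← mergeBlocks A B
      pool C stack
    else
      pure ((B, X) :: (A, Y) :: stack)

/-- Pool all blocks from left to right. Blocks from different sequences (different vertical
extents) are never merged, since the extents of a later sequence lie above. -/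
def poolAll : List Block → List (Block × Box) → RAM (List (Block × Box))
  | [], stack => do tick; pure stack
  | B :: blocks, stack => do
    tick
    let stack' ← pool B stack
    poolAll blocks stack'

/-- The boxes on the stack, from left to right. -/
def unstack : List (Block × Box) → List Box → RAM (List Box)
  | [], acc => do tick; pure acc
  | (_, X) :: stack, acc => do tick; unstack stack (X :: acc)

/-! ### Iterations -/

/-- Choose the splitting values and compute the statistics of all blocks from the original data. -/
def prepare (pick : Box → RAM (Option Cut)) : List Box → List (ℝ × ℝ) → RAM (List Block)
  | [], _ => do tick; pure []
  | X :: boxes, data => do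
    tick
    match ← pick X with
    | none =>
      let rest ← skip X.len data
      let r ← prepare pick boxes rest
      pure (⟨X, none, Stats.empty⟩ :: r)
    | some c =>
      let (s, rest) ← scan c.y X.len data Stats.empty
      let r ← prepare pick boxes rest
      pure (⟨X, some c, s⟩ :: r)

/-- Whether some box is still to be partitioned. -/
def anyActive (pick : Box → RAM (Option Cut)) : List Box → RAM Bool
  | [] => do tick; pure false
  | X :: boxes => do
    tick
    match ← pick X with
    | none => anyActive pick boxes
    | some _ => pure true

/-- Repeat the iteration (partition all boxes, pool adjacent violators) while some box is to be
partitioned. -/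
def iterations (pick : Box → RAM (Option Cut)) (data : List (ℝ × ℝ)) (boxes : List Box) :
    RAM (List Box) := do
  tick
  if ← anyActive pick boxes then
    let blocks ← prepare pick boxes data
    let stack ← poolAll blocks []
    let boxes' ← unstack stack []
    iterations pick data boxes'
  else
    pure boxes
  partial_fixpoint

/-- Split at the median of the data values in the extent, if there are any. -/
def pickData (A : Array ℝ) (X : Box) : RAM (Option Cut) := do
  tick
  if ← ltN X.lo X.hi then
    let s ← addN X.lo X.hi
    let m ← halfN s
    let y ← readA A m
    let m' ← addN m 1
    pure (some ⟨y, m, m'⟩)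
  else
    pure none

/-- Split at the midpoint of the extent, if it is longer than `δ`. -/
def pickMid (δ : ℝ) (X : Box) : RAM (Option Cut) := do
  tick
  let d ← subR X.b X.a
  if ← ltR δ d then
    let s ← addR X.a X.b
    let y ← halfR s
    pure (some ⟨y, X.hi, X.lo⟩)
  else
    pure none

/-- Every data point in its own box, the vertical extent being the range `[a, b]` of the data. -/
def initBoxes (a b : ℝ) (m : ℕ) : List (ℝ × ℝ) → RAM (List Box)
  | [] => do tick; pure []
  | _ :: data => do
    tick
    let r ← initBoxes a b m data
    pure (⟨1, a, b, 0, m⟩ :: r)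

/-- `k` copies of `z` in front of `l`. -/
def replicateOnto (z : ℝ × ℝ) (l : List (ℝ × ℝ)) : ℕ → RAM (List (ℝ × ℝ))
  | 0 => do tick; pure l
  | k + 1 => do
    tick
    let r ← replicateOnto z l k
    pure (z :: r)

/-- For every vertex, the vertical extent of its box. -/
def output : List Box → RAM (List (ℝ × ℝ))
  | [] => do tick; pure []
  | X :: boxes => do
    tick
    let r ← output boxes
    replicateOnto (X.a, X.b) r X.len

/-- The algorithm: partitioning at data values, then by halving the remaining extents until all
of them have length at most `δ`. The input lists value and weight of the vertices in order; the
output lists for every vertex the lower and the upper end of its vertical extent. -/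
def strictAlg (data : List (ℝ × ℝ)) (δ : ℝ) : RAM (List (ℝ × ℝ)) := do
  tick
  let vals ← values data
  let sorted ← sortDistinct vals
  let A ← fillArray sorted #[]
  let a ← readA A 0
  let last ← predN A.size
  let b ← readA A last
  let boxes ← initBoxes a b A.size data
  let boxes₁ ← iterations (pickData A) data boxes
  let boxes₂ ← iterations (pickMid δ) data boxes₁
  output boxes₂

/-- Value and weight of the vertices of a linear order, in order. -/
def dataOf {n : ℕ} (f w : Fin n → ℝ) : List (ℝ × ℝ) := List.ofFn fun i => (f i, w i)

/-- The computation `c` halts with result `x` after exactly `t` steps. -/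
def HaltsWith {α : Type} (c : RAM α) (x : α) (t : ℕ) : Prop := c.run 0 = some (x, t)

end StrictIso

end

open StrictIso

namespace StrictIso

/-! ### Slopes of the `L_p` error of a block and their behaviour as `p ↘ 1` -/

/-! Limit means. With `q = p - 1`, the derivative at `y` of the `L_p` error of a family is `q + 1`
times `slope q S y`, which is strictly increasing in `y` for `q > 0`; a mean is its zero. As `q ↘ 0`
the slope expands as `signSum S y + q * logSum S y + o(q)`, so its sign for small `q` is found
lexicographically, by weights and then by logarithms. Values equal to `y` add nothing at `y`, but
they shift `signSum` by their weight and drive `logSum` to infinity next to `y`; hence the rules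
compare `signSum` with `eqSum`. The three rules exhaust all cases (`rule_trichotomy`), so the slopes
change sign at a single point `limMean S`, to which all means converge. Logarithms of the two
products give `logSum`, which is Jackson's formula (`Stats.of_identities`, `locate_runs`).

Limit regressions. Shifting a block of an `L_p` regression up or down, where monotonicity permits,
gives a first-order condition on a slope. In the limit it becomes stability: a block at the lower
end of an upper level set has limit mean at least the level, and dually. Every cluster point of the
regressions is stable (`isStable_of_tendsto`), and two stable functions coincide
(`IsStable.le_of_isStable`). Clamping bounds the regressions, so compactness turns the unique
cluster point into a limit.

Correctness. Every vertex is carried together with its regression value. The invariant is that this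
value is constant on a block, lies in the extent, and, if it is a data value, is a remaining
candidate or the extent is a point. By stability two adjacent violators have the same regression
value, so pooling preserves constancy (`StableCells.eq_of_violators`). Once no violators remain,
stability places the regression value of each block on the side of the cut where its limit mean lies
(`regression_below`, `regression_above`), so the new extent is right.

Time. Pooling is linear by amortization over the stack, so an iteration takes linear time; it also
takes at least `n` steps, as all the data are read. The first phase halves the candidates, the
second the lengths, which bounds the numbers of iterations. For the lower bound, merge sort always
takes about `n log n` steps, and there is an input with regression value `U / 3`. After `k` halvings
the ends of the extents are integer multiples of `U / 2 ^ k`, never `U / 3`, so an extent of length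
at most `δ` around it forces `U ≤ δ * 2 ^ k`. -/

/-- The odd function `x ↦ sign x |x|^q`. -/
noncomputable def signPow (q x : ℝ) : ℝ := (SignType.sign x : ℝ) * |x| ^ q

/-- The slope at `y` of the `L_{q+1}` error of `S`, up to the factor `q + 1`. -/
noncomputable def slope (q : ℝ) (S : List (ℝ × ℝ)) (y : ℝ) : ℝ :=
  (S.map fun r => r.2 * signPow q (y - r.1)).sum

/-- The weight of the values below `y` minus that of the values above `y`. -/
noncomputable def signSum (S : List (ℝ × ℝ)) (y : ℝ) : ℝ :=
  (S.map fun r => r.2 * (SignType.sign (y - r.1) : ℝ)).sum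

/-- The derivative of `slope q S y` with respect to `q` at `q = 0`. -/
noncomputable def logSum (S : List (ℝ × ℝ)) (y : ℝ) : ℝ :=
  (S.map fun r => r.2 * ((SignType.sign (y - r.1) : ℝ) * Real.log |y - r.1|)).sum

/-- The weight of the values equal to `y`. -/
noncomputable def eqSum (S : List (ℝ × ℝ)) (y : ℝ) : ℝ :=
  (S.map fun r => if r.1 = y then r.2 else 0).sum

/-- The family with all values negated. -/
def reflect (S : List (ℝ × ℝ)) : List (ℝ × ℝ) := S.map fun r => (-r.1, r.2)

theorem signPow_of_pos {q x : ℝ} (hx : 0 < x) : signPow q x = x ^ q := by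
  simp [signPow, sign_pos hx, abs_of_pos hx]

theorem signPow_zero (q : ℝ) : signPow q 0 = 0 := by simp [signPow]

theorem sign_neg_coe (x : ℝ) : ((SignType.sign (-x) : SignType) : ℝ) = -(SignType.sign x : ℝ) := by
  rw [Left.sign_neg]; simp

theorem signPow_neg (q x : ℝ) : signPow q (-x) = -signPow q x := by
  simp [signPow, Left.sign_neg]

theorem signPow_strictMono {q : ℝ} (hq : 0 < q) : StrictMono (signPow q) := by
  have hpos : ∀ x y, 0 ≤ x → x < y → signPow q x < signPow q y := by
    intro x y hx hxy
    rcases hx.eq_or_lt with rfl | hx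
    · rw [signPow_zero, signPow_of_pos hxy]; positivity
    · rw [signPow_of_pos hx, signPow_of_pos (hx.trans hxy)]
      exact Real.rpow_lt_rpow hx.le hxy hq
  intro x y hxy
  rcases le_or_gt 0 x with hx | hx
  · exact hpos x y hx hxy
  rcases le_or_gt y 0 with hy | hy
  · have := hpos (-y) (-x) (by linarith) (by linarith)
    rw [signPow_neg, signPow_neg] at this
    linarith
  · have h1 := hpos 0 y le_rfl hy
    have h2 := hpos 0 (-x) le_rfl (by linarith)
    rw [signPow_neg] at h2
    rw [signPow_zero] at h1 h2
    linarith

theorem hasDerivAt_abs_rpow_signPow {q : ℝ} (hq : 0 < q) (x : ℝ) :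
    HasDerivAt (fun x : ℝ => |x| ^ (q + 1)) ((q + 1) * signPow q x) x := by
  have h := hasDerivAt_abs_rpow x (p := q + 1) (by linarith)
  convert h using 1
  rw [mul_assoc]
  congr 1
  rcases lt_trichotomy x 0 with hx | rfl | hx
  · have h0 : 0 < -x := by linarith
    rw [show x = -(-x) by ring, signPow_neg, signPow_of_pos h0, abs_neg, abs_of_pos h0,
      show q = (q + 1 - 2) + 1 by ring, Real.rpow_add_one h0.ne']
    ring_nf
  · simp [signPow_zero]
  · rw [signPow_of_pos hx, abs_of_pos hx, show q = (q + 1 - 2) + 1 by ring,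
      Real.rpow_add_one hx.ne']
    ring_nf

/-! ### Symmetry under negating all values -/

theorem slope_reflect (q : ℝ) (S : List (ℝ × ℝ)) (y : ℝ) :
    slope q (reflect S) (-y) = -slope q S y := by
  induction S with
  | nil => simp [slope, reflect]
  | cons r S ih =>
    simp only [slope, reflect, List.map_cons, List.sum_cons] at ih ⊢
    rw [ih, show -y - -r.1 = -(y - r.1) by ring, signPow_neg]
    ring

theorem signSum_reflect (S : List (ℝ × ℝ)) (y : ℝ) :
    signSum (reflect S) (-y) = -signSum S y := by
  induction S with
  | nil => simp [signSum, reflect]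
  | cons r S ih =>
    simp only [signSum, reflect, List.map_cons, List.sum_cons] at ih ⊢
    rw [ih, show -y - -r.1 = -(y - r.1) by ring, sign_neg_coe]
    ring

theorem logSum_reflect (S : List (ℝ × ℝ)) (y : ℝ) :
    logSum (reflect S) (-y) = -logSum S y := by
  induction S with
  | nil => simp [logSum, reflect]
  | cons r S ih =>
    simp only [logSum, reflect, List.map_cons, List.sum_cons] at ih ⊢
    rw [ih, show -y - -r.1 = -(y - r.1) by ring, sign_neg_coe, abs_neg]
    ring

theorem eqSum_reflect (S : List (ℝ × ℝ)) (y : ℝ) :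
    eqSum (reflect S) (-y) = eqSum S y := by
  induction S with
  | nil => simp [eqSum, reflect]
  | cons r S ih =>
    simp only [eqSum, reflect, List.map_cons, List.sum_cons] at ih ⊢
    rw [ih]; simp

theorem reflect_weights {S : List (ℝ × ℝ)} (hw : ∀ r ∈ S, 0 < r.2) :
    ∀ r ∈ reflect S, 0 < r.2 := by
  intro r hr
  obtain ⟨r', hr', rfl⟩ := List.mem_map.1 hr
  exact hw r' hr'

theorem slope_strictMono {q : ℝ} (hq : 0 < q) {S : List (ℝ × ℝ)} (hS : S ≠ [])
    (hw : ∀ r ∈ S, 0 < r.2) : StrictMono (slope q S) := by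
  intro x y hxy
  unfold slope
  refine List.sum_lt_sum_of_ne_nil hS _ _ fun r hr => ?_
  exact mul_lt_mul_of_pos_left (signPow_strictMono hq (by linarith)) (hw r hr)

/-! ### First-order expansion of the slope at `q = 0` -/

theorem signPow_hasDerivAt_zero (x : ℝ) :
    HasDerivAt (fun q => signPow q x) ((SignType.sign x : ℝ) * Real.log |x|) 0 := by
  unfold signPow
  rcases eq_or_ne x 0 with rfl | hx
  · simpa using hasDerivAt_const (0 : ℝ) (0 : ℝ)
  · have h := (Real.hasStrictDerivAt_const_rpow (abs_pos.2 hx) 0).hasDerivAt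
    simpa using h.const_mul (SignType.sign x : ℝ)

theorem slope_hasDerivAt_zero (S : List (ℝ × ℝ)) (y : ℝ) :
    HasDerivAt (fun q => slope q S y) (logSum S y) 0 := by
  induction S with
  | nil => simpa [slope, logSum] using hasDerivAt_const (0 : ℝ) (0 : ℝ)
  | cons r S ih =>
    simp only [slope, logSum, List.map_cons, List.sum_cons] at ih ⊢
    exact ((signPow_hasDerivAt_zero _).const_mul _).add ih

theorem slope_zero (S : List (ℝ × ℝ)) (y : ℝ) : slope 0 S y = signSum S y := by
  simp [slope, signSum, signPow]

theorem eventually_slope_pos_of_signSum {S : List (ℝ × ℝ)} {y : ℝ} (h : 0 < signSum S y) :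
    ∀ᶠ q in 𝓝[>] (0 : ℝ), 0 < slope q S y := by
  have hc := (slope_hasDerivAt_zero S y).continuousAt
  rw [← slope_zero] at h
  exact (hc.eventually (lt_mem_nhds h)).filter_mono nhdsWithin_le_nhds

/-- When the constant term of the expansion in `q` vanishes, the linear term decides the sign. -/
theorem eventually_slope_pos_of_logSum {S : List (ℝ × ℝ)} {y : ℝ} (h0 : signSum S y = 0)
    (h : 0 < logSum S y) : ∀ᶠ q in 𝓝[>] (0 : ℝ), 0 < slope q S y := by
  have hd := (slope_hasDerivAt_zero S y).tendsto_slope.mono_left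
    (nhdsWithin_mono (0 : ℝ) (fun x (hx : 0 < x) => hx.ne'))
  filter_upwards [hd.eventually (lt_mem_nhds h), self_mem_nhdsWithin] with q hq hq0
  rw [slope_def_field, slope_zero, h0, sub_zero, sub_zero] at hq
  exact (div_pos_iff_of_pos_right hq0).1 hq

/-! ### Behaviour of the coefficients just left of a point -/

theorem sign_left (v y : ℝ) : ∀ᶠ y' in 𝓝[<] y, (SignType.sign (y' - v) : ℝ) =
    (SignType.sign (y - v) : ℝ) - if v = y then 1 else 0 := by
  rcases lt_trichotomy v y with h | rfl | h
  · filter_upwards [(lt_mem_nhds h).filter_mono nhdsWithin_le_nhds] with y' hy'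
    simp [sign_pos (sub_pos.2 h), sign_pos (sub_pos.2 hy'), h.ne]
  · filter_upwards [self_mem_nhdsWithin] with y' hy'
    simp [sign_neg (sub_neg.2 (Set.mem_Iio.1 hy'))]
  · filter_upwards [(gt_mem_nhds h).filter_mono nhdsWithin_le_nhds] with y' hy'
    simp [sign_neg (sub_neg.2 h), sign_neg (sub_neg.2 hy'), h.ne']

/-- A value equal to `y` contributes nothing at `y`, and minus its weight immediately to the left;
all other contributions are locally constant. -/
theorem signSum_left (S : List (ℝ × ℝ)) (y : ℝ) :
    ∀ᶠ y' in 𝓝[<] y, signSum S y' = signSum S y - eqSum S y := by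
  induction S with
  | nil => simp [signSum, eqSum]
  | cons r S ih =>
    filter_upwards [ih, sign_left r.1 y] with y' h1 h2
    simp only [signSum, eqSum, List.map_cons, List.sum_cons] at h1 ⊢
    rw [h1, h2]
    split_ifs <;> ring

theorem signLog_continuousAt {v y : ℝ} (h : v ≠ y) :
    ContinuousAt (fun y' => (SignType.sign (y' - v) : ℝ) * Real.log |y' - v|) y := by
  have hne : y - v ≠ 0 := sub_ne_zero.2 h.symm
  refine ContinuousAt.mul ?_ ?_
  · have h1 : (fun y' => (SignType.sign (y' - v) : ℝ)) =ᶠ[𝓝 y]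
        fun _ => (SignType.sign (y - v) : ℝ) := by
      rcases lt_or_gt_of_ne h with h | h
      · filter_upwards [lt_mem_nhds h] with y' hy'
        rw [sign_pos (sub_pos.2 h), sign_pos (sub_pos.2 hy')]
      · filter_upwards [gt_mem_nhds h] with y' hy'
        rw [sign_neg (sub_neg.2 h), sign_neg (sub_neg.2 hy')]
    exact continuousAt_const.congr h1.symm
  · exact ContinuousAt.log (by fun_prop) (abs_ne_zero.2 hne)

/-- The sign is `-1` and the logarithm tends to `-∞`. This settles the tie `eqSum S y = signSum S y`
whenever some value equals `y`. -/
theorem signLog_left_atTop (y : ℝ) :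
    Tendsto (fun y' => (SignType.sign (y' - y) : ℝ) * Real.log |y' - y|) (𝓝[<] y) atTop := by
  have h1 : Tendsto (fun y' : ℝ => |y' - y|) (𝓝[<] y) (𝓝[>] 0) := by
    refine tendsto_nhdsWithin_iff.2 ⟨?_, ?_⟩
    · have : Continuous fun y' : ℝ => |y' - y| := by fun_prop
      simpa using (this.tendsto y).mono_left nhdsWithin_le_nhds
    · filter_upwards [self_mem_nhdsWithin] with y' hy'
      exact abs_pos.2 (sub_neg.2 (Set.mem_Iio.1 hy')).ne
  have h2 := tendsto_neg_atBot_atTop.comp (Real.tendsto_log_nhdsGT_zero.comp h1)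
  refine h2.congr' ?_
  filter_upwards [self_mem_nhdsWithin] with y' hy'
  simp [sign_neg (sub_neg.2 (Set.mem_Iio.1 hy'))]

theorem eqSum_nonneg {S : List (ℝ × ℝ)} (hw : ∀ r ∈ S, 0 < r.2) (y : ℝ) : 0 ≤ eqSum S y := by
  refine List.sum_nonneg fun x hx => ?_
  obtain ⟨r, hr, rfl⟩ := List.mem_map.1 hx
  split_ifs
  exacts [(hw r hr).le, le_rfl]

theorem logSum_left {S : List (ℝ × ℝ)} (hw : ∀ r ∈ S, 0 < r.2) (y : ℝ) :
    (eqSum S y = 0 → Tendsto (logSum S) (𝓝[<] y) (𝓝 (logSum S y))) ∧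
    (0 < eqSum S y → Tendsto (logSum S) (𝓝[<] y) atTop) := by
  induction S with
  | nil =>
    have h : logSum [] = fun _ => 0 := by ext; simp [logSum]
    simp [eqSum, h]
  | cons r S ih =>
    have hwS : ∀ r ∈ S, 0 < r.2 := fun r hr => hw r (List.mem_cons_of_mem _ hr)
    have hr := hw r List.mem_cons_self
    obtain ⟨ih1, ih2⟩ := ih hwS
    have hE := eqSum_nonneg hwS y
    have e1 : eqSum (r :: S) y = (if r.1 = y then r.2 else 0) + eqSum S y := by simp [eqSum]
    have e2 : logSum (r :: S) = fun y => r.2 * ((SignType.sign (y - r.1) : ℝ) *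
      Real.log |y - r.1|) + logSum S y := by ext y; simp [logSum]
    rw [e1, e2]
    by_cases h : r.1 = y
    · have ht : Tendsto (fun y' => r.2 * ((SignType.sign (y' - r.1) : ℝ) *
          Real.log |y' - r.1|)) (𝓝[<] y) atTop := by
        rw [h]; exact (signLog_left_atTop y).const_mul_atTop hr
      rw [if_pos h]
      refine ⟨fun h0 => by linarith, fun _ => ?_⟩
      rcases hE.eq_or_lt with h0 | h0
      · exact ht.atTop_add (ih1 h0.symm)
      · exact ht.atTop_add_atTop (ih2 h0)
    · have ht := ((signLog_continuousAt h).tendsto.mono_left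
        (nhdsWithin_le_nhds (s := Set.Iio y))).const_mul r.2
      rw [if_neg h, zero_add]
      exact ⟨fun h0 => ht.add (ih1 h0), fun h0 => ht.add_atTop (ih2 h0)⟩

/-- The function `sign x * log |x|` increases on each side of `0`, as its derivative is `1 / |x|`;
only the jump at `v` itself must be avoided. -/
theorem signLog_left_lt {v y : ℝ} (h : v ≠ y) : ∀ᶠ y' in 𝓝[<] y,
    (SignType.sign (y' - v) : ℝ) * Real.log |y' - v| <
      (SignType.sign (y - v) : ℝ) * Real.log |y - v| := by
  rcases lt_or_gt_of_ne h with h | h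
  · filter_upwards [(lt_mem_nhds h).filter_mono nhdsWithin_le_nhds, self_mem_nhdsWithin]
      with y' hy' hlt
    have hlt : y' < y := hlt
    simp only [sign_pos (sub_pos.2 h), sign_pos (sub_pos.2 hy'), SignType.coe_one, one_mul,
      abs_of_pos (sub_pos.2 h), abs_of_pos (sub_pos.2 hy')]
    exact Real.log_lt_log (sub_pos.2 hy') (by linarith)
  · filter_upwards [(gt_mem_nhds h).filter_mono nhdsWithin_le_nhds, self_mem_nhdsWithin]
      with y' hy' hlt
    have hlt : y' < y := hlt
    simp only [sign_neg (sub_neg.2 h), sign_neg (sub_neg.2 hy'), SignType.coe_neg_one,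
      neg_one_mul, abs_of_neg (sub_neg.2 h), abs_of_neg (sub_neg.2 hy'), neg_lt_neg_iff]
    exact Real.log_lt_log (by linarith) (by linarith)

theorem eqSum_pos_of_mem {S : List (ℝ × ℝ)} (hw : ∀ r ∈ S, 0 < r.2) {r : ℝ × ℝ} (hr : r ∈ S) :
    0 < eqSum S r.1 := by
  have h : (fun s : ℝ × ℝ => if s.1 = r.1 then s.2 else 0) r ≤ eqSum S r.1 := by
    refine List.single_le_sum ?_ _ (List.mem_map.2 ⟨r, hr, rfl⟩)
    intro x hx
    obtain ⟨s, hs, rfl⟩ := List.mem_map.1 hx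
    split_ifs
    exacts [(hw s hs).le, le_rfl]
  simp only [if_true] at h
  exact (hw r hr).trans_le h

theorem logSum_left_lt {S : List (ℝ × ℝ)} (hS : S ≠ []) (hw : ∀ r ∈ S, 0 < r.2) {y : ℝ}
    (h0 : eqSum S y = 0) : ∀ᶠ y' in 𝓝[<] y, logSum S y' < logSum S y := by
  have hall : ∀ r ∈ S, ∀ᶠ y' in 𝓝[<] y, (SignType.sign (y' - r.1) : ℝ) * Real.log |y' - r.1| <
      (SignType.sign (y - r.1) : ℝ) * Real.log |y - r.1| := by
    intro r hr
    refine signLog_left_lt ?_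
    rintro rfl
    exact (eqSum_pos_of_mem hw hr).ne' h0
  have hall' := (Filter.eventually_all_finite (List.finite_toSet S)).2 hall
  filter_upwards [hall'] with y' hy'
  exact List.sum_lt_sum_of_ne_nil hS _ _ fun r hr => mul_lt_mul_of_pos_left (hy' r hr) (hw r hr)

/-! ### The partitioning rule in terms of these sums -/

/-- The rule for "the limit mean is below `y`". -/
def RuleLT (S : List (ℝ × ℝ)) (y : ℝ) : Prop :=
  eqSum S y < signSum S y ∨ (eqSum S y = signSum S y ∧ (0 < eqSum S y ∨ 0 < logSum S y))

/-- The rule for "the limit mean is `y`". -/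
def RuleEQ (S : List (ℝ × ℝ)) (y : ℝ) : Prop :=
  |signSum S y| < eqSum S y ∨ (eqSum S y = 0 ∧ signSum S y = 0 ∧ logSum S y = 0)

/-- The sign is tested at a point strictly left of `y`, so that the conclusion about means stays
strict in the limit. Left of `y` the constant term is `signSum S y - eqSum S y`; if it is zero, the
logarithmic term is positive there. -/
theorem RuleLT.exists_slope_pos {S : List (ℝ × ℝ)} (hw : ∀ r ∈ S, 0 < r.2) {y : ℝ}
    (h : RuleLT S y) : ∃ y' < y, ∀ᶠ q in 𝓝[>] (0 : ℝ), 0 < slope q S y' := by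
  have key : ∀ᶠ y' in 𝓝[<] y, ∀ᶠ q in 𝓝[>] (0 : ℝ), 0 < slope q S y' := by
    rcases h with h | ⟨h, h'⟩
    · filter_upwards [signSum_left S y] with y' hy'
      exact eventually_slope_pos_of_signSum (by rw [hy']; linarith)
    · have hl : ∀ᶠ y' in 𝓝[<] y, 0 < logSum S y' := by
        rcases (eqSum_nonneg hw y).eq_or_lt with h0 | h0
        · have h' : 0 < logSum S y := h'.resolve_left (by rw [← h0]; exact lt_irrefl _)
          exact ((logSum_left hw y).1 h0.symm).eventually (lt_mem_nhds h')
        · exact ((logSum_left hw y).2 h0).eventually_gt_atTop 0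
      filter_upwards [signSum_left S y, hl] with y' hy' hl'
      exact eventually_slope_pos_of_logSum (by rw [hy']; linarith) hl'
  obtain ⟨y', hy', hlt⟩ := (key.and self_mem_nhdsWithin).exists
  exact ⟨y', hlt, hy'⟩

theorem eventually_slope_reflect {S : List (ℝ × ℝ)} {y : ℝ}
    (h : ∀ᶠ q in 𝓝[>] (0 : ℝ), 0 < slope q (reflect S) (-y)) :
    ∀ᶠ q in 𝓝[>] (0 : ℝ), slope q S y < 0 := by
  filter_upwards [h] with q hq
  rw [slope_reflect] at hq
  linarith

/-- The rule for "the limit mean is above `y`" is the rule for "below" applied to the reflected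
family; this spells it out in terms of `S`. -/
theorem reflect_ruleLT_iff {S : List (ℝ × ℝ)} {y : ℝ} : RuleLT (reflect S) (-y) ↔
    eqSum S y < -signSum S y ∨
      (eqSum S y = -signSum S y ∧ (0 < eqSum S y ∨ logSum S y < 0)) := by
  rw [RuleLT, signSum_reflect, eqSum_reflect, logSum_reflect, neg_pos]

theorem exists_slope_neg_of_reflect {S : List (ℝ × ℝ)} (hw : ∀ r ∈ S, 0 < r.2) {y : ℝ}
    (h : RuleLT (reflect S) (-y)) :
    ∃ y', y < y' ∧ ∀ᶠ q in 𝓝[>] (0 : ℝ), slope q S y' < 0 := by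
  obtain ⟨y', hy', h'⟩ := h.exists_slope_pos (reflect_weights hw)
  refine ⟨-y', by linarith, eventually_slope_reflect ?_⟩
  rwa [neg_neg]

theorem reflect_ne_nil {S : List (ℝ × ℝ)} (hS : S ≠ []) : reflect S ≠ [] := by
  simpa [reflect] using hS

theorem ruleEQ_reflect {S : List (ℝ × ℝ)} {y : ℝ} (h : RuleEQ S y) :
    RuleEQ (reflect S) (-y) := by
  unfold RuleEQ at *
  rwa [signSum_reflect, eqSum_reflect, logSum_reflect, abs_neg, neg_eq_zero, neg_eq_zero]

/-- Points just left of `y` have negative slopes for small `q`: either the constant term is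
negative, or it vanishes and `logSum` drops strictly below its value `0` at `y`. Monotonicity of the
slopes extends this to every smaller point. -/
theorem RuleEQ.slope_neg_of_lt {S : List (ℝ × ℝ)} (hS : S ≠ []) (hw : ∀ r ∈ S, 0 < r.2)
    {y y' : ℝ} (h : RuleEQ S y) (hy' : y' < y) :
    ∀ᶠ q in 𝓝[>] (0 : ℝ), slope q S y' < 0 := by
  have key : ∀ᶠ x in 𝓝[<] y, ∀ᶠ q in 𝓝[>] (0 : ℝ), slope q S x < 0 := by
    rcases h with h | ⟨h0, h1, h2⟩
    · filter_upwards [signSum_left S y] with x hx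
      refine eventually_slope_reflect (eventually_slope_pos_of_signSum ?_)
      rw [signSum_reflect, hx]
      linarith [le_abs_self (signSum S y)]
    · filter_upwards [signSum_left S y, logSum_left_lt hS hw h0] with x hx hl
      refine eventually_slope_reflect (eventually_slope_pos_of_logSum ?_ ?_)
      · rw [signSum_reflect, hx, h0, h1]; simp
      · rw [logSum_reflect]; linarith
  obtain ⟨x, hx, hlt⟩ := (key.and (Ioo_mem_nhdsLT hy')).exists
  filter_upwards [hx, self_mem_nhdsWithin] with q hq hq0
  exact (slope_strictMono hq0 hS hw hlt.1).trans hq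

theorem RuleEQ.slope_pos_of_gt {S : List (ℝ × ℝ)} (hS : S ≠ []) (hw : ∀ r ∈ S, 0 < r.2)
    {y y' : ℝ} (h : RuleEQ S y) (hy' : y < y') :
    ∀ᶠ q in 𝓝[>] (0 : ℝ), 0 < slope q S y' := by
  have := (ruleEQ_reflect h).slope_neg_of_lt (reflect_ne_nil hS) (reflect_weights hw)
    (neg_lt_neg hy')
  filter_upwards [this] with q hq
  rw [slope_reflect] at hq
  linarith

theorem rule_trichotomy {S : List (ℝ × ℝ)} (hw : ∀ r ∈ S, 0 < r.2) (y : ℝ) :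
    RuleLT S y ∨ RuleEQ S y ∨ RuleLT (reflect S) (-y) := by
  rw [reflect_ruleLT_iff]
  unfold RuleLT RuleEQ
  have h0 := eqSum_nonneg hw y
  rcases lt_trichotomy (eqSum S y) (signSum S y) with h | h | h
  · tauto
  · rcases h0.eq_or_lt with h0 | h0
    · rcases lt_trichotomy (logSum S y) 0 with hl | hl | hl
      · right; right; right; exact ⟨by linarith, Or.inr hl⟩
      · right; left; right; exact ⟨h0.symm, by linarith, hl⟩
      · left; right; exact ⟨h, Or.inr hl⟩
    · left; right; exact ⟨h, Or.inl h0⟩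
  · rcases lt_trichotomy (eqSum S y) (-signSum S y) with h' | h' | h'
    · tauto
    · right; right; right; exact ⟨h', Or.inl (by linarith)⟩
    · right; left; left; exact abs_lt.2 ⟨by linarith, h⟩

theorem exists_slope_pos {S : List (ℝ × ℝ)} (hS : S ≠ []) (hw : ∀ r ∈ S, 0 < r.2) :
    ∃ y, ∀ q, 0 < slope q S y := by
  have hb : ∃ y, ∀ r ∈ S, r.1 < y := by
    clear hS hw
    induction S with
    | nil => exact ⟨0, by simp⟩
    | cons r S ih =>
      obtain ⟨y, hy⟩ := ih
      refine ⟨max y (r.1 + 1), fun s hs => ?_⟩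
      rcases List.mem_cons.1 hs with rfl | hs
      · exact lt_max_of_lt_right (by linarith)
      · exact lt_max_of_lt_left (hy s hs)
  obtain ⟨y, hy⟩ := hb
  refine ⟨y, fun q => ?_⟩
  refine List.sum_pos _ (fun x hx => ?_) (by simpa using hS)
  obtain ⟨r, hr, rfl⟩ := List.mem_map.1 hx
  have := sub_pos.2 (hy r hr)
  have := hw r hr
  rw [signPow_of_pos (by assumption)]
  positivity

theorem exists_slope_neg {S : List (ℝ × ℝ)} (hS : S ≠ []) (hw : ∀ r ∈ S, 0 < r.2) :
    ∃ y, ∀ q, slope q S y < 0 := by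
  obtain ⟨y, hy⟩ := exists_slope_pos (reflect_ne_nil hS) (reflect_weights hw)
  refine ⟨-y, fun q => ?_⟩
  have := hy q
  rw [← neg_neg y, slope_reflect] at this
  linarith

/-- There is a point where the limit of the slopes changes sign. -/
theorem exists_slope_center {S : List (ℝ × ℝ)} (hS : S ≠ []) (hw : ∀ r ∈ S, 0 < r.2) :
    ∃ c, (∀ y < c, ∀ᶠ q in 𝓝[>] (0 : ℝ), slope q S y < 0) ∧
      (∀ y, c < y → ∀ᶠ q in 𝓝[>] (0 : ℝ), 0 < slope q S y) := by
  -- The candidate is the supremum of the points with eventually negative slope. `T` is downward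
  -- closed because the slopes increase.
  set T : Set ℝ := {y | ∀ᶠ q in 𝓝[>] (0 : ℝ), slope q S y < 0} with hT
  obtain ⟨lo, hlo⟩ := exists_slope_neg hS hw
  obtain ⟨hi, hhi⟩ := exists_slope_pos hS hw
  have hne : T.Nonempty := ⟨lo, show ∀ᶠ q in 𝓝[>] (0 : ℝ), slope q S lo < 0 from Eventually.of_forall hlo⟩
  have hub : ∀ y, (∀ᶠ q in 𝓝[>] (0 : ℝ), 0 < slope q S y) → ∀ x ∈ T, x < y := by
    intro y hy x hx
    obtain ⟨q, ⟨h1, h2⟩, h3⟩ := ((hy.and hx).and self_mem_nhdsWithin).exists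
    exact (slope_strictMono (S := S) h3 hS hw).lt_iff_lt.1 (h2.trans h1)
  have hbdd : BddAbove T := ⟨hi, fun x hx => (hub hi (Eventually.of_forall hhi) x hx).le⟩
  refine ⟨sSup T, fun y hy => ?_, fun y hy => ?_⟩
  · obtain ⟨x, hx, hyx⟩ := exists_lt_of_lt_csSup hne hy
    have hx : ∀ᶠ q in 𝓝[>] (0 : ℝ), slope q S x < 0 := hx
    filter_upwards [hx, self_mem_nhdsWithin] with q hq hq0
    exact (slope_strictMono hq0 hS hw hyx).trans hq
  -- Being outside `T` does not yet make the slopes eventually positive, as signs might oscillate in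
  -- `q`. The rule that applies at the supremum excludes this; the rule for "above" would put a
  -- larger point into `T`.
  · rcases rule_trichotomy hw (sSup T) with h | h | h
    · obtain ⟨y', hy', h'⟩ := h.exists_slope_pos hw
      filter_upwards [h', self_mem_nhdsWithin] with q hq hq0
      exact hq.trans (slope_strictMono hq0 hS hw (hy'.trans hy))
    · exact h.slope_pos_of_gt hS hw hy
    · obtain ⟨y', hy', h'⟩ := exists_slope_neg_of_reflect hw h
      exact absurd (le_csSup hbdd h') (not_le.2 hy')

/-! ### Existence of minimizers -/

theorem lpError_continuous {V : Type*} [Fintype V] {p : ℝ} (hp : 0 ≤ p) (f w : V → ℝ) :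
    Continuous (lpError p f w) := by
  unfold lpError
  refine continuous_finsetSum _ fun v _ => continuous_const.mul ?_
  exact Continuous.rpow_const (by fun_prop) fun _ => Or.inr hp

/-- A sublevel set is confined to a box around `f`, since each term alone is bounded by the total.
The constraint set is arbitrary and closed, so the lemma serves both monotone functions
(regressions) and constant functions (means). -/
theorem exists_lpError_min {V : Type*} [Fintype V] {p : ℝ} (hp : 0 < p) (f w : V → ℝ)
    (hw : ∀ v, 0 < w v) {K : Set (V → ℝ)} (hK : IsClosed K) (hne : K.Nonempty) :
    ∃ g ∈ K, ∀ h ∈ K, lpError p f w g ≤ lpError p f w h := by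
  obtain ⟨h₀, hh₀⟩ := hne
  set E := lpError p f w h₀
  set R : V → ℝ := fun v => (E / w v) ^ (1 / p)
  have hin : ∀ h, lpError p f w h ≤ E → h ∈ Set.Icc (f - R) (f + R) := by
    intro h hh
    have hR : ∀ v, |f v - h v| ≤ R v := by
      intro v
      have h1 : w v * |f v - h v| ^ p ≤ E :=
        (Finset.single_le_sum (f := fun v => w v * |f v - h v| ^ p)
          (fun u _ => mul_nonneg (hw u).le (by positivity)) (Finset.mem_univ v)).trans hh
      have h2 : |f v - h v| ^ p ≤ E / w v := by
        rw [le_div_iff₀ (hw v)]; linarith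
      have h3 := Real.rpow_le_rpow (by positivity) h2 (by positivity : 0 ≤ 1 / p)
      rwa [← Real.rpow_mul (abs_nonneg _), mul_one_div_cancel hp.ne', Real.rpow_one] at h3
    constructor <;> intro v <;> have := abs_le.1 (hR v) <;>
      simp only [Pi.sub_apply, Pi.add_apply] <;> linarith
  obtain ⟨g, ⟨hgK, -⟩, hg⟩ := (isCompact_Icc.inter_left hK).exists_isMinOn
    ⟨h₀, hh₀, hin h₀ le_rfl⟩ (lpError_continuous hp.le f w).continuousOn
  refine ⟨g, hgK, fun h hh => ?_⟩
  by_cases hE : lpError p f w h ≤ E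
  · exact hg ⟨hh, hin h hE⟩
  · exact (hg ⟨hh₀, hin h₀ le_rfl⟩ : lpError p f w g ≤ E).trans (not_le.1 hE).le

theorem exists_isLpRegression {V : Type*} [Fintype V] [Preorder V] {p : ℝ} (hp : 0 < p)
    (f w : V → ℝ) (hw : ∀ v, 0 < w v) : ∃ g, IsLpRegression p f w g := by
  have hcl : IsClosed {g : V → ℝ | Monotone g} := by
    simp only [Monotone, Set.ofPred_forall]
    exact isClosed_iInter fun a => isClosed_iInter fun b => isClosed_iInter fun _ =>
      isClosed_le (continuous_apply a) (continuous_apply b)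
  obtain ⟨g, hg, hmin⟩ := exists_lpError_min hp f w hw hcl ⟨0, monotone_const⟩
  exact ⟨g, hg, hmin⟩

theorem exists_isLpMean {p : ℝ} (hp : 0 < p) {S : List (ℝ × ℝ)} (hS : S ≠ [])
    (hw : ∀ r ∈ S, 0 < r.2) : ∃ c, IsLpMean p S c := by
  set K : Set (Fin S.length → ℝ) := {g | ∀ i j, g i = g j}
  have hcl : IsClosed K := by
    simp only [K, Set.ofPred_forall]
    exact isClosed_iInter fun a => isClosed_iInter fun b =>
      isClosed_eq (continuous_apply a) (continuous_apply b)
  obtain ⟨g, hg, hmin⟩ := exists_lpError_min hp (fun i : Fin S.length => S[i].1)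
    (fun i => S[i].2) (fun i => hw _ (List.getElem_mem _)) hcl ⟨0, fun _ _ => rfl⟩
  have key : ∀ c, lpError p (fun i : Fin S.length => S[i].1) (fun i => S[i].2) (fun _ => c) =
      (S.map fun q => q.2 * |q.1 - c| ^ p).sum := fun c =>
    Fin.sum_univ_fun_getElem S fun q => q.2 * |q.1 - c| ^ p
  have h0 : 0 < S.length := List.length_pos_iff.2 hS
  have hgc : g = fun _ => g ⟨0, h0⟩ := funext fun i => hg _ _
  refine ⟨g ⟨0, h0⟩, fun z => ?_⟩
  have := hmin (fun _ => z) fun _ _ => rfl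
  rw [hgc] at this
  rwa [key, key] at this

theorem hasDerivAt_blockError {q : ℝ} (hq : 0 < q) (S : List (ℝ × ℝ)) (c : ℝ) :
    HasDerivAt (fun z => (S.map fun r => r.2 * |r.1 - z| ^ (q + 1)).sum)
      ((q + 1) * slope q S c) c := by
  induction S with
  | nil => simpa [slope] using hasDerivAt_const c (0 : ℝ)
  | cons r S ih =>
    simp only [slope, List.map_cons, List.sum_cons] at ih ⊢
    have h := ((hasDerivAt_abs_rpow_signPow hq (c - r.1)).comp c
      ((hasDerivAt_id c).sub_const r.1)).const_mul r.2
    refine ((h.add ih).congr_deriv (by ring)).congr_of_eventuallyEq (Eventually.of_forall ?_)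
    intro z
    simp [abs_sub_comm]

theorem IsLpMean.slope_eq_zero {q : ℝ} (hq : 0 < q) {S : List (ℝ × ℝ)} {c : ℝ}
    (h : IsLpMean (q + 1) S c) : slope q S c = 0 := by
  have hmin : IsLocalMin (fun z => (S.map fun r => r.2 * |r.1 - z| ^ (q + 1)).sum) c :=
    Eventually.of_forall h
  have := hmin.hasDerivAt_eq_zero (hasDerivAt_blockError hq S c)
  exact (mul_eq_zero.1 this).resolve_left (by linarith)

/-! ### The limit mean -/

open Classical in
/-- The limit, as `p ↘ 1`, of the weighted `L_p` means of `S`. -/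
noncomputable def limMean (S : List (ℝ × ℝ)) : ℝ :=
  if h : S ≠ [] ∧ ∀ r ∈ S, 0 < r.2 then (exists_slope_center h.1 h.2).choose else 0

theorem limMean_spec {S : List (ℝ × ℝ)} (hS : S ≠ []) (hw : ∀ r ∈ S, 0 < r.2) :
    (∀ y < limMean S, ∀ᶠ q in 𝓝[>] (0 : ℝ), slope q S y < 0) ∧
      (∀ y, limMean S < y → ∀ᶠ q in 𝓝[>] (0 : ℝ), 0 < slope q S y) := by
  rw [limMean, dif_pos ⟨hS, hw⟩]
  exact (exists_slope_center hS hw).choose_spec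

theorem tendsto_sub_one : Tendsto (fun p : ℝ => p - 1) (𝓝[>] 1) (𝓝[>] 0) := by
  refine tendsto_nhdsWithin_iff.2 ⟨?_, ?_⟩
  · have : Continuous fun p : ℝ => p - 1 := by fun_prop
    simpa using (this.tendsto 1).mono_left nhdsWithin_le_nhds
  · filter_upwards [self_mem_nhdsWithin] with p hp
    exact sub_pos.2 (Set.mem_Ioi.1 hp)

/-- A mean is a zero of an increasing slope. On either side of `limMean S` the slopes eventually
have opposite strict signs, which traps the zero. -/
theorem tendsto_limMean {S : List (ℝ × ℝ)} (hS : S ≠ []) (hw : ∀ r ∈ S, 0 < r.2) {m : ℝ → ℝ}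
    (hm : ∀ p, 1 < p → IsLpMean p S (m p)) : Tendsto m (𝓝[>] 1) (𝓝 (limMean S)) := by
  have h0 : ∀ p, 1 < p → slope (p - 1) S (m p) = 0 := fun p hp =>
    IsLpMean.slope_eq_zero (sub_pos.2 hp) (by rw [sub_add_cancel]; exact hm p hp)
  refine tendsto_order.2 ⟨fun y hy => ?_, fun y hy => ?_⟩
  · filter_upwards [tendsto_sub_one.eventually ((limMean_spec hS hw).1 y hy),
      self_mem_nhdsWithin] with p hp hp1
    rw [← h0 p hp1] at hp
    exact (slope_strictMono (sub_pos.2 hp1) hS hw).lt_iff_lt.1 hp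
  · filter_upwards [tendsto_sub_one.eventually ((limMean_spec hS hw).2 y hy),
      self_mem_nhdsWithin] with p hp hp1
    rw [← h0 p hp1] at hp
    exact (slope_strictMono (sub_pos.2 hp1) hS hw).lt_iff_lt.1 hp

theorem isMeanDownOne_iff {S : List (ℝ × ℝ)} (hS : S ≠ []) (hw : ∀ r ∈ S, 0 < r.2) (c : ℝ) :
    IsMeanDownOne S c ↔ c = limMean S := by
  constructor
  · rintro ⟨m, hm, ht⟩
    exact tendsto_nhds_unique ht (tendsto_limMean hS hw hm)
  · rintro rfl
    have hex : ∀ p : ℝ, ∃ c, 1 < p → IsLpMean p S c := fun p => by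
      by_cases hp : 1 < p
      · exact (exists_isLpMean (by linarith) hS hw).imp fun c hc _ => hc
      · exact ⟨0, fun h => absurd h hp⟩
    choose m hm using hex
    exact ⟨m, hm, tendsto_limMean hS hw hm⟩

theorem RuleLT.limMean_lt {S : List (ℝ × ℝ)} (hS : S ≠ []) (hw : ∀ r ∈ S, 0 < r.2) {y : ℝ}
    (h : RuleLT S y) : limMean S < y := by
  obtain ⟨y', hy', hs⟩ := h.exists_slope_pos hw
  refine lt_of_le_of_lt (not_lt.1 fun hlt => ?_) hy'
  obtain ⟨q, h1, h2⟩ := (hs.and ((limMean_spec hS hw).1 y' hlt)).exists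
  exact lt_asymm h1 h2

theorem lt_limMean_of_reflect {S : List (ℝ × ℝ)} (hS : S ≠ []) (hw : ∀ r ∈ S, 0 < r.2) {y : ℝ}
    (h : RuleLT (reflect S) (-y)) : y < limMean S := by
  obtain ⟨y', hy', hs⟩ := exists_slope_neg_of_reflect hw h
  refine lt_of_lt_of_le hy' (not_lt.1 fun hlt => ?_)
  obtain ⟨q, h1, h2⟩ := (hs.and ((limMean_spec hS hw).2 y' hlt)).exists
  exact lt_asymm h1 h2

theorem RuleEQ.limMean_eq {S : List (ℝ × ℝ)} (hS : S ≠ []) (hw : ∀ r ∈ S, 0 < r.2) {y : ℝ}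
    (h : RuleEQ S y) : limMean S = y := by
  refine le_antisymm (not_lt.1 fun hlt => ?_) (not_lt.1 fun hlt => ?_)
  · obtain ⟨z, hz1, hz2⟩ := exists_between hlt
    obtain ⟨q, h1, h2⟩ := ((h.slope_pos_of_gt hS hw hz1).and
      ((limMean_spec hS hw).1 z hz2)).exists
    exact lt_asymm h1 h2
  · obtain ⟨z, hz1, hz2⟩ := exists_between hlt
    obtain ⟨q, h1, h2⟩ := ((h.slope_neg_of_lt hS hw hz2).and
      ((limMean_spec hS hw).2 z hz1)).exists
    exact lt_asymm h1 h2

/-! ### The limit of the isotonic regressions -/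

/-- The data of the vertices `s ≤ i < e`. -/
def blockData {n : ℕ} (f w : Fin n → ℝ) (s e : ℕ) : List (ℝ × ℝ) :=
  ((dataOf f w).take e).drop s

/-- A monotone function is stable if the limit mean of a block at the lower end of an upper level
set is at least the level, and dually. -/
structure IsStable {n : ℕ} (f w g : Fin n → ℝ) : Prop where
  mono : Monotone g
  le_mean : ∀ (s e : ℕ) (c : ℝ), s < e → e ≤ n → (∀ i : Fin n, s ≤ i → i < e → c ≤ g i) →
    (∀ i : Fin n, i < s → g i < c) → c ≤ limMean (blockData f w s e)
  mean_le : ∀ (s e : ℕ) (c : ℝ), s < e → e ≤ n → (∀ i : Fin n, s ≤ i → i < e → g i ≤ c) →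
    (∀ i : Fin n, e ≤ i → c < g i) → limMean (blockData f w s e) ≤ c

theorem sum_blockData {n : ℕ} (f w : Fin n → ℝ) {s e : ℕ} (hse : s ≤ e)
    (φ : ℝ × ℝ → ℝ) : ((blockData f w s e).map φ).sum =
      ∑ i : Fin n, if s ≤ i ∧ (i : ℕ) < e then φ (f i, w i) else 0 := by
  have h1 : (dataOf f w).map φ = List.ofFn fun i => φ (f i, w i) := by
    simp [dataOf, List.map_ofFn, Function.comp_def]
  rw [blockData, List.map_drop, List.map_take, h1]
  have h2 := List.sum_take_add_sum_drop ((List.ofFn fun i => φ (f i, w i)).take e) s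
  rw [List.take_take, min_eq_left hse, List.sum_take_ofFn, List.sum_take_ofFn,
    Finset.sum_filter, Finset.sum_filter] at h2
  rw [← eq_sub_iff_add_eq'] at h2
  rw [h2, ← Finset.sum_sub_distrib]
  refine Finset.sum_congr rfl fun i _ => ?_
  split_ifs <;> first | omega | simp

theorem blockData_ne_nil {n : ℕ} (f w : Fin n → ℝ) {s e : ℕ} (hse : s < e) (he : e ≤ n) :
    blockData f w s e ≠ [] := by
  rw [← List.length_pos_iff]
  simp [blockData, dataOf]
  omega

theorem blockData_pos {n : ℕ} {f w : Fin n → ℝ} (hw : ∀ i, 0 < w i) (s e : ℕ) :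
    ∀ r ∈ blockData f w s e, 0 < r.2 := by
  intro r hr
  have := List.mem_of_mem_take (List.mem_of_mem_drop hr)
  obtain ⟨i, rfl⟩ := (List.mem_ofFn' _ _).1 this
  exact hw i

/-! ### First-order conditions for regressions -/

theorem deriv_nonneg_of_right_min {Φ : ℝ → ℝ} {d : ℝ} (hd : HasDerivAt Φ d 0)
    (hmin : ∀ᶠ t in 𝓝[>] (0 : ℝ), Φ 0 ≤ Φ t) : 0 ≤ d := by
  by_contra! h
  have hs := hd.tendsto_slope.mono_left
    (nhdsWithin_mono (0 : ℝ) (s := Set.Ioi 0) (fun x hx => (Set.mem_Ioi.1 hx).ne'))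
  obtain ⟨t, ⟨h1, h2⟩, h3⟩ :=
    ((hs.eventually (gt_mem_nhds h)).and hmin |>.and self_mem_nhdsWithin).exists
  rw [slope_def_field, sub_zero] at h1
  exact absurd h1 (not_lt.2 (div_nonneg (sub_nonneg.2 h2) (le_of_lt h3)))

/-- Move the vertices in `A` by `σ * t`. Only small positive `t` need be feasible, so minimality
gives a sign of the one-sided derivative rather than its vanishing. -/
theorem shift_derivative {n : ℕ} {q σ : ℝ} (hq : 0 < q) {f w r : Fin n → ℝ}
    (hr : IsLpRegression (q + 1) f w r) (A : Fin n → Prop) [DecidablePred A]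
    (hA : ∀ᶠ t in 𝓝[>] (0 : ℝ), Monotone fun i => r i + if A i then σ * t else 0) :
    0 ≤ σ * ∑ i, if A i then w i * signPow q (r i - f i) else 0 := by
  have hd : HasDerivAt (fun t => lpError (q + 1) f w fun i => r i + if A i then σ * t else 0)
      (∑ i, (q + 1) * σ * if A i then w i * signPow q (r i - f i) else 0) 0 := by
    unfold lpError
    refine HasDerivAt.fun_sum fun i _ => ?_
    by_cases hi : A i
    · simp only [if_pos hi]
      have h1 : HasDerivAt (fun t : ℝ => r i + σ * t - f i) σ 0 := by
        simpa using (((hasDerivAt_id (0 : ℝ)).const_mul σ).const_add (r i)).sub_const (f i)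
      have h2 := (HasDerivAt.comp (0 : ℝ)
        (hasDerivAt_abs_rpow_signPow hq (r i + σ * 0 - f i)) h1).const_mul (w i)
      refine (h2.congr_deriv ?_).congr_of_eventuallyEq (Eventually.of_forall ?_)
      · simp only [mul_zero, add_zero]; ring
      · intro t; simp only [Function.comp_apply]; rw [abs_sub_comm]
    · simp only [if_neg hi, mul_zero]
      exact hasDerivAt_const _ _
  have h0 := deriv_nonneg_of_right_min hd (by
    filter_upwards [hA] with t ht
    simpa using hr.2 _ ht)
  rw [← Finset.mul_sum, mul_assoc] at h0
  exact nonneg_of_mul_nonneg_right h0 (by linarith)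

/-- The block can be lowered slightly without meeting the vertices before it, all strictly below
`c`. This bounds the sum of the slope terms at the values of `r`, and replacing these values by the
smaller `c` only decreases it. -/
theorem IsLpRegression.slope_nonpos {n : ℕ} {q : ℝ} (hq : 0 < q) {f w r : Fin n → ℝ}
    (hw : ∀ i, 0 < w i) (hr : IsLpRegression (q + 1) f w r) {s e : ℕ} {c : ℝ} (hse : s ≤ e)
    (hA : ∀ i : Fin n, s ≤ i → i < e → c ≤ r i) (hB : ∀ i : Fin n, i < s → r i < c) :
    slope q (blockData f w s e) c ≤ 0 := by
  have hev : ∀ᶠ t in 𝓝[>] (0 : ℝ), ∀ i : Fin n, i < s → r i < c - t := by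
    rw [eventually_all]
    intro i
    by_cases hi : i < s
    · have : ∀ᶠ t in 𝓝 (0 : ℝ), t < c - r i := gt_mem_nhds (by linarith [hB i hi])
      filter_upwards [this.filter_mono nhdsWithin_le_nhds] with t ht _
      linarith
    · exact Eventually.of_forall fun t h => absurd h hi
  have h := shift_derivative (σ := -1) hq hr (fun i => s ≤ i ∧ (i : ℕ) < e) (by
    filter_upwards [hev, self_mem_nhdsWithin] with t ht ht0 i j hij
    have ht0 : 0 < t := ht0
    have hm := hr.1 hij
    have hij : (i : ℕ) ≤ j := hij
    dsimp only
    split_ifs with h1 h2 h2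
    · linarith
    · linarith
    · have h3 := ht i (by omega)
      have h4 := hA j h2.1 h2.2
      linarith
    · linarith)
  rw [slope, sum_blockData f w hse]
  refine le_trans (Finset.sum_le_sum fun i _ => ?_) (by linarith : (∑ i : Fin n,
    if s ≤ i ∧ (i : ℕ) < e then w i * signPow q (r i - f i) else 0) ≤ 0)
  split_ifs with h1
  · exact mul_le_mul_of_nonneg_left ((signPow_strictMono hq).monotone
      (by linarith [hA i h1.1 h1.2])) (hw i).le
  · exact le_rfl

theorem IsLpRegression.slope_nonneg {n : ℕ} {q : ℝ} (hq : 0 < q) {f w r : Fin n → ℝ}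
    (hw : ∀ i, 0 < w i) (hr : IsLpRegression (q + 1) f w r) {s e : ℕ} {c : ℝ} (hse : s ≤ e)
    (hA : ∀ i : Fin n, s ≤ i → i < e → r i ≤ c) (hB : ∀ i : Fin n, e ≤ i → c < r i) :
    0 ≤ slope q (blockData f w s e) c := by
  have hev : ∀ᶠ t in 𝓝[>] (0 : ℝ), ∀ i : Fin n, e ≤ i → c + t < r i := by
    rw [eventually_all]
    intro i
    by_cases hi : e ≤ i
    · have : ∀ᶠ t in 𝓝 (0 : ℝ), t < r i - c := gt_mem_nhds (by linarith [hB i hi])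
      filter_upwards [this.filter_mono nhdsWithin_le_nhds] with t ht _
      linarith
    · exact Eventually.of_forall fun t h => absurd h hi
  have h := shift_derivative (σ := 1) hq hr (fun i => s ≤ i ∧ (i : ℕ) < e) (by
    filter_upwards [hev, self_mem_nhdsWithin] with t ht ht0 i j hij
    have ht0 : 0 < t := ht0
    have hm := hr.1 hij
    have hij : (i : ℕ) ≤ j := hij
    dsimp only
    split_ifs with h1 h2 h2
    · linarith
    · have h3 := ht j (by omega)
      have h4 := hA i h1.1 h1.2
      linarith
    · linarith
    · linarith)
  rw [slope, sum_blockData f w hse]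
  refine le_trans (by linarith : 0 ≤ (∑ i : Fin n,
    if s ≤ i ∧ (i : ℕ) < e then w i * signPow q (r i - f i) else 0))
    (Finset.sum_le_sum fun i _ => ?_)
  split_ifs with h1
  · exact mul_le_mul_of_nonneg_left ((signPow_strictMono hq).monotone
      (by linarith [hA i h1.1 h1.2])) (hw i).le
  · exact le_rfl

theorem exists_forall_lt_between {n : ℕ} {A : Fin n → Prop} {h : Fin n → ℝ} {m c : ℝ}
    (hm : m < c) (hA : ∀ i, A i → h i < c) : ∃ c', m < c' ∧ c' < c ∧ ∀ i, A i → h i < c' := by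
  have hev : ∀ᶠ x in 𝓝[<] c, ∀ i, A i → h i < x := by
    rw [eventually_all]
    intro i
    by_cases hi : A i
    · filter_upwards [(lt_mem_nhds (hA i hi)).filter_mono nhdsWithin_le_nhds] with x hx _ using hx
    · exact Eventually.of_forall fun _ h => absurd h hi
  obtain ⟨x, hx, hlt⟩ := (hev.and (Ioo_mem_nhdsLT hm)).exists
  exact ⟨x, hlt.1, hlt.2, hx⟩

/-- If stability fails, the first-order condition for `p` near `1` contradicts the eventual sign of
the block's slope. Any filter finer than `𝓝[>] 1` is allowed, so that cluster points can be treated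
as limits along ultrafilters. -/
theorem isStable_of_tendsto {n : ℕ} {f w : Fin n → ℝ} (hw : ∀ i, 0 < w i)
    {r : ℝ → Fin n → ℝ} (hr : ∀ p, 1 < p → IsLpRegression p f w (r p)) {F : Filter ℝ} [F.NeBot]
    (hF : F ≤ 𝓝[>] 1) {g : Fin n → ℝ} (hg : Tendsto r F (𝓝 g)) : IsStable f w g := by
  have hp1 : ∀ᶠ p in F, 1 < p := hF self_mem_nhdsWithin
  have hgi := tendsto_pi_nhds.1 hg
  refine ⟨fun i j hij => ?_, fun s e c hse he hA hB => ?_, fun s e c hse he hA hB => ?_⟩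
  · exact le_of_tendsto_of_tendsto (hgi i) (hgi j) (hp1.mono fun p hp => (hr p hp).1 hij)
  · by_contra! hlt
    -- The level is lowered strictly, to a value above the mean and above all earlier values. The
    -- inequalities defining the block thereby become strict and pass from the limit to nearby
    -- regressions.
    obtain ⟨c', h1, h2, h3⟩ := exists_forall_lt_between hlt hB
    have hs := hF (tendsto_sub_one.eventually
      ((limMean_spec (blockData_ne_nil f w hse he) (blockData_pos hw s e)).2 c' h1))
    have hev : ∀ᶠ p in F, ∀ i : Fin n, (s ≤ i → i < e → c' < r p i) ∧ (i < s → r p i < c') := by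
      rw [eventually_all]
      intro i
      by_cases hi : (i : ℕ) < s
      · filter_upwards [(hgi i).eventually (gt_mem_nhds (h3 i hi))] with p hp
        exact ⟨fun h => by omega, fun _ => hp⟩
      · by_cases hi' : (i : ℕ) < e
        · filter_upwards [(hgi i).eventually
            (lt_mem_nhds (h2.trans_le (hA i (not_lt.1 hi) hi')))] with p hp
          exact ⟨fun _ _ => hp, fun h => absurd h hi⟩
        · exact Eventually.of_forall fun p => ⟨fun _ h => absurd h hi', fun h => absurd h hi⟩
    obtain ⟨p, ⟨hp, hs⟩, hev⟩ := ((hp1.and hs).and hev).exists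
    have := IsLpRegression.slope_nonpos (q := p - 1) (sub_pos.2 hp) hw
      (by rw [sub_add_cancel]; exact hr p hp) hse.le (fun i h h' => ((hev i).1 h h').le)
      fun i h => (hev i).2 h
    exact absurd hs (not_lt.2 this)
  · by_contra! hlt
    obtain ⟨c', h1, h2, h3⟩ := exists_forall_lt_between (h := fun i => -g i)
      (neg_lt_neg hlt) (fun i hi => neg_lt_neg (hB i hi))
    have hs := hF (tendsto_sub_one.eventually
      ((limMean_spec (blockData_ne_nil f w hse he) (blockData_pos hw s e)).1 (-c') (by linarith)))
    have hev : ∀ᶠ p in F, ∀ i : Fin n,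
        (s ≤ i → i < e → r p i < -c') ∧ (e ≤ i → -c' < r p i) := by
      rw [eventually_all]
      intro i
      by_cases hi : e ≤ (i : ℕ)
      · filter_upwards [(hgi i).eventually
          (lt_mem_nhds (by linarith [h3 i hi] : -c' < g i))] with p hp
        exact ⟨fun h => by omega, fun _ => hp⟩
      · by_cases hi' : s ≤ (i : ℕ)
        · filter_upwards [(hgi i).eventually (gt_mem_nhds
            (by linarith [hA i hi' (not_le.1 hi)] : g i < -c'))] with p hp
          exact ⟨fun _ _ => hp, fun h => absurd h hi⟩
        · exact Eventually.of_forall fun p => ⟨fun h => absurd h hi', fun h => absurd h hi⟩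
    obtain ⟨p, ⟨hp, hs⟩, hev⟩ := ((hp1.and hs).and hev).exists
    have := IsLpRegression.slope_nonneg (q := p - 1) (sub_pos.2 hp) hw
      (by rw [sub_add_cancel]; exact hr p hp) hse.le (fun i h h' => ((hev i).1 h h').le)
      fun i h => (hev i).2 h
    exact absurd hs (not_lt.2 this)

/-- If `g i < g' i`, consider the block from the first vertex where `g'` exceeds `g i` to the last
where `g` is at most `g i`. Stability of `g` puts its limit mean at or below `g i`, and stability of
`g'` puts it above. -/
theorem IsStable.le_of_isStable {n : ℕ} {f w g g' : Fin n → ℝ} (hg : IsStable f w g)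
    (hg' : IsStable f w g') (i : Fin n) : g' i ≤ g i := by
  by_contra! hlt
  classical
  have hP : ∃ j : ℕ, ∃ h : j < n, g i < g' ⟨j, h⟩ := ⟨i, i.2, hlt⟩
  -- Allowing `j = n`, where the condition is vacuous, covers the case that no vertex has a larger
  -- value of `g`.
  have hQ : ∃ j : ℕ, j ≤ n ∧ ∀ h : j < n, g i < g ⟨j, h⟩ := ⟨n, le_rfl, fun h => by omega⟩
  obtain ⟨hsn, hs⟩ := Nat.find_spec hP
  obtain ⟨hen, he⟩ := Nat.find_spec hQ
  set s := Nat.find hP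
  set e := Nat.find hQ
  have hsi : s ≤ i := Nat.find_min' hP ⟨i.2, hlt⟩
  have hA : ∀ j : Fin n, (j : ℕ) < e → g j ≤ g i := by
    intro j hj
    by_contra! h
    exact Nat.find_min hQ hj ⟨j.2.le, fun _ => h⟩
  have hie : (i : ℕ) < e := by
    by_contra! h
    have h1 := he (by omega)
    have h2 : g ⟨e, by omega⟩ ≤ g i := hg.mono (show e ≤ (i : ℕ) from h)
    linarith
  have h1 := hg.mean_le s e (g i) (by omega) hen (fun j _ hj => hA j hj) (fun j hj =>
    (he (by omega)).trans_le (hg.mono (show e ≤ (j : ℕ) from hj)))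
  have h2 := hg'.le_mean s e (g' ⟨s, hsn⟩) (by omega) hen
    (fun j hj _ => hg'.mono (show s ≤ (j : ℕ) from hj)) (fun j hj => by
      have := Nat.find_min hP hj
      push Not at this
      exact (this j.2).trans_lt hs)
  linarith

theorem IsStable.unique {n : ℕ} {f w g g' : Fin n → ℝ} (hg : IsStable f w g)
    (hg' : IsStable f w g') : g = g' :=
  funext fun i => le_antisymm (hg'.le_of_isStable hg i) (hg.le_of_isStable hg' i)

theorem abs_sub_clamp {a b x y : ℝ} (hx : a ≤ x ∧ x ≤ b) :
    |x - max a (min b y)| ≤ |x - y| ∧ (¬ (a ≤ y ∧ y ≤ b) → |x - max a (min b y)| < |x - y|) := by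
  rcases lt_or_ge y a with h | h
  · have : max a (min b y) = a := max_eq_left ((min_le_right _ _).trans h.le)
    rw [this, abs_of_nonneg (by linarith), abs_of_nonneg (by linarith)]
    exact ⟨by linarith, fun _ => by linarith⟩
  rcases lt_or_ge b y with h' | h'
  · have : max a (min b y) = b := by rw [min_eq_left h'.le, max_eq_right (by linarith)]
    rw [this, abs_of_nonpos (by linarith), abs_of_nonpos (by linarith)]
    exact ⟨by linarith, fun _ => by linarith⟩
  · rw [min_eq_right h', max_eq_right h]
    exact ⟨le_rfl, fun hn => absurd ⟨h, h'⟩ hn⟩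

/-- Clamping a monotone function to an interval that contains the data keeps it monotone, and
strictly decreases the error if it changes anything. -/
theorem IsLpRegression.mem_Icc {n : ℕ} {p : ℝ} (hp : 0 < p) {f w r : Fin n → ℝ}
    (hw : ∀ i, 0 < w i) (hr : IsLpRegression p f w r) {a b : ℝ}
    (hf : ∀ i, a ≤ f i ∧ f i ≤ b) (i : Fin n) : a ≤ r i ∧ r i ≤ b := by
  by_contra hi
  have hm : Monotone fun j => max a (min b (r j)) := fun j k hjk =>
    max_le_max le_rfl (min_le_min le_rfl (hr.1 hjk))
  refine absurd (hr.2 _ hm) (not_le.2 ?_)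
  refine Finset.sum_lt_sum (fun j _ => ?_) ⟨i, Finset.mem_univ i, ?_⟩
  · exact mul_le_mul_of_nonneg_left (Real.rpow_le_rpow (abs_nonneg _)
      (abs_sub_clamp (hf j)).1 hp.le) (hw j).le
  · exact mul_lt_mul_of_pos_left (Real.rpow_lt_rpow (abs_nonneg _)
      ((abs_sub_clamp (hf i)).2 hi) hp) (hw i)

/-- The limit of the isotonic regressions exists, is unique, and is the stable function. -/
theorem exists_strictDownOne {n : ℕ} (f w : Fin n → ℝ) (hw : ∀ i, 0 < w i) :
    ∃ g : Fin n → ℝ, (∀ g', IsStrictDownOne f w g' ↔ g' = g) ∧ IsStable f w g ∧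
      ∀ a b, (∀ i, a ≤ f i ∧ f i ≤ b) → ∀ i, a ≤ g i ∧ g i ≤ b := by
  have hex : ∀ p : ℝ, ∃ r, 1 < p → IsLpRegression p f w r := fun p => by
    by_cases hp : 1 < p
    · exact (exists_isLpRegression (by linarith) f w hw).imp fun c hc _ => hc
    · exact ⟨0, fun h => absurd h hp⟩
  choose r hr using hex
  have hf : ∀ i, -‖f‖ ≤ f i ∧ f i ≤ ‖f‖ := fun i => abs_le.1 (norm_le_pi_norm f i)
  have hK : IsCompact (Set.Icc (fun _ : Fin n => -‖f‖) fun _ => ‖f‖) := isCompact_Icc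
  have hmem : ∀ r : ℝ → Fin n → ℝ, (∀ p, 1 < p → IsLpRegression p f w (r p)) →
      ∀ᶠ p in 𝓝[>] (1 : ℝ), r p ∈ Set.Icc (fun _ : Fin n => -‖f‖) fun _ => ‖f‖ := by
    intro r hr
    filter_upwards [self_mem_nhdsWithin] with p hp
    have hp : (1 : ℝ) < p := hp
    exact ⟨fun i => ((hr p hp).mem_Icc (by linarith) hw hf i).1,
      fun i => ((hr p hp).mem_Icc (by linarith) hw hf i).2⟩
  -- Compactness supplies one cluster point for one choice of regressions. By stability it is the
  -- only cluster point for every choice, hence their common limit.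
  obtain ⟨g, -, hg⟩ := hK.exists_mapClusterPt (le_principal_iff.2 (mem_map.2 (hmem r hr)))
  have hst : ∀ r : ℝ → Fin n → ℝ, (∀ p, 1 < p → IsLpRegression p f w (r p)) →
      ∀ g, MapClusterPt g (𝓝[>] 1) r → IsStable f w g := by
    intro r hr g hg
    obtain ⟨F, hF, hF'⟩ := mapClusterPt_iff_ultrafilter.1 hg
    exact isStable_of_tendsto hw hr hF hF'
  have hlim : ∀ r : ℝ → Fin n → ℝ, (∀ p, 1 < p → IsLpRegression p f w (r p)) →
      Tendsto r (𝓝[>] 1) (𝓝 g) := fun r' hr' =>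
    hK.tendsto_nhds_of_unique_mapClusterPt (hmem r' hr') fun g' _ hg' =>
      (hst r' hr' g' hg').unique (hst r hr g hg)
  refine ⟨g, fun g' => ⟨?_, ?_⟩, hst r hr g hg, fun a b hab i => ?_⟩
  · rintro ⟨r', hr', ht⟩
    exact tendsto_nhds_unique ht (hlim r' hr')
  · rintro rfl
    exact ⟨r, hr, hlim r hr⟩
  · have hi := tendsto_pi_nhds.1 (hlim r hr) i
    have hev : ∀ᶠ p in 𝓝[>] (1 : ℝ), a ≤ r p i ∧ r p i ≤ b := by
      filter_upwards [self_mem_nhdsWithin] with p hp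
      have hp : (1 : ℝ) < p := hp
      exact (hr p hp).mem_Icc (by linarith) hw hab i
    exact ⟨ge_of_tendsto hi (hev.mono fun _ h => h.1), le_of_tendsto hi (hev.mono fun _ h => h.2)⟩

/-! ### Running programs on the step-counting machine -/

/-- The program `c` halts with result `x`, and its number of steps is between `lo` and `hi`. -/
def RunsIn {α : Type} (c : RAM α) (x : α) (lo hi : ℕ) : Prop :=
  ∃ t, lo ≤ t ∧ t ≤ hi ∧ ∀ s, c.run s = some (x, s + t)

theorem RunsIn.mono {α : Type} {c : RAM α} {x : α} {lo hi lo' hi' : ℕ} (h : RunsIn c x lo hi)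
    (hlo : lo' ≤ lo) (hhi : hi ≤ hi') : RunsIn c x lo' hi' := by
  obtain ⟨t, h1, h2, h3⟩ := h
  exact ⟨t, hlo.trans h1, h2.trans hhi, h3⟩

theorem RunsIn.pure {α : Type} (x : α) : RunsIn (pure x : RAM α) x 0 0 :=
  ⟨0, le_rfl, le_rfl, fun _ => rfl⟩

theorem RunsIn.bind {α β : Type} {c : RAM α} {x : α} {k : α → RAM β} {y : β}
    {lo hi lo' hi' : ℕ} (h : RunsIn c x lo hi) (hk : RunsIn (k x) y lo' hi') :
    RunsIn (c >>= k) y (lo + lo') (hi + hi') := by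
  obtain ⟨t, h1, h2, h3⟩ := h
  obtain ⟨u, h4, h5, h6⟩ := hk
  refine ⟨t + u, by omega, by omega, fun s => ?_⟩
  rw [StateT.run_bind, h3]
  simp only [Option.bind_eq_bind, Option.bind_some, h6, add_assoc]

theorem RunsIn.tick : RunsIn tick () 1 1 := ⟨1, le_rfl, le_rfl, fun _ => rfl⟩

theorem RunsIn.tick_bind {β : Type} {k : Unit → RAM β} {y : β} {lo hi : ℕ}
    (hk : RunsIn (k ()) y lo hi) : RunsIn (StrictIso.tick >>= k) y (1 + lo) (1 + hi) :=
  RunsIn.tick.bind hk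

theorem RunsIn.haltsWith {α : Type} {c : RAM α} {x : α} {lo hi : ℕ} (h : RunsIn c x lo hi) :
    ∃ t, lo ≤ t ∧ t ≤ hi ∧ HaltsWith c x t := by
  obtain ⟨t, h1, h2, h3⟩ := h
  exact ⟨t, h1, h2, by simpa [HaltsWith] using h3 0⟩

theorem RunsIn.of_run {α : Type} {c : RAM α} {x : α} (t : ℕ)
    (h : ∀ s, c.run s = some (x, s + t)) : RunsIn c x t t := ⟨t, le_rfl, le_rfl, h⟩

theorem run_tick (s : ℕ) : StateT.run tick s = some ((), s + 1) := rfl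
theorem run_addR (x y : ℝ) (s : ℕ) : (addR x y).run s = some (x + y, s + 1) := rfl
theorem run_subR (x y : ℝ) (s : ℕ) : (subR x y).run s = some (x - y, s + 1) := rfl
theorem run_mulR (x y : ℝ) (s : ℕ) : (mulR x y).run s = some (x * y, s + 1) := rfl
theorem run_halfR (x : ℝ) (s : ℕ) : (halfR x).run s = some (x / 2, s + 1) := rfl
theorem run_powR (x y : ℝ) (s : ℕ) : (powR x y).run s = some (x ^ y, s + 1) := rfl
theorem run_ltR (x y : ℝ) (s : ℕ) : (ltR x y).run s = some (decide (x < y), s + 1) := rfl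
theorem run_leR (x y : ℝ) (s : ℕ) : (leR x y).run s = some (decide (x ≤ y), s + 1) := rfl
theorem run_addN (x y : ℕ) (s : ℕ) : (addN x y).run s = some (x + y, s + 1) := rfl
theorem run_halfN (x : ℕ) (s : ℕ) : (halfN x).run s = some (x / 2, s + 1) := rfl
theorem run_ltN (x y : ℕ) (s : ℕ) : (ltN x y).run s = some (decide (x < y), s + 1) := rfl
theorem run_readA (A : Array ℝ) (i s : ℕ) : (readA A i).run s = some (A.getD i 0, s + 1) := rfl

/-! ### Statistics of blocks -/

/-- The statistics of a union. -/
noncomputable def Stats.combine (s t : Stats) : Stats :=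
  ⟨s.W + t.W, s.Slt + t.Slt, s.Seq + t.Seq, s.Sgt + t.Sgt, s.Plt * t.Plt, s.Pgt * t.Pgt⟩

theorem Stats.combine_assoc (s t u : Stats) :
    (s.combine t).combine u = s.combine (t.combine u) := by
  simp [Stats.combine, add_assoc, mul_assoc]

theorem Stats.empty_combine (s : Stats) : Stats.empty.combine s = s := by
  simp [Stats.combine, Stats.empty]

theorem Stats.combine_empty (s : Stats) : s.combine Stats.empty = s := by
  simp [Stats.combine, Stats.empty]

theorem Stats.of_nil (y : ℝ) : Stats.of y [] = Stats.empty := by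
  simp [Stats.of, Stats.empty]

theorem Stats.of_append (y : ℝ) (S S' : List (ℝ × ℝ)) :
    Stats.of y (S ++ S') = (Stats.of y S).combine (Stats.of y S') := by
  simp [Stats.of, Stats.combine]

theorem mergeStats_runs (s t : Stats) : RunsIn (mergeStats s t) (s.combine t) 7 7 :=
  RunsIn.of_run 7 fun _ => rfl

theorem addPoint_runs (y v w : ℝ) (s : Stats) :
    RunsIn (addPoint y v w s) (s.combine (Stats.of y [(v, w)])) 1 8 := by
  rcases lt_trichotomy v y with h | h | h
  · refine ⟨7, by norm_num, by norm_num, fun t => ?_⟩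
    simp [addPoint, run_tick, run_addR, run_subR, run_mulR, run_powR, run_ltR, h, h.ne, h.not_gt,
      Stats.combine, Stats.of, abs_of_pos (sub_pos.2 h)]
  · refine ⟨5, by norm_num, by norm_num, fun t => ?_⟩
    simp [addPoint, run_tick, run_addR, run_ltR, h, Stats.combine, Stats.of]
  · refine ⟨8, by norm_num, by norm_num, fun t => ?_⟩
    simp [addPoint, run_tick, run_addR, run_subR, run_mulR, run_powR, run_ltR, h, h.ne', h.not_gt,
      Stats.combine, Stats.of, abs_of_neg (sub_neg.2 h)]

theorem scan_runs (y : ℝ) (S rest : List (ℝ × ℝ)) (s : Stats) :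
    RunsIn (scan y S.length (S ++ rest) s) (s.combine (Stats.of y S), rest)
      S.length (9 * S.length + 1) := by
  induction S generalizing s with
  | nil =>
    rw [Stats.of_nil, Stats.combine_empty]
    refine ⟨1, by simp, by simp, fun t => ?_⟩
    cases rest <;> rfl
  | cons r S ih =>
    have h := (addPoint_runs y r.1 r.2 s).bind (ih (s.combine (Stats.of y [r])))
    rw [Stats.combine_assoc, ← Stats.of_append] at h
    refine (RunsIn.tick_bind h).mono ?_ ?_ <;> simp <;> omega

theorem skip_runs (S rest : List (ℝ × ℝ)) :
    RunsIn (skip S.length (S ++ rest)) rest S.length (9 * S.length + 1) := by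
  induction S with
  | nil => exact ⟨1, by simp, by simp, fun t => by cases rest <;> rfl⟩
  | cons r S ih =>
    exact (RunsIn.tick_bind ih).mono (by simp only [List.length_cons]; omega)
      (by simp only [List.length_cons]; omega)

/-- This translates the program's numbers into the coefficients of the expansion. A factor `|y - v|
^ w` has logarithm `w * log |y - v|`, so comparing the two positive products is reading off the sign
of `logSum`. -/
theorem Stats.of_identities {S : List (ℝ × ℝ)} (y : ℝ) :
    (Stats.of y S).W = (Stats.of y S).Slt + (Stats.of y S).Seq + (Stats.of y S).Sgt ∧
    (Stats.of y S).Seq = eqSum S y ∧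
    (Stats.of y S).Slt - (Stats.of y S).Sgt = signSum S y ∧
    0 < (Stats.of y S).Plt ∧ 0 < (Stats.of y S).Pgt ∧
    Real.log (Stats.of y S).Plt - Real.log (Stats.of y S).Pgt = logSum S y := by
  induction S with
  | nil => simp [Stats.of, eqSum, signSum, logSum]
  | cons r S ih =>
    obtain ⟨h1, h2, h3, h4, h5, h6⟩ := ih
    have e1 : eqSum (r :: S) y = (if r.1 = y then r.2 else 0) + eqSum S y := by simp [eqSum]
    have e2 : signSum (r :: S) y = r.2 * (SignType.sign (y - r.1) : ℝ) + signSum S y := by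
      simp [signSum]
    have e3 : logSum (r :: S) y = r.2 * ((SignType.sign (y - r.1) : ℝ) *
      Real.log |y - r.1|) + logSum S y := by simp [logSum]
    rw [e1, e2, e3, ← h2, ← h3, ← h6,
      show r :: S = [r] ++ S from rfl, Stats.of_append]
    simp only [Stats.combine]
    rcases lt_trichotomy r.1 y with h | h | h
    · have hp : 0 < y - r.1 := sub_pos.2 h
      have hs : Stats.of y [r] = ⟨r.2, r.2, 0, 0, (y - r.1) ^ r.2, 1⟩ := by
        simp [Stats.of, h, h.ne, h.not_gt, abs_of_pos hp]
      have hpw : 0 < (y - r.1) ^ r.2 := Real.rpow_pos_of_pos hp _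
      rw [hs, if_neg h.ne, sign_pos hp, abs_of_pos hp, Real.log_mul hpw.ne' h4.ne',
        Real.log_rpow hp, one_mul]
      refine ⟨?_, ?_, ?_, mul_pos hpw h4, h5, ?_⟩ <;> simp <;> linarith
    · have hs : Stats.of y [r] = ⟨r.2, 0, r.2, 0, 1, 1⟩ := by
        simp [Stats.of, h]
      rw [hs, if_pos h, h]
      refine ⟨?_, ?_, ?_, ?_, ?_, ?_⟩ <;> simp <;> linarith
    · have hp : y - r.1 < 0 := sub_neg.2 h
      have hs : Stats.of y [r] = ⟨r.2, 0, 0, r.2, 1, (-(y - r.1)) ^ r.2⟩ := by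
        simp [Stats.of, h, h.ne', h.not_gt, abs_of_neg hp]
      have hpw : 0 < (-(y - r.1)) ^ r.2 := Real.rpow_pos_of_pos (by linarith) _
      rw [hs, if_neg h.ne', sign_neg hp, abs_of_neg hp, Real.log_mul hpw.ne' h5.ne',
        Real.log_rpow (by linarith), one_mul]
      refine ⟨?_, ?_, ?_, h4, mul_pos hpw h5, ?_⟩ <;> simp <;> linarith

theorem locate_runs {S : List (ℝ × ℝ)} (hS : S ≠ []) (hw : ∀ r ∈ S, 0 < r.2) (y : ℝ) :
    RunsIn (locate (Stats.of y S)) (cmp (limMean S) y) 1 8 := by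
  obtain ⟨h1, h2, h3, h4, h5, h6⟩ := Stats.of_identities (S := S) y
  have h0 := eqSum_nonneg hw y
  have hlt : RuleLT S y → cmp (limMean S) y = .lt := fun h =>
    (cmp_eq_lt_iff _ _).2 (h.limMean_lt hS hw)
  have heq : RuleEQ S y → cmp (limMean S) y = .eq := fun h =>
    (cmp_eq_eq_iff _ _).2 (h.limMean_eq hS hw)
  have hgt : RuleLT (reflect S) (-y) → cmp (limMean S) y = .gt := fun h =>
    (cmp_eq_gt_iff _ _).2 (lt_limMean_of_reflect hS hw h)
  rw [reflect_ruleLT_iff] at hgt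
  set s := Stats.of y S
  by_cases c1 : 0 < s.Seq
  · by_cases c2 : s.Slt < s.W / 2 ∧ s.Sgt < s.W / 2
    -- As `W = Slt + Seq + Sgt`, both outer weights are below `W / 2` exactly when `|Slt - Sgt| <
    -- Seq`. Similarly, `W / 2 ≤ Slt` means `Seq ≤ Slt - Sgt`.
    · rw [heq (Or.inl (abs_lt.2 ⟨by linarith, by linarith⟩))]
      refine ⟨5, by norm_num, by norm_num, fun t => ?_⟩
      simp [locate, run_tick, run_halfR, run_ltR, c1, c2.1, c2.2]
    · by_cases c3 : s.W / 2 ≤ s.Slt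
      · have : RuleLT S y := by
          rcases (show eqSum S y ≤ signSum S y by linarith).lt_or_eq with h | h
          · exact Or.inl h
          · exact Or.inr ⟨h, Or.inl (by linarith)⟩
        rw [hlt this]
        refine ⟨6, by norm_num, by norm_num, fun t => ?_⟩
        simp [locate, run_tick, run_halfR, run_ltR, run_leR, c1, not_lt.2 c3, c3]
      · have c4 : s.W / 2 ≤ s.Sgt := by
          by_contra! h
          exact c2 ⟨not_le.1 c3, h⟩
        rw [hgt (by
          rcases (show eqSum S y ≤ -signSum S y by linarith).lt_or_eq with h | h
          · exact Or.inl h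
          · exact Or.inr ⟨h, Or.inl (by linarith)⟩)]
        refine ⟨6, by norm_num, by norm_num, fun t => ?_⟩
        simp [locate, run_tick, run_halfR, run_ltR, run_leR, c1, not_le.1 c3, c3, not_lt.2 c4]
  · have hE : eqSum S y = 0 := by linarith
    by_cases c2 : s.Slt = s.Sgt
    · have hD : signSum S y = 0 := by linarith
      rcases lt_trichotomy s.Plt s.Pgt with c3 | c3 | c3
      · have hl := Real.log_lt_log h4 c3
        rw [hgt (Or.inr ⟨by linarith, Or.inr (by linarith)⟩)]
        refine ⟨7, by norm_num, by norm_num, fun t => ?_⟩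
        simp [locate, run_tick, run_halfR, run_ltR, run_leR, c1, c2, c3, c3.not_gt]
      · rw [heq (Or.inr ⟨hE, hD, by rw [← h6, c3, sub_self]⟩)]
        refine ⟨7, by norm_num, by norm_num, fun t => ?_⟩
        simp [locate, run_tick, run_halfR, run_ltR, run_leR, c1, c2, c3]
      · have hl := Real.log_lt_log h5 c3
        rw [hlt (Or.inr ⟨by linarith, Or.inr (by linarith)⟩)]
        refine ⟨6, by norm_num, by norm_num, fun t => ?_⟩
        simp [locate, run_tick, run_halfR, run_ltR, run_leR, c1, c2, c3]
    · have c2' : ¬ (s.Slt ≤ s.Sgt ∧ s.Sgt ≤ s.Slt) := fun h => c2 (le_antisymm h.1 h.2)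
      refine ⟨6, by norm_num, by norm_num, fun t => ?_⟩
      by_cases c3 : s.W / 2 < s.Slt
      · rw [hlt (Or.inl (by linarith))]
        simp [locate, run_tick, run_halfR, run_ltR, run_leR, c1, c2', c3]
      · have : s.Slt < s.Sgt := lt_of_le_of_ne (by linarith) c2
        rw [hgt (Or.inl (by linarith))]
        simp [locate, run_tick, run_halfR, run_ltR, run_leR, c1, c2', c3]

/-! ### Sorting, input and output -/

theorem split_runs (l : List ℝ) : ∃ p q, RunsIn (split l) (p, q) (l.length + 1) (l.length + 1) ∧
    p.length = (l.length + 1) / 2 ∧ q.length = l.length / 2 ∧ ∀ x, x ∈ l ↔ x ∈ p ∨ x ∈ q := by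
  induction l with
  | nil => exact ⟨[], [], RunsIn.of_run 1 fun _ => rfl, by simp, by simp, by simp⟩
  | cons x l ih =>
    obtain ⟨p, q, h, hp, hq, hm⟩ := ih
    refine ⟨x :: q, p, ?_, ?_, ?_, ?_⟩
    · exact (RunsIn.tick_bind (h.bind (RunsIn.pure (x :: q, p)))).mono
        (by simp only [List.length_cons]; omega) (by simp only [List.length_cons]; omega)
    · simp only [List.length_cons]; omega
    · simp only [List.length_cons]; omega
    · intro y; simp only [List.mem_cons, hm]; tauto

theorem merge_runs (xs ys : List ℝ) (hx : xs.Pairwise (· < ·)) (hy : ys.Pairwise (· < ·)) :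
    ∃ zs, RunsIn (merge xs ys) zs 1 (3 * (xs.length + ys.length) + 1) ∧
      zs.Pairwise (· < ·) ∧ zs.length ≤ xs.length + ys.length ∧
      ∀ x, x ∈ zs ↔ x ∈ xs ∨ x ∈ ys := by
  induction hn : xs.length + ys.length using Nat.strong_induction_on generalizing xs ys with
  | _ n ih =>
  subst hn
  cases xs with
  | nil =>
    refine ⟨ys, ⟨1, le_rfl, by omega, fun s => ?_⟩, hy, by simp, by simp⟩
    rw [merge]; rfl
  | cons x xs =>
    cases ys with
    | nil =>
      refine ⟨x :: xs, ⟨1, le_rfl, by omega, fun s => ?_⟩, hx, by simp, by simp⟩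
      rw [merge]; rfl
    | cons y ys =>
      have hx' := List.pairwise_cons.1 hx
      have hy' := List.pairwise_cons.1 hy
      rcases lt_trichotomy x y with h | h | h
      · obtain ⟨zs, ⟨t, h1, h2, h3⟩, hz, hl, hm⟩ := ih _ (by simp) xs (y :: ys) hx'.2 hy rfl
        refine ⟨x :: zs, ⟨t + 2, by omega, ?_, fun s => ?_⟩, ?_, ?_, ?_⟩
        · simp only [List.length_cons] at h2 ⊢; omega
        · rw [merge]
          simp [run_tick, run_ltR, h, h3]
          omega
        · refine List.pairwise_cons.2 ⟨fun z hz' => ?_, hz⟩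
          rcases (hm z).1 hz' with h' | h'
          · exact hx'.1 z h'
          · rcases List.mem_cons.1 h' with rfl | h'
            · exact h
            · exact h.trans (hy'.1 z h')
        · simp only [List.length_cons] at hl ⊢; omega
        · intro z; rw [List.mem_cons, hm, List.mem_cons (a := z) (b := x)]; tauto
      · subst h
        obtain ⟨zs, ⟨t, h1, h2, h3⟩, hz, hl, hm⟩ := ih _ (by simp) xs (x :: ys) hx'.2 hy rfl
        refine ⟨zs, ⟨t + 3, by omega, ?_, fun s => ?_⟩, hz, ?_, ?_⟩
        · simp only [List.length_cons] at h2 ⊢; omega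
        · rw [merge]
          simp [run_tick, run_ltR, h3]
          omega
        · simp only [List.length_cons] at hl ⊢; omega
        · intro z; rw [hm]; simp only [List.mem_cons]; tauto
      · obtain ⟨zs, ⟨t, h1, h2, h3⟩, hz, hl, hm⟩ := ih _ (by simp) (x :: xs) ys hx hy'.2 rfl
        refine ⟨y :: zs, ⟨t + 3, by omega, ?_, fun s => ?_⟩, ?_, ?_, ?_⟩
        · simp only [List.length_cons] at h2 ⊢; omega
        · rw [merge]
          simp [run_tick, run_ltR, h, h.not_gt, h3]
          omega
        · refine List.pairwise_cons.2 ⟨fun z hz' => ?_, hz⟩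
          rcases (hm z).1 hz' with h' | h'
          · rcases List.mem_cons.1 h' with rfl | h'
            · exact h
            · exact h.trans (hx'.1 z h')
          · exact hy'.1 z h'
        · simp only [List.length_cons] at hl ⊢; omega
        · intro z; rw [List.mem_cons, hm, List.mem_cons (a := z) (b := y)]; tauto

/-- The lower bound comes from `split` alone, which walks through its whole input at every level of
the recursion. It therefore holds even when merging discards many duplicates. -/
theorem sortDistinct_runs (l : List ℝ) :
    ∃ zs, RunsIn (sortDistinct l) zs (l.length * Nat.log 2 l.length)
        (8 * l.length * Nat.clog 2 l.length + 1) ∧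
      zs.Pairwise (· < ·) ∧ zs.length ≤ l.length ∧ ∀ x, x ∈ zs ↔ x ∈ l := by
  induction hn : l.length using Nat.strong_induction_on generalizing l with
  | _ n ih =>
  subst hn
  match l with
  | [] =>
    refine ⟨[], ⟨1, by simp, by simp, fun s => ?_⟩, by simp, by simp, by simp⟩
    rw [sortDistinct]; rfl
  | [x] =>
    refine ⟨[x], ⟨1, by simp, by simp, fun s => ?_⟩, by simp, by simp, by simp⟩
    rw [sortDistinct]; rfl
  | x :: y :: l =>
    set l' := x :: y :: l with hl'
    set n := l'.length with hn
    have hn2 : 2 ≤ n := by simp [hn, hl']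
    obtain ⟨p, q, hs, hp, hq, hm⟩ := split_runs l'
    rw [← hn] at hs hp hq
    obtain ⟨p', hp1, hp2, hp3, hp4⟩ := ih p.length (by omega) p rfl
    obtain ⟨q', hq1, hq2, hq3, hq4⟩ := ih q.length (by omega) q rfl
    obtain ⟨zs, hz1, hz2, hz3, hz4⟩ := merge_runs p' q' hp2 hq2
    refine ⟨zs, ?_, hz2, by omega, ?_⟩
    · have h := RunsIn.tick_bind (k := fun _ => (split l' >>= fun r => sortDistinct r.1 >>=
        fun p' => sortDistinct r.2 >>= fun q' => merge p' q'))
        (hs.bind (hp1.bind (hq1.bind hz1)))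
      rw [sortDistinct]
      refine RunsIn.mono h ?_ ?_
      · have e1 : Nat.log 2 n = Nat.log 2 (n / 2) + 1 := Nat.log_of_one_lt_of_le (by norm_num) hn2
        have e2 : Nat.log 2 (n / 2) ≤ Nat.log 2 p.length :=
          Nat.log_mono_right (by omega)
        have e3 : Nat.log 2 (n / 2) = Nat.log 2 q.length := by rw [hq]
        have e4 : p.length * Nat.log 2 (n / 2) ≤ p.length * Nat.log 2 p.length :=
          Nat.mul_le_mul_left _ e2
        have e5 : n = p.length + q.length := by omega
        have e6 : n * Nat.log 2 n = p.length * Nat.log 2 (n / 2) +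
            q.length * Nat.log 2 (n / 2) + n := by
          rw [e1, ← add_mul, ← e5]; ring
        rw [e6, ← e3]
        omega
      · have e1 : Nat.clog 2 n = Nat.clog 2 ((n + 1) / 2) + 1 := by
          simpa using Nat.clog_of_two_le (b := 2) (n := n) (by norm_num) hn2
        have e2 : Nat.clog 2 q.length ≤ Nat.clog 2 p.length :=
          Nat.clog_mono_right _ (by omega)
        have e4 : q.length * Nat.clog 2 q.length ≤ q.length * Nat.clog 2 p.length :=
          Nat.mul_le_mul_left _ e2
        have e5 : n = p.length + q.length := by omega
        have e6 : n * Nat.clog 2 n = p.length * Nat.clog 2 p.length +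
            q.length * Nat.clog 2 p.length + n := by
          rw [e1, ← hp, ← add_mul, ← e5]; ring
        rw [mul_assoc, mul_assoc, mul_assoc, e6]
        omega
    · intro z; rw [hz4, hp4, hq4, hm]

theorem values_runs (data : List (ℝ × ℝ)) :
    RunsIn (values data) (data.map Prod.fst) 1 (data.length + 1) := by
  induction data with
  | nil => exact ⟨1, by simp, by simp, fun _ => rfl⟩
  | cons r data ih =>
    exact (RunsIn.tick_bind (ih.bind (RunsIn.pure (r.1 :: data.map Prod.fst)))).mono
      (by simp) (by simp; omega)

theorem fillArray_runs (l : List ℝ) (A : Array ℝ) :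
    RunsIn (fillArray l A) (A ++ l.toArray) 1 (l.length + 1) := by
  induction l generalizing A with
  | nil => exact ⟨1, by simp, by simp, fun _ => by simp; rfl⟩
  | cons x l ih =>
    have h := RunsIn.tick_bind (k := fun _ => fillArray l (A.push x)) (ih (A.push x))
    have e : A.push x ++ l.toArray = A ++ (x :: l).toArray := by
      apply Array.ext'; simp
    rw [e] at h
    exact h.mono (by simp) (by simp; omega)

theorem initBoxes_runs (a b : ℝ) (m : ℕ) (data : List (ℝ × ℝ)) :
    RunsIn (initBoxes a b m data) (List.replicate data.length ⟨1, a, b, 0, m⟩)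
      1 (data.length + 1) := by
  induction data with
  | nil => exact ⟨1, by simp, by simp, fun _ => rfl⟩
  | cons r data ih =>
    exact (RunsIn.tick_bind (ih.bind (RunsIn.pure
      ((⟨1, a, b, 0, m⟩ : Box) :: List.replicate data.length ⟨1, a, b, 0, m⟩)))).mono
      (by simp) (by simp; omega)

theorem replicateOnto_runs (z : ℝ × ℝ) (l : List (ℝ × ℝ)) (k : ℕ) :
    RunsIn (replicateOnto z l k) (List.replicate k z ++ l) 1 (k + 1) := by
  induction k with
  | zero => exact ⟨1, by simp, by simp, fun _ => rfl⟩
  | succ k ih =>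
    exact (RunsIn.tick_bind (ih.bind (RunsIn.pure (z :: (List.replicate k z ++ l))))).mono
      (by simp) (by omega)

theorem output_runs (boxes : List Box) :
    RunsIn (output boxes) (boxes.flatMap fun X => List.replicate X.len (X.a, X.b)) 1
      ((boxes.map fun X => X.len).sum + 2 * boxes.length + 1) := by
  induction boxes with
  | nil => exact ⟨1, by simp, by simp, fun _ => rfl⟩
  | cons X boxes ih =>
    exact (RunsIn.tick_bind (ih.bind (replicateOnto_runs (X.a, X.b) _ X.len))).mono
      (by simp) (by simp; omega)

/-! ### Vertices with their regression values, and boxes containing them -/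

/-- A vertex: its value and weight, and the value of the regression. -/
abbrev Cell := (ℝ × ℝ) × ℝ

/-- The limit mean of the data of a block. -/
noncomputable def cellMean (Q : List Cell) : ℝ := limMean (Q.map Prod.fst)

/-- The regression values of `E` are stable (see `IsStable`). -/
structure StableCells (E : List Cell) : Prop where
  pos : ∀ e ∈ E, 0 < e.1.2
  mono : E.Pairwise fun e e' => e.2 ≤ e'.2
  le_mean : ∀ (P Q R : List Cell) (c : ℝ), E = P ++ Q ++ R → Q ≠ [] → (∀ e ∈ P, e.2 < c) →
    (∀ e ∈ Q, c ≤ e.2) → c ≤ cellMean Q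
  mean_le : ∀ (P Q R : List Cell) (c : ℝ), E = P ++ Q ++ R → Q ≠ [] → (∀ e ∈ Q, e.2 ≤ c) →
    (∀ e ∈ R, c < e.2) → cellMean Q ≤ c

/-- Stability is restated for decompositions of the list of vertices, the form in which pooling
presents its blocks. -/
theorem IsStable.stableCells {n : ℕ} {f w g : Fin n → ℝ} (hw : ∀ i, 0 < w i)
    (h : IsStable f w g) : StableCells (List.ofFn fun i => ((f i, w i), g i)) := by
  set E : List Cell := List.ofFn fun i => ((f i, w i), g i) with hE
  have hlen : E.length = n := by simp [hE]
  have hget : ∀ (i : ℕ) (hi : i < E.length), E[i].2 = g ⟨i, hlen ▸ hi⟩ := by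
    intro i hi; simp [hE]
  have hblock : ∀ P Q R, E = P ++ Q ++ R →
      blockData f w P.length (P.length + Q.length) = Q.map Prod.fst := by
    intro P Q R hPQR
    have e : dataOf f w = E.map Prod.fst := by
      simp [dataOf, hE, List.map_ofFn, Function.comp_def]
    rw [blockData, e, hPQR, ← List.map_take, ← List.map_drop, ← List.length_append,
      List.take_left, List.drop_left]
  refine ⟨?_, ?_, ?_, ?_⟩
  · intro e he
    obtain ⟨i, rfl⟩ := (List.mem_ofFn' _ _).1 he
    exact hw i
  · rw [List.pairwise_iff_getElem]
    intro i j hi hj hij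
    rw [hget, hget]
    exact h.mono hij.le
  · intro P Q R c hPQR hQ hP hQc
    have hl : P.length + Q.length + R.length = n := by rw [← hlen, hPQR]; simp [add_assoc]
    have hQl : 0 < Q.length := List.length_pos_iff.2 hQ
    rw [cellMean, ← hblock P Q R hPQR]
    refine h.le_mean _ _ c (by omega) (by omega) (fun i hi hi' => ?_) fun i hi => ?_
    · have h1 := hget i (by omega)
      rw [← h1]
      refine hQc _ ?_
      simp only [hPQR]
      rw [List.getElem_append_left (by simp; omega), List.getElem_append_right hi]
      exact List.getElem_mem _
    · have h1 := hget i (by omega)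
      rw [← h1]
      refine hP _ ?_
      simp only [hPQR]
      rw [List.getElem_append_left (by simp; omega), List.getElem_append_left hi]
      exact List.getElem_mem _
  · intro P Q R c hPQR hQ hQc hR
    have hl : P.length + Q.length + R.length = n := by rw [← hlen, hPQR]; simp [add_assoc]
    have hQl : 0 < Q.length := List.length_pos_iff.2 hQ
    rw [cellMean, ← hblock P Q R hPQR]
    refine h.mean_le _ _ c (by omega) (by omega) (fun i hi hi' => ?_) fun i hi => ?_
    · have h1 := hget i (by omega)
      rw [← h1]
      refine hQc _ ?_
      simp only [hPQR]
      rw [List.getElem_append_left (by simp; omega), List.getElem_append_right hi]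
      exact List.getElem_mem _
    · have h1 := hget i (by omega)
      rw [← h1]
      refine hR _ ?_
      simp only [hPQR]
      rw [List.getElem_append_right (by simpa using hi)]
      exact List.getElem_mem _

/-! ### The limit mean lies between the smallest and the largest value -/

theorem slope_neg_of_forall_gt {S : List (ℝ × ℝ)} (hS : S ≠ []) (hw : ∀ r ∈ S, 0 < r.2) {y : ℝ}
    (h : ∀ r ∈ S, y < r.1) (q : ℝ) : slope q S y < 0 := by
  have h0 : 0 < slope q (reflect S) (-y) := by
    refine List.sum_pos _ (fun x hx => ?_) (by simpa using reflect_ne_nil hS)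
    obtain ⟨r, hr, rfl⟩ := List.mem_map.1 hx
    obtain ⟨r', hr', rfl⟩ := List.mem_map.1 hr
    have h1 := h r' hr'
    have h2 := hw r' hr'
    have h3 : 0 < -y - -r'.1 := by linarith
    dsimp only
    rw [signPow_of_pos h3]
    positivity
  rw [slope_reflect] at h0
  linarith

theorem slope_pos_of_forall_lt {S : List (ℝ × ℝ)} (hS : S ≠ []) (hw : ∀ r ∈ S, 0 < r.2) {y : ℝ}
    (h : ∀ r ∈ S, r.1 < y) (q : ℝ) : 0 < slope q S y := by
  refine List.sum_pos _ (fun x hx => ?_) (by simpa using hS)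
  obtain ⟨r, hr, rfl⟩ := List.mem_map.1 hx
  have h1 := sub_pos.2 (h r hr)
  have h2 := hw r hr
  rw [signPow_of_pos h1]
  positivity

theorem le_limMean {S : List (ℝ × ℝ)} (hS : S ≠ []) (hw : ∀ r ∈ S, 0 < r.2) {y : ℝ}
    (h : ∀ r ∈ S, y ≤ r.1) : y ≤ limMean S := by
  by_contra! hlt
  obtain ⟨z, hz1, hz2⟩ := exists_between hlt
  obtain ⟨q, hq⟩ := ((limMean_spec hS hw).2 z hz1).exists
  exact lt_asymm hq (slope_neg_of_forall_gt hS hw (fun r hr => hz2.trans_le (h r hr)) q)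

theorem limMean_le {S : List (ℝ × ℝ)} (hS : S ≠ []) (hw : ∀ r ∈ S, 0 < r.2) {y : ℝ}
    (h : ∀ r ∈ S, r.1 ≤ y) : limMean S ≤ y := by
  by_contra! hlt
  obtain ⟨z, hz1, hz2⟩ := exists_between hlt
  obtain ⟨q, hq⟩ := ((limMean_spec hS hw).1 z hz2).exists
  exact lt_asymm hq (slope_pos_of_forall_lt hS hw (fun r hr => (h r hr).trans_lt hz1) q)

/-- Two boxes have the same vertical extent and the same candidates. -/
def SameExtent (X Y : Box) : Prop := X.a = Y.a ∧ X.b = Y.b ∧ X.lo = Y.lo ∧ X.hi = Y.hi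

/-- The relation of a box to a later one: its extent is below or the same. -/
def Precedes (X Y : Box) : Prop := X.b ≤ Y.a ∨ SameExtent X Y

theorem SameExtent.symm {X Y : Box} (h : SameExtent X Y) : SameExtent Y X :=
  ⟨h.1.symm, h.2.1.symm, h.2.2.1.symm, h.2.2.2.symm⟩

theorem SameExtent.trans {X Y Z : Box} (h : SameExtent X Y) (h' : SameExtent Y Z) :
    SameExtent X Z :=
  ⟨h.1.trans h'.1, h.2.1.trans h'.2.1, h.2.2.1.trans h'.2.2.1, h.2.2.2.trans h'.2.2.2⟩

/-- The block `seg` of the vertices `E` may have the box `X`; `arr` are the sorted data values. -/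
structure Fits (E : List Cell) (arr : ℕ → ℝ) (X : Box) (seg : List Cell) : Prop where
  ne : seg ≠ []
  sub : ∀ e ∈ seg, e ∈ E
  len : X.len = seg.length
  le : X.a ≤ X.b
  const : ∀ e ∈ seg, ∀ e' ∈ seg, e.2 = e'.2
  mem : ∀ e ∈ seg, X.a ≤ e.2 ∧ e.2 ≤ X.b
  cand : ∀ e ∈ seg, (∃ e' ∈ E, e'.1.1 = e.2) →
    X.a = X.b ∨ ∃ k, X.lo ≤ k ∧ k < X.hi ∧ arr k = e.2

/-- The cut `c` is suitable for the box `X`. -/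
structure CutOK (E : List Cell) (arr : ℕ → ℝ) (X : Box) (c : Cut) : Prop where
  ge : X.a ≤ c.y
  le : c.y ≤ X.b
  bot : c.y = X.a → ∀ e ∈ E, c.y ≤ e.1.1
  top : c.y = X.b → ∀ e ∈ E, e.1.1 ≤ c.y
  below : ∀ k, X.lo ≤ k → k < X.hi → arr k < c.y → k < c.hiBelow
  above : ∀ k, X.lo ≤ k → k < X.hi → c.y < arr k → c.loAbove ≤ k

/-- A rule `cutOf` for choosing cuts, with an invariant `J` of the boxes after `j` iterations. -/
structure Phase (E : List Cell) (arr : ℕ → ℝ) (cutOf : Box → Option Cut) (J : ℕ → Box → Prop) :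
    Prop where
  cut_congr : ∀ X Y, SameExtent X Y → cutOf X = cutOf Y
  congr : ∀ j X Y, SameExtent X Y → J j X → J j Y
  ok : ∀ j X c, J j X → cutOf X = some c → CutOK E arr X c
  lower : ∀ j X c, J j X → cutOf X = some c → X.a < c.y →
    J (j + 1) { X with b := c.y, hi := c.hiBelow }
  point : ∀ j X c, J j X → cutOf X = some c →
    J (j + 1) { X with a := c.y, b := c.y, lo := 0, hi := 0 }
  upper : ∀ j X c, J j X → cutOf X = some c → c.y < X.b →
    J (j + 1) { X with a := c.y, lo := c.loAbove }
  keep : ∀ j X, J j X → cutOf X = none → J (j + 1) X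

/-! ### Partitioning a block -/

/-- A box with the vertices of its block. -/
abbrev Item := Box × List Cell

/-- The box that results from partitioning. -/
noncomputable def outBox (cutOf : Box → Option Cut) (it : Item) : Box :=
  match cutOf it.1 with
  | none => it.1
  | some c =>
    match cmp (cellMean it.2) c.y with
    | .lt => { it.1 with b := c.y, hi := c.hiBelow }
    | .eq => { it.1 with a := c.y, b := c.y, lo := 0, hi := 0 }
    | .gt => { it.1 with a := c.y, lo := c.loAbove }

/-- The statistics kept for a block. -/
noncomputable def itemStats (cutOf : Box → Option Cut) (it : Item) : Stats :=
  match cutOf it.1 with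
  | none => Stats.empty
  | some c => Stats.of c.y (it.2.map Prod.fst)

/-- The block of the program that represents an item. -/
noncomputable def mkBlock (cutOf : Box → Option Cut) (it : Item) : Block :=
  ⟨it.1, cutOf it.1, itemStats cutOf it⟩

/-- The stack entry of the program that represents an item. -/
noncomputable def entry (cutOf : Box → Option Cut) (it : Item) : Block × Box :=
  (mkBlock cutOf it, outBox cutOf it)

section
variable {E : List Cell} {arr : ℕ → ℝ} {cutOf : Box → Option Cut} {J : ℕ → Box → Prop} {j : ℕ}

theorem outBox_none {it : Item} (h : cutOf it.1 = none) : outBox cutOf it = it.1 := by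
  simp [outBox, h]

theorem outBox_lt {it : Item} {c : Cut} (h : cutOf it.1 = some c) (hm : cellMean it.2 < c.y) :
    outBox cutOf it = { it.1 with b := c.y, hi := c.hiBelow } := by
  simp [outBox, h, (cmp_eq_lt_iff _ _).2 hm]

theorem outBox_eq {it : Item} {c : Cut} (h : cutOf it.1 = some c) (hm : cellMean it.2 = c.y) :
    outBox cutOf it = { it.1 with a := c.y, b := c.y, lo := 0, hi := 0 } := by
  simp [outBox, h, (cmp_eq_eq_iff _ _).2 hm]

theorem outBox_gt {it : Item} {c : Cut} (h : cutOf it.1 = some c) (hm : c.y < cellMean it.2) :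
    outBox cutOf it = { it.1 with a := c.y, lo := c.loAbove } := by
  simp [outBox, h, (cmp_eq_gt_iff _ _).2 hm]

theorem outBox_len (it : Item) : (outBox cutOf it).len = it.1.len := by
  unfold outBox
  split
  · rfl
  · split <;> rfl

theorem partitionBlock_runs {it : Item} (hne : it.2 ≠ []) (hpos : ∀ e ∈ it.2, 0 < e.1.2) :
    RunsIn (partitionBlock (mkBlock cutOf it)) (outBox cutOf it) 1 9 := by
  have hw : ∀ r ∈ it.2.map Prod.fst, 0 < r.2 := by
    intro r hr
    obtain ⟨e, he, rfl⟩ := List.mem_map.1 hr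
    exact hpos e he
  cases hc : cutOf it.1 with
  | none =>
    refine ⟨1, le_rfl, by norm_num, fun s => ?_⟩
    simp [partitionBlock, mkBlock, hc, outBox, run_tick]
  | some c =>
    obtain ⟨t, h1, h2, h3⟩ := locate_runs (S := it.2.map Prod.fst) (by simpa using hne) hw c.y
    refine ⟨1 + t, by omega, by omega, fun s => ?_⟩
    simp only [partitionBlock, mkBlock, hc, itemStats, outBox, cellMean, StateT.run_bind, run_tick,
      Option.bind_eq_bind, Option.bind_some, h3, ← add_assoc]
    cases cmp (limMean (it.2.map Prod.fst)) c.y <;> rfl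

/-- An item satisfies the invariants of the current iteration. -/
structure ItemOK (E : List Cell) (arr : ℕ → ℝ) (J : ℕ → Box → Prop) (j : ℕ) (it : Item) :
    Prop where
  fits : Fits E arr it.1 it.2
  inv : J j it.1

/-- A cut at the lower end of the extent is a lower bound of all data, so no limit mean lies below
it. Hence the lower part of a partitioned extent is never degenerate. -/
theorem ItemOK.lt_of_mean_lt (hE : StableCells E) (hP : Phase E arr cutOf J) {it : Item}
    (h : ItemOK E arr J j it) {c : Cut} (hc : cutOf it.1 = some c) (hm : cellMean it.2 < c.y) :
    it.1.a < c.y := by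
  have hok := hP.ok j it.1 c h.inv hc
  refine lt_of_le_of_ne hok.ge fun heq => ?_
  refine absurd hm (not_lt.2 (le_limMean (by simpa using h.fits.ne) ?_ ?_))
  all_goals
    intro r hr
    obtain ⟨e, he, rfl⟩ := List.mem_map.1 hr
  · exact hE.pos e (h.fits.sub e he)
  · exact hok.bot heq.symm e (h.fits.sub e he)

theorem ItemOK.lt_of_lt_mean (hE : StableCells E) (hP : Phase E arr cutOf J) {it : Item}
    (h : ItemOK E arr J j it) {c : Cut} (hc : cutOf it.1 = some c) (hm : c.y < cellMean it.2) :
    c.y < it.1.b := by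
  have hok := hP.ok j it.1 c h.inv hc
  refine lt_of_le_of_ne hok.le fun heq => ?_
  refine absurd hm (not_lt.2 (limMean_le (by simpa using h.fits.ne) ?_ ?_))
  all_goals
    intro r hr
    obtain ⟨e, he, rfl⟩ := List.mem_map.1 hr
  · exact hE.pos e (h.fits.sub e he)
  · exact hok.top heq e (h.fits.sub e he)

theorem ItemOK.outBox_subset (hP : Phase E arr cutOf J) {it : Item} (h : ItemOK E arr J j it) :
    it.1.a ≤ (outBox cutOf it).a ∧ (outBox cutOf it).b ≤ it.1.b := by
  cases hc : cutOf it.1 with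
  | none => simp [outBox_none hc]
  | some c =>
    have hok := hP.ok j it.1 c h.inv hc
    rcases lt_trichotomy (cellMean it.2) c.y with hm | hm | hm
    · rw [outBox_lt hc hm]; exact ⟨le_rfl, hok.le⟩
    · rw [outBox_eq hc hm]; exact ⟨hok.ge, hok.le⟩
    · rw [outBox_gt hc hm]; exact ⟨hok.ge, le_rfl⟩

/-- The relation between an item and a later one when no violators are left. -/
def Ordered (cutOf : Box → Option Cut) (p q : Item) : Prop :=
  p.1.b ≤ q.1.a ∨ (SameExtent p.1 q.1 ∧ ∀ c, cutOf p.1 = some c →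
    (cellMean q.2 < c.y → cellMean p.2 < c.y) ∧ (cellMean q.2 ≤ c.y → cellMean p.2 ≤ c.y))

theorem Ordered.trans (hP : Phase E arr cutOf J) {p q r : Item} (hq : q.1.a ≤ q.1.b)
    (h : Ordered cutOf p q) (h' : Ordered cutOf q r) : Ordered cutOf p r := by
  rcases h with h | ⟨h1, h2⟩
  · rcases h' with h' | ⟨h1', -⟩
    · exact Or.inl (by linarith)
    · exact Or.inl (by rw [← h1'.1]; exact h)
  · rcases h' with h' | ⟨h1', h2'⟩
    · exact Or.inl (by rw [h1.2.1]; exact h')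
    · refine Or.inr ⟨h1.trans h1', fun c hc => ?_⟩
      have hc' := hc
      rw [hP.cut_congr _ _ h1] at hc'
      exact ⟨fun h => (h2 c hc).1 ((h2' c hc').1 h), fun h => (h2 c hc).2 ((h2' c hc').2 h)⟩

/-- The vertical extent of `Y` is above that of `X`. -/
def Above (Y X : Box) : Prop := X.b ≤ Y.a ∧ X.a < Y.b

theorem isAbove_runs (Y X : Box) [Decidable (Above Y X)] :
    RunsIn (isAbove Y X) (decide (Above Y X)) 3 3 := by
  refine RunsIn.of_run 3 fun s => ?_
  rw [show decide (Above Y X) = (decide (X.b ≤ Y.a) && decide (X.a < Y.b)) by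
    rw [← Bool.decide_and]; congr]
  rfl

/-- Extents that were ordered before the partitioning stay so, and an untouched pair cannot become
inverted. Thus "above" arises only from two blocks with the same cut whose limit means fall on
inverted sides of it. -/
theorem violators_of_above (hP : Phase E arr cutOf J) {p q : Item} (hp : ItemOK E arr J j p)
    (hq : ItemOK E arr J j q) (hpq : Precedes p.1 q.1)
    (h : Above (outBox cutOf p) (outBox cutOf q)) :
    SameExtent p.1 q.1 ∧ (∃ c, cutOf q.1 = some c) ∧ cellMean q.2 < cellMean p.2 := by
  obtain ⟨h1, h2⟩ := h
  have hps := hp.outBox_subset hP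
  have hqs := hq.outBox_subset hP
  rcases hpq with hpq | hpq
  · linarith
  refine ⟨hpq, ?_⟩
  have hcc := hP.cut_congr _ _ hpq
  have ea := hpq.1
  have eb := hpq.2.1
  cases hc : cutOf q.1 with
  | none =>
    rw [outBox_none hc, outBox_none (hcc.trans hc)] at h1 h2
    linarith
  | some c =>
    refine ⟨⟨c, rfl⟩, ?_⟩
    have hc' := hcc.trans hc
    have hok := hP.ok j q.1 c hq.inv hc
    rcases lt_trichotomy (cellMean p.2) c.y with hm | hm | hm
    · rw [outBox_lt hc' hm] at h1 h2
      rcases lt_trichotomy (cellMean q.2) c.y with hm' | hm' | hm'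
      · rw [outBox_lt hc hm'] at h1 h2; dsimp only at h1 h2; linarith
      · rw [outBox_eq hc hm'] at h1 h2; dsimp only at h1 h2; linarith
      · rw [outBox_gt hc hm'] at h1 h2; dsimp only at h1 h2; linarith
    · rw [outBox_eq hc' hm] at h1 h2
      rcases lt_trichotomy (cellMean q.2) c.y with hm' | hm' | hm'
      · linarith
      · rw [outBox_eq hc hm'] at h1 h2; dsimp only at h1 h2; linarith
      · rw [outBox_gt hc hm'] at h1 h2; dsimp only at h1 h2; linarith
    · rw [outBox_gt hc' hm] at h1 h2
      rcases lt_trichotomy (cellMean q.2) c.y with hm' | hm' | hm'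
      · linarith
      · linarith
      · rw [outBox_gt hc hm'] at h1 h2; dsimp only at h1 h2; linarith

/-- Conversely, inverted sides always show up in the test `isAbove`. Its strict part needs the
extents not to collapse, which `ItemOK.lt_of_mean_lt` and `ItemOK.lt_of_lt_mean` provide. -/
theorem ordered_of_not_above (hE : StableCells E) (hP : Phase E arr cutOf J) {p q : Item}
    (hp : ItemOK E arr J j p) (hq : ItemOK E arr J j q) (hpq : Precedes p.1 q.1)
    (h : ¬ Above (outBox cutOf p) (outBox cutOf q)) : Ordered cutOf p q := by
  rcases hpq with hpq | hpq
  · exact Or.inl hpq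
  refine Or.inr ⟨hpq, fun c hc' => ?_⟩
  have hc := hc'
  rw [hP.cut_congr _ _ hpq] at hc
  have ea := hpq.1
  have eb := hpq.2.1
  have hok := hP.ok j q.1 c hq.inv hc
  constructor
  · intro hm
    by_contra! hm'
    have ha := hq.lt_of_mean_lt hE hP hc hm
    rw [outBox_lt hc hm] at h
    rcases hm'.eq_or_lt with hm' | hm'
    · rw [outBox_eq hc' hm'.symm] at h
      exact h ⟨le_rfl, ha⟩
    · rw [outBox_gt hc' hm'] at h
      exact h ⟨le_rfl, by dsimp only; linarith [hok.le]⟩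
  · intro hm
    by_contra! hm'
    have hb := hp.lt_of_lt_mean hE hP hc' hm'
    rw [outBox_gt hc' hm'] at h
    rcases hm.eq_or_lt with hm | hm
    · rw [outBox_eq hc hm] at h
      exact h ⟨le_rfl, hb⟩
    · rw [outBox_lt hc hm] at h
      exact h ⟨le_rfl, by dsimp only; linarith [hok.ge]⟩

/-- Adjacent violators have the same regression value. -/
theorem StableCells.eq_of_violators (hE : StableCells E) {P Q Q' R : List Cell}
    (hPQ : E = P ++ Q ++ Q' ++ R) (hQ : Q ≠ []) (hQ' : Q' ≠ [])
    (hc : ∀ e ∈ Q, ∀ e' ∈ Q, e.2 = e'.2) (hc' : ∀ e ∈ Q', ∀ e' ∈ Q', e.2 = e'.2)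
    (hm : cellMean Q' < cellMean Q) : ∀ e ∈ Q, ∀ e' ∈ Q', e.2 = e'.2 := by
  intro e he e' he'
  have hmono := hE.mono
  rw [hPQ] at hmono
  rw [List.pairwise_append, List.pairwise_append, List.pairwise_append] at hmono
  obtain ⟨⟨⟨-, -, h1⟩, -, h2⟩, -, h3⟩ := hmono
  have hle := h2 e (List.mem_append_right _ he) e' he'
  refine hle.eq_of_not_lt fun hlt => ?_
  -- If the regression jumped between the blocks, `Q` would end a lower level set and `Q'` would
  -- begin an upper one. Stability would then give `cellMean Q ≤ e.2 < e'.2 ≤ cellMean Q'`.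
  have h4 := hE.mean_le P Q (Q' ++ R) e.2 (by simpa using hPQ) hQ (fun x hx => (hc x hx e he).le)
    (fun x hx => by
      rcases List.mem_append.1 hx with hx | hx
      · rw [hc' x hx e' he']; exact hlt
      · exact hlt.trans_le (h3 e' (List.mem_append_right _ he') x hx))
  have h5 := hE.le_mean (P ++ Q) Q' R e'.2 hPQ hQ' (fun x hx => by
      rcases List.mem_append.1 hx with hx | hx
      · exact (h1 x hx e he).trans_lt hlt
      · rw [hc x hx e he]; exact hlt) (fun x hx => (hc' e' he' x hx).le)
  linarith

/-! ### Pool adjacent violators -/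

/-- The vertices covered by a stack of items, from left to right. -/
def cover : List Item → List Cell
  | [] => []
  | it :: items => cover items ++ it.2

/-- The union of two adjacent items. -/
def mergeItem (p q : Item) : Item := ({ q.1 with len := p.1.len + q.1.len }, p.2 ++ q.2)

theorem mergeItem_sameExtent (p q : Item) : SameExtent q.1 (mergeItem p q).1 :=
  ⟨rfl, rfl, rfl, rfl⟩

theorem mergeBlocks_runs (hP : Phase E arr cutOf J) {p q : Item} (h : SameExtent p.1 q.1)
    {c : Cut} (hc : cutOf q.1 = some c) :
    RunsIn (mergeBlocks (mkBlock cutOf p) (mkBlock cutOf q)) (mkBlock cutOf (mergeItem p q))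
      9 9 := by
  have h1 : cutOf p.1 = some c := (hP.cut_congr _ _ h).trans hc
  have h2 : cutOf (mergeItem p q).1 = some c :=
    (hP.cut_congr _ _ (mergeItem_sameExtent p q)).symm.trans hc
  obtain ⟨t, h3, h4, h5⟩ := mergeStats_runs (itemStats cutOf p) (itemStats cutOf q)
  obtain rfl : t = 7 := by omega
  have h6 : (itemStats cutOf p).combine (itemStats cutOf q) =
      itemStats cutOf (mergeItem p q) := by
    simp only [itemStats, h1, h2, hc]
    simp [mergeItem, Stats.of_append]
  refine RunsIn.of_run 9 fun s => ?_
  simp [mergeBlocks, mkBlock, run_tick, run_addN, h5, h6, h2, hc]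
  rfl

theorem ItemOK.merge (hE : StableCells E) (hP : Phase E arr cutOf J) {p q : Item}
    (hp : ItemOK E arr J j p) (hq : ItemOK E arr J j q) {P R : List Cell}
    (hPR : E = P ++ p.2 ++ q.2 ++ R) (hs : SameExtent p.1 q.1)
    (hm : cellMean q.2 < cellMean p.2) : ItemOK E arr J j (mergeItem p q) := by
  have hcr := hE.eq_of_violators hPR hp.fits.ne hq.fits.ne hp.fits.const hq.fits.const hm
  obtain ⟨ea, eb, elo, ehi⟩ := hs
  refine ⟨⟨?_, ?_, ?_, hq.fits.le, ?_, ?_, ?_⟩, hP.congr j _ _ (mergeItem_sameExtent p q) hq.inv⟩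
  · simp [mergeItem, hp.fits.ne]
  · intro e he
    exact (List.mem_append.1 he).elim (hp.fits.sub e) (hq.fits.sub e)
  · simp [mergeItem, hp.fits.len, hq.fits.len]
  · intro e he e' he'
    rcases List.mem_append.1 he with he | he <;> rcases List.mem_append.1 he' with he' | he'
    · exact hp.fits.const e he e' he'
    · exact hcr e he e' he'
    · exact (hcr e' he' e he).symm
    · exact hq.fits.const e he e' he'
  · intro e he
    rcases List.mem_append.1 he with he | he
    · have := hp.fits.mem e he
      rw [ea, eb] at this
      exact this
    · exact hq.fits.mem e he
  · intro e he
    rcases List.mem_append.1 he with he | he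
    · have := hp.fits.cand e he
      rw [ea, eb, elo, ehi] at this
      exact this
    · exact hq.fits.cand e he

/-- Amortization: each stack entry carries a credit of 30 steps. A merge removes an entry, which
pays for its round of 22 steps; otherwise the new entry is pushed after at most 13 steps. The last
clause keeps the order relation to the blocks not yet processed. -/
theorem pool_runs (hE : StableCells E) (hP : Phase E arr cutOf J) (items : List Item)
    (it : Item) (rest : List Cell) (hit : ItemOK E arr J j it)
    (hitems : ∀ p ∈ items, ItemOK E arr J j p)
    (hord : items.Pairwise fun q p => Ordered cutOf p q)
    (hprec : ∀ p ∈ items, Precedes p.1 it.1) (hcov : E = cover items ++ it.2 ++ rest) :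
    ∃ items' hi, RunsIn (pool (mkBlock cutOf it) (items.map (entry cutOf)))
        (items'.map (entry cutOf)) 1 hi ∧
      hi + 30 * items'.length ≤ 30 * (items.length + 2) ∧
      (∀ p ∈ items', ItemOK E arr J j p) ∧ (items'.Pairwise fun q p => Ordered cutOf p q) ∧
      cover items' = cover items ++ it.2 ∧
      ∀ Z, (∀ p ∈ items, Precedes p.1 Z) → Precedes it.1 Z → ∀ p ∈ items', Precedes p.1 Z := by
  classical
  have hpart : ∀ q, ItemOK E arr J j q →
      RunsIn (partitionBlock (mkBlock cutOf q)) (outBox cutOf q) 1 9 := fun q hq =>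
    partitionBlock_runs hq.fits.ne fun e he => hE.pos e (hq.fits.sub e he)
  induction items generalizing it rest with
  | nil =>
    refine ⟨[it], 10, ?_, by simp, by simpa using hit, by simp, by simp [cover], by simp⟩
    exact (RunsIn.tick_bind ((hpart it hit).bind
      (RunsIn.pure [(mkBlock cutOf it, outBox cutOf it)]))).mono (by omega) (by omega)
  | cons p items ih =>
    have hp := hitems p List.mem_cons_self
    have hitems' : ∀ q ∈ items, ItemOK E arr J j q := fun q hq =>
      hitems q (List.mem_cons_of_mem _ hq)
    rw [List.pairwise_cons] at hord
    have hpit := hprec p List.mem_cons_self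
    have habove := isAbove_runs (outBox cutOf p) (outBox cutOf it)
    by_cases hab : Above (outBox cutOf p) (outBox cutOf it)
    · obtain ⟨hs, ⟨c, hc⟩, hm⟩ := violators_of_above hP hp hit hpit hab
      have hcov' : E = cover items ++ p.2 ++ it.2 ++ rest := hcov
      obtain ⟨items', hi, h1, h2, h3, h4, h5, h6⟩ := ih (mergeItem p it) rest
        (hp.merge hE hP hit hcov' hs hm) hitems' hord.2
        (fun q hq => hprec q (List.mem_cons_of_mem _ hq)) (by simpa [mergeItem] using hcov')
      refine ⟨items', 1 + (9 + (3 + (9 + hi))), ?_, ?_, h3, h4, ?_, ?_⟩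
      · rw [decide_eq_true hab] at habove
        exact (RunsIn.tick_bind ((hpart it hit).bind (habove.bind
          ((mergeBlocks_runs hP hs hc).bind h1)))).mono (by omega) le_rfl
      · simp only [List.length_cons]; omega
      · rw [h5]; simp [cover, mergeItem]
      · intro Z hZ hZ'
        exact h6 Z (fun q hq => hZ q (List.mem_cons_of_mem _ hq)) hZ'
    · have hop := ordered_of_not_above hE hP hp hit hpit hab
      refine ⟨it :: p :: items, 1 + (9 + (3 + 0)), ?_, ?_, ?_, ?_, rfl, ?_⟩
      · rw [decide_eq_false hab] at habove
        exact (RunsIn.tick_bind ((hpart it hit).bind (habove.bind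
          (RunsIn.pure ((it :: p :: items).map (entry cutOf)))))).mono (by omega) le_rfl
      · simp only [List.length_cons]; omega
      · intro q hq
        rcases List.mem_cons.1 hq with rfl | hq
        · exact hit
        · exact hitems q hq
      · refine List.pairwise_cons.2 ⟨fun q hq => ?_, List.pairwise_cons.2 hord⟩
        rcases List.mem_cons.1 hq with rfl | hq
        · exact hop
        · exact (hord.1 q hq).trans hP hp.fits.le hop
      · intro Z hZ hZ' q hq
        rcases List.mem_cons.1 hq with rfl | hq
        · exact hZ'
        · exact hZ q hq

/-- Each block costs one step and adds two credits of 30, one for its final round and one for its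
stack entry. The total is linear although a single call of `pool` may be long. -/
theorem poolAll_runs (hE : StableCells E) (hP : Phase E arr cutOf J) (todo items : List Item)
    (htodo : ∀ p ∈ todo, ItemOK E arr J j p) (hitems : ∀ p ∈ items, ItemOK E arr J j p)
    (hord : items.Pairwise fun q p => Ordered cutOf p q)
    (hprec : todo.Pairwise fun p q => Precedes p.1 q.1)
    (hprec' : ∀ p ∈ items, ∀ q ∈ todo, Precedes p.1 q.1)
    (hcov : E = cover items ++ (todo.map Prod.snd).flatten) :
    ∃ items' hi, RunsIn (poolAll (todo.map (mkBlock cutOf)) (items.map (entry cutOf)))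
        (items'.map (entry cutOf)) 1 hi ∧
      hi + 30 * items'.length ≤ 30 * items.length + 61 * todo.length + 1 ∧
      (∀ p ∈ items', ItemOK E arr J j p) ∧ (items'.Pairwise fun q p => Ordered cutOf p q) ∧
      cover items' = E := by
  induction todo generalizing items with
  | nil =>
    refine ⟨items, 1, RunsIn.of_run 1 fun _ => rfl, by simp; omega, hitems, hord, ?_⟩
    simpa using hcov.symm
  | cons it todo ih =>
    rw [List.pairwise_cons] at hprec
    obtain ⟨items₁, hi₁, h1, h2, h3, h4, h5, h6⟩ := pool_runs hE hP items it
      (todo.map Prod.snd).flatten (htodo it List.mem_cons_self) hitems hord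
      (fun p hp => hprec' p hp it List.mem_cons_self) (by simpa using hcov)
    obtain ⟨items', hi, g1, g2, g3, g4, g5⟩ := ih items₁
      (fun q hq => htodo q (List.mem_cons_of_mem _ hq)) h3 h4 hprec.2
      (fun p hp q hq => h6 q.1 (fun r hr => hprec' r hr q (List.mem_cons_of_mem _ hq))
        (hprec.1 q hq) p hp) (by rw [h5]; simpa using hcov)
    refine ⟨items', 1 + (hi₁ + hi), (RunsIn.tick_bind (h1.bind g1)).mono (by omega) le_rfl,
      ?_, g3, g4, g5⟩
    simp only [List.length_cons]; omega

theorem unstack_runs (items : List Item) (acc : List Box) :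
    RunsIn (unstack (items.map (entry cutOf)) acc)
      ((items.map (outBox cutOf)).reverse ++ acc) 1 (items.length + 1) := by
  induction items generalizing acc with
  | nil => exact ⟨1, le_rfl, by simp, fun _ => rfl⟩
  | cons it items ih =>
    have := RunsIn.tick_bind (k := fun _ => unstack (items.map (entry cutOf))
      (outBox cutOf it :: acc)) (ih (outBox cutOf it :: acc))
    simp only [List.map_cons, List.reverse_cons, List.append_assoc, List.singleton_append]
    exact this.mono (by omega) (by simp only [List.length_cons]; omega)

end

/-! ### One iteration -/

section
variable {E : List Cell} {arr : ℕ → ℝ} {cutOf : Box → Option Cut} {J : ℕ → Box → Prop} {j : ℕ}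

theorem cover_eq (items : List Item) : cover items = (items.reverse.map Prod.snd).flatten := by
  induction items with
  | nil => rfl
  | cons it items ih => simp [cover, ih]

/-- If no violators are left, the regression value of a block is on the same side of a cut as its
limit mean: the case of "below". -/
theorem regression_below (hE : StableCells E) {L : List Item} (hL : ∀ p ∈ L, ItemOK E arr J j p)
    (hP : Phase E arr cutOf J)
    (hord : L.Pairwise (Ordered cutOf)) (hcov : (L.map Prod.snd).flatten = E) {c : Cut}
    {S : ℝ → Prop} (hS : (∀ x, S x ↔ x < c.y) ∨ (∀ x, S x ↔ x ≤ c.y)) {L₁ L₂ : List Item}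
    {it : Item} (hsplit : L = L₁ ++ it :: L₂) (hc : cutOf it.1 = some c) (ha : S it.1.a)
    (hm : S (cellMean it.2)) : ∀ e ∈ it.2, S e.2 := by
  have hlow : ∀ x y, x ≤ y → S y → S x := by
    intro x y hxy hy
    rcases hS with hS | hS <;> rw [hS] at hy ⊢ <;> linarith
  induction hk : L₁.length using Nat.strong_induction_on generalizing L₁ L₂ it with
  | _ k ih =>
  intro e he
  -- If all earlier regression values were smaller than `e.2`, stability would bound `e.2` by the
  -- limit mean. So some earlier block has a value at least `e.2`, and that value is on the right
  -- side of the cut by its extent or by induction on the number of earlier blocks.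
  by_contra hne
  have hit := hL it (by simp [hsplit])
  refine hne (hlow _ _ (hE.le_mean (L₁.map Prod.snd).flatten it.2 (L₂.map Prod.snd).flatten e.2
    ?_ hit.fits.ne (fun x hx => ?_) fun x hx => (hit.fits.const e he x hx).le) hm)
  · rw [← hcov, hsplit]; simp
  · by_contra! hlt
    refine hne (hlow _ _ hlt ?_)
    obtain ⟨seg, hseg, hxs⟩ := List.mem_flatten.1 hx
    obtain ⟨p, hp, rfl⟩ := List.mem_map.1 hseg
    obtain ⟨M₁, M₂, rfl⟩ := List.append_of_mem hp
    have hpit : Ordered cutOf p it := by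
      rw [hsplit] at hord
      exact (List.pairwise_append.1 hord).2.2 p (by simp) it (by simp)
    have hpok := hL p (by simp [hsplit])
    rcases hpit with h | ⟨hs, h⟩
    · exact hlow _ _ ((hpok.fits.mem x hxs).2.trans h) ha
    · have hcp : cutOf p.1 = some c := (hP.cut_congr _ _ hs).trans hc
      refine ih M₁.length (by rw [← hk]; simp) (L₁ := M₁) (L₂ := M₂ ++ it :: L₂) (it := p)
        (by simp [hsplit]) hcp (by rw [hs.1]; exact ha) ?_ rfl x hxs
      have h := h c hcp
      rcases hS with hS | hS
      · rw [hS] at hm ⊢; exact h.1 hm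
      · rw [hS] at hm ⊢; exact h.2 hm

theorem regression_above (hE : StableCells E) {L : List Item} (hL : ∀ p ∈ L, ItemOK E arr J j p)
    (hP : Phase E arr cutOf J)
    (hord : L.Pairwise (Ordered cutOf)) (hcov : (L.map Prod.snd).flatten = E) {c : Cut}
    {S : ℝ → Prop} (hS : (∀ x, S x ↔ c.y < x) ∨ (∀ x, S x ↔ c.y ≤ x)) {L₁ L₂ : List Item}
    {it : Item} (hsplit : L = L₁ ++ it :: L₂) (hc : cutOf it.1 = some c) (hb : S it.1.b)
    (hm : S (cellMean it.2)) : ∀ e ∈ it.2, S e.2 := by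
  have hup : ∀ x y, x ≤ y → S x → S y := by
    intro x y hxy hx
    rcases hS with hS | hS <;> rw [hS] at hx ⊢ <;> linarith
  induction hk : L₂.length using Nat.strong_induction_on generalizing L₁ L₂ it with
  | _ k ih =>
  intro e he
  by_contra hne
  have hit := hL it (by simp [hsplit])
  refine hne (hup _ _ (hE.mean_le (L₁.map Prod.snd).flatten it.2 (L₂.map Prod.snd).flatten e.2
    ?_ hit.fits.ne (fun x hx => (hit.fits.const x hx e he).le) fun x hx => ?_) hm)
  · rw [← hcov, hsplit]; simp
  · by_contra! hlt
    refine hne (hup _ _ hlt ?_)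
    obtain ⟨seg, hseg, hxs⟩ := List.mem_flatten.1 hx
    obtain ⟨p, hp, rfl⟩ := List.mem_map.1 hseg
    obtain ⟨M₁, M₂, rfl⟩ := List.append_of_mem hp
    have hpit : Ordered cutOf it p := by
      rw [hsplit] at hord
      exact (List.pairwise_cons.1 (List.pairwise_append.1 hord).2.1).1 p (by simp)
    have hpok := hL p (by simp [hsplit])
    rcases hpit with h | ⟨hs, h⟩
    · exact hup _ _ (h.trans (hpok.fits.mem x hxs).1) hb
    · have hcp : cutOf p.1 = some c := (hP.cut_congr _ _ hs).symm.trans hc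
      refine ih M₂.length (by rw [← hk]; simp; omega) (L₁ := L₁ ++ it :: M₁) (L₂ := M₂) (it := p)
        (by simp [hsplit]) hcp (by rw [← hs.2.1]; exact hb) ?_ rfl x hxs
      have h := h c hc
      rcases hS with hS | hS
      · rw [hS] at hm ⊢
        by_contra! h'
        exact absurd (h.2 h') (not_le.2 hm)
      · rw [hS] at hm ⊢
        by_contra! h'
        exact absurd (h.1 h') (not_lt.2 hm)

/-- The new box of a block fits if no violators are left. -/
theorem outBox_itemOK (hE : StableCells E) (hP : Phase E arr cutOf J) {L : List Item}
    (hL : ∀ p ∈ L, ItemOK E arr J j p) (hord : L.Pairwise (Ordered cutOf))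
    (hcov : (L.map Prod.snd).flatten = E) {it : Item} (hmem : it ∈ L) :
    ItemOK E arr J (j + 1) (outBox cutOf it, it.2) := by
  obtain ⟨L₁, L₂, hsplit⟩ := List.append_of_mem hmem
  have hit := hL it hmem
  have hf := hit.fits
  have hlen : (outBox cutOf it).len = it.2.length := (outBox_len it).trans hf.len
  cases hc : cutOf it.1 with
  | none =>
    rw [outBox_none hc]
    exact ⟨hf, hP.keep j _ hit.inv hc⟩
  | some c =>
    have hok := hP.ok j it.1 c hit.inv hc
    -- An extent that is already a point may still be cut, for example when all data are equal. The
    -- cut is then that point, so a regression value different from it cannot occur there.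
    have hcand : ∀ e ∈ it.2, e.2 ≠ c.y → (∃ e' ∈ E, e'.1.1 = e.2) →
        ∃ k, it.1.lo ≤ k ∧ k < it.1.hi ∧ arr k = e.2 := by
      intro e he hne hex
      refine (hf.cand e he hex).resolve_left fun hab => hne ?_
      have := hf.mem e he
      exact le_antisymm (by linarith [hok.ge]) (by linarith [hok.le])
    rcases lt_trichotomy (cellMean it.2) c.y with hm | hm | hm
    · have ha := hit.lt_of_mean_lt hE hP hc hm
      have hg := regression_below hE hL hP hord hcov (S := fun x => x < c.y)
        (Or.inl fun _ => Iff.rfl) hsplit hc ha hm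
      rw [outBox_lt hc hm] at hlen ⊢
      refine ⟨⟨hf.ne, hf.sub, hlen, ha.le, hf.const,
        fun e he => ⟨(hf.mem e he).1, (hg e he).le⟩, fun e he hex => ?_⟩,
        hP.lower j _ c hit.inv hc ha⟩
      obtain ⟨k, h1, h2, h3⟩ := hcand e he (hg e he).ne hex
      exact Or.inr ⟨k, h1, hok.below k h1 h2 (by rw [h3]; exact hg e he), h3⟩
    · have hg := regression_below hE hL hP hord hcov (S := fun x => x ≤ c.y)
        (Or.inr fun _ => Iff.rfl) hsplit hc hok.ge hm.le
      have hg' := regression_above hE hL hP hord hcov (S := fun x => c.y ≤ x)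
        (Or.inr fun _ => Iff.rfl) hsplit hc hok.le hm.ge
      rw [outBox_eq hc hm] at hlen ⊢
      exact ⟨⟨hf.ne, hf.sub, hlen, le_rfl, hf.const, fun e he => ⟨hg' e he, hg e he⟩,
        fun e he _ => Or.inl rfl⟩, hP.point j _ c hit.inv hc⟩
    · have hb := hit.lt_of_lt_mean hE hP hc hm
      have hg := regression_above hE hL hP hord hcov (S := fun x => c.y < x)
        (Or.inl fun _ => Iff.rfl) hsplit hc hb hm
      rw [outBox_gt hc hm] at hlen ⊢
      refine ⟨⟨hf.ne, hf.sub, hlen, hb.le, hf.const,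
        fun e he => ⟨(hg e he).le, (hf.mem e he).2⟩, fun e he hex => ?_⟩,
        hP.upper j _ c hit.inv hc hb⟩
      obtain ⟨k, h1, h2, h3⟩ := hcand e he (hg e he).ne' hex
      exact Or.inr ⟨k, hok.above k h1 h2 (by rw [h3]; exact hg e he), h2, h3⟩

/-- Extents after the partitioning are again in order or equal, which is the invariant that the next
iteration starts from. -/
theorem outBox_precedes (hP : Phase E arr cutOf J) {p q : Item}
    (hp : ItemOK E arr J j p) (hq : ItemOK E arr J j q) (h : Ordered cutOf p q) :
    Precedes (outBox cutOf p) (outBox cutOf q) := by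
  rcases h with h | ⟨hs, h⟩
  · have h1 := hp.outBox_subset hP
    have h2 := hq.outBox_subset hP
    exact Or.inl (by linarith)
  · have hcc := hP.cut_congr _ _ hs
    cases hc : cutOf p.1 with
    | none => rw [outBox_none hc, outBox_none (hcc ▸ hc)]; exact Or.inr hs
    | some c =>
      have hc' : cutOf q.1 = some c := hcc ▸ hc
      have h := h c hc
      rcases lt_trichotomy (cellMean q.2) c.y with hm | hm | hm
      · rw [outBox_lt hc' hm, outBox_lt hc (h.1 hm)]
        exact Or.inr ⟨hs.1, rfl, hs.2.2.1, rfl⟩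
      · rw [outBox_eq hc' hm]
        rcases (h.2 hm.le).eq_or_lt with hm' | hm'
        · rw [outBox_eq hc hm']; exact Or.inl le_rfl
        · rw [outBox_lt hc hm']; exact Or.inl le_rfl
      · rw [outBox_gt hc' hm]
        rcases lt_trichotomy (cellMean p.2) c.y with hm' | hm' | hm'
        · rw [outBox_lt hc hm']; exact Or.inl le_rfl
        · rw [outBox_eq hc hm']; exact Or.inl le_rfl
        · rw [outBox_gt hc hm']
          exact Or.inr ⟨rfl, hs.2.1, rfl, hs.2.2.2⟩

/-- The invariants of a list of boxes after `j` iterations, witnessed by the blocks `L`. -/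
structure State (E : List Cell) (arr : ℕ → ℝ) (J : ℕ → Box → Prop) (j : ℕ) (L : List Item) :
    Prop where
  ok : ∀ p ∈ L, ItemOK E arr J j p
  prec : L.Pairwise fun p q => Precedes p.1 q.1
  cov : (L.map Prod.snd).flatten = E

theorem length_le_of_forall_ne_nil {L : List Item} (h : ∀ p ∈ L, p.2 ≠ []) :
    L.length ≤ (L.map Prod.snd).flatten.length := by
  induction L with
  | nil => simp
  | cons p L ih =>
    have h1 := List.length_pos_iff.2 (h p List.mem_cons_self)
    have h2 := ih fun q hq => h q (List.mem_cons_of_mem _ hq)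
    simp only [List.map_cons, List.flatten_cons, List.length_append, List.length_cons]
    omega

theorem State.length_le {L : List Item} (h : State E arr J j L) : L.length ≤ E.length := by
  rw [← h.cov]
  exact length_le_of_forall_ne_nil fun p hp => (h.ok p hp).fits.ne

/-! ### Running time of an iteration and of a phase -/

theorem prepare_runs {pick : Box → RAM (Option Cut)} (hpick : ∀ X, RunsIn (pick X) (cutOf X) 1 6)
    (L : List Item) (hL : ∀ p ∈ L, p.1.len = p.2.length) :
    RunsIn (prepare pick (L.map Prod.fst) ((L.map Prod.snd).flatten.map Prod.fst))
      (L.map (mkBlock cutOf)) (L.map Prod.snd).flatten.length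
      (8 * L.length + 9 * (L.map Prod.snd).flatten.length + 1) := by
  induction L with
  | nil => exact ⟨1, by simp, by simp, fun _ => rfl⟩
  | cons p L ih =>
    have hp := hL p List.mem_cons_self
    have ih := ih fun q hq => hL q (List.mem_cons_of_mem _ hq)
    have hlen : p.1.len = (p.2.map Prod.fst).length := by simpa using hp
    simp only [List.map_cons, List.flatten_cons, List.map_append, List.length_append,
      List.length_cons]
    have hpk := hpick p.1
    cases hc : cutOf p.1 with
    | none =>
      have hb : mkBlock cutOf p = ⟨p.1, none, Stats.empty⟩ := by simp [mkBlock, itemStats, hc]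
      rw [hc] at hpk
      have hs := skip_runs (p.2.map Prod.fst) ((L.map Prod.snd).flatten.map Prod.fst)
      rw [← hlen] at hs
      rw [hb]
      exact (RunsIn.tick_bind (hpk.bind (hs.bind (ih.bind (RunsIn.pure
        ((⟨p.1, none, Stats.empty⟩ : Block) :: L.map (mkBlock cutOf))))))).mono
        (by omega) (by omega)
    | some c =>
      have hb : mkBlock cutOf p = ⟨p.1, some c, Stats.of c.y (p.2.map Prod.fst)⟩ := by
        simp [mkBlock, itemStats, hc]
      rw [hc] at hpk
      have hs := scan_runs c.y (p.2.map Prod.fst) ((L.map Prod.snd).flatten.map Prod.fst)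
        Stats.empty
      rw [← hlen, Stats.empty_combine] at hs
      rw [hb]
      exact (RunsIn.tick_bind (hpk.bind (hs.bind (ih.bind (RunsIn.pure
        ((⟨p.1, some c, Stats.of c.y (p.2.map Prod.fst)⟩ : Block) ::
          L.map (mkBlock cutOf))))))).mono (by omega) (by omega)

theorem anyActive_runs {pick : Box → RAM (Option Cut)}
    (hpick : ∀ X, RunsIn (pick X) (cutOf X) 1 6) (boxes : List Box) :
    RunsIn (anyActive pick boxes) (boxes.any fun X => (cutOf X).isSome) 1
      (7 * boxes.length + 1) := by
  induction boxes with
  | nil => exact ⟨1, by simp, by simp, fun _ => rfl⟩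
  | cons X boxes ih =>
    have hpk := hpick X
    cases hc : cutOf X with
    | none =>
      rw [hc] at hpk
      simp only [List.any_cons, hc, Option.isSome_none, Bool.false_or, List.length_cons]
      exact (RunsIn.tick_bind (hpk.bind ih)).mono (by omega) (by omega)
    | some c =>
      rw [hc] at hpk
      simp only [List.any_cons, hc, Option.isSome_some, Bool.true_or, List.length_cons]
      exact (RunsIn.tick_bind (hpk.bind (RunsIn.pure true))).mono (by omega) (by omega)

/-- A continuation `k` follows the iteration, so that the bound fits the nested binds of the
recursive program without reassociating them. The lower bound `E.length` is the reading of all data.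
-/
theorem iteration_runs (hE : StableCells E) (hP : Phase E arr cutOf J)
    {pick : Box → RAM (Option Cut)} (hpick : ∀ X, RunsIn (pick X) (cutOf X) 1 6)
    {L : List Item} (hL : State E arr J j L) : ∃ L', State E arr J (j + 1) L' ∧
      ∀ (k : List Box → RAM (List Box)) (y : List Box) (lo hi : ℕ),
        RunsIn (k (L'.map Prod.fst)) y lo hi → RunsIn (prepare pick (L.map Prod.fst) (E.map Prod.fst) >>= fun blocks =>
        poolAll blocks [] >>= fun stack => unstack stack [] >>= k) y
        (E.length + lo) (79 * E.length + 3 + hi) := by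
  have hprep := prepare_runs hpick L fun p hp => (hL.ok p hp).fits.len
  rw [hL.cov] at hprep
  obtain ⟨items, hi', h1, h2, h3, h4, h5⟩ := poolAll_runs hE hP L [] hL.ok (by simp)
    List.Pairwise.nil hL.prec (by simp) (by simpa [cover] using hL.cov.symm)
  have hun := unstack_runs (cutOf := cutOf) items []
  set M := items.reverse with hM
  have hMok : ∀ p ∈ M, ItemOK E arr J j p := fun p hp => h3 p (by simpa [hM] using hp)
  have hMord : M.Pairwise (Ordered cutOf) := by rw [hM, List.pairwise_reverse]; exact h4
  have hMcov : (M.map Prod.snd).flatten = E := by rw [← h5, cover_eq]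
  refine ⟨M.map fun it => (outBox cutOf it, it.2), ⟨?_, ?_, ?_⟩, fun k y lo hi hk => ?_⟩
  · intro p hp
    obtain ⟨it, hit, rfl⟩ := List.mem_map.1 hp
    exact outBox_itemOK hE hP hMok hMord hMcov hit
  · rw [List.pairwise_map]
    exact hMord.imp_of_mem fun hp hq h => outBox_precedes hP (hMok _ hp) (hMok _ hq) h
  · rw [List.map_map, ← hMcov]; rfl
  · have hout : (items.map (outBox cutOf)).reverse ++ [] =
        (M.map fun it => (outBox cutOf it, it.2)).map Prod.fst := by
      simp [hM, List.map_reverse, Function.comp_def]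
    rw [hout] at hun
    have hlenL := hL.length_le
    have hlen : items.length ≤ E.length := by
      have := length_le_of_forall_ne_nil fun p hp => (hMok p hp).fits.ne
      rw [hMcov] at this
      simpa [hM] using this
    simp only [List.length_nil, mul_zero, zero_add] at h2
    exact (hprep.bind (h1.bind (hun.bind hk))).mono (by omega) (by omega)

theorem iterations_runs_done {pick : Box → RAM (Option Cut)}
    (hpick : ∀ X, RunsIn (pick X) (cutOf X) 1 6) {L : List Item}
    (hact : ∀ p ∈ L, cutOf p.1 = none) {data : List (ℝ × ℝ)} :
    RunsIn (iterations pick data (L.map Prod.fst)) (L.map Prod.fst) 0 (7 * L.length + 2) := by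
  have hany := anyActive_runs hpick (L.map Prod.fst)
  rw [List.length_map, show ((L.map Prod.fst).any fun X => (cutOf X).isSome) = false from by
    rw [List.any_eq_false]
    intro X hX
    obtain ⟨p, hp, rfl⟩ := List.mem_map.1 hX
    simp [hact p hp]] at hany
  rw [iterations]
  exact (RunsIn.tick_bind (hany.bind (RunsIn.pure (L.map Prod.fst)))).mono (by simp) (by omega)

/-- `N` is a number of iterations after which the invariant `J` leaves nothing to cut. Of the
constants, `79 * E.length + 3` is for the iteration and the rest for testing whether one is needed.
The actual number `k` of iterations is recorded for the lower bound. -/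
theorem iterations_runs (hE : StableCells E) (hP : Phase E arr cutOf J)
    {pick : Box → RAM (Option Cut)} (hpick : ∀ X, RunsIn (pick X) (cutOf X) 1 6) (N : ℕ)
    (hN : ∀ X, J (j + N) X → cutOf X = none) {L : List Item} (hL : State E arr J j L) :
    ∃ k L', k ≤ N ∧ State E arr J (j + k) L' ∧ (∀ p ∈ L', cutOf p.1 = none) ∧
      RunsIn (iterations pick (E.map Prod.fst) (L.map Prod.fst)) (L'.map Prod.fst)
        (k * E.length) ((N + 1) * (86 * E.length + 5)) := by
  induction N generalizing j L with
  | zero =>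
    have hact : ∀ p ∈ L, cutOf p.1 = none := fun p hp => hN p.1 (hL.ok p hp).inv
    exact ⟨0, L, le_rfl, hL, hact, (iterations_runs_done hpick hact).mono (by simp)
      (by linarith [hL.length_le])⟩
  | succ N ih =>
    by_cases hact : ∀ p ∈ L, cutOf p.1 = none
    · refine ⟨0, L, Nat.zero_le _, hL, hact, (iterations_runs_done hpick hact).mono (by simp) ?_⟩
      nlinarith [hL.length_le]
    · push Not at hact
      obtain ⟨p, hp, hpc⟩ := hact
      have hany := anyActive_runs hpick (L.map Prod.fst)
      rw [List.length_map, show ((L.map Prod.fst).any fun X => (cutOf X).isSome) = true from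
        List.any_eq_true.2 ⟨p.1, List.mem_map.2 ⟨p, hp, rfl⟩,
          Option.isSome_iff_ne_none.2 hpc⟩] at hany
      obtain ⟨M, hM, hrun⟩ := iteration_runs hE hP hpick hL
      obtain ⟨k, L', hk, hL', hnone, hr⟩ := ih (j := j + 1)
        (fun X hX => hN X (by convert hX using 1; omega)) hM
      refine ⟨k + 1, L', by omega, by convert hL' using 1; omega, hnone, ?_⟩
      rw [iterations]
      refine (RunsIn.tick_bind (hany.bind (hrun _ _ _ _ hr))).mono ?_ ?_
      · rw [add_mul]; omega
      · have := hL.length_le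
        rw [add_mul (N + 1)]; omega

end

/-! ### The two phases -/

/-- The cut at the median of the candidates. -/
noncomputable def medianCut (arr : ℕ → ℝ) (X : Box) : Option Cut :=
  if X.lo < X.hi then some ⟨arr ((X.lo + X.hi) / 2), (X.lo + X.hi) / 2, (X.lo + X.hi) / 2 + 1⟩
  else none

/-- The invariant of the first phase; `m` is the number of distinct data values. -/
def MedianInv (arr : ℕ → ℝ) (m j : ℕ) (X : Box) : Prop :=
  (∃ k < m, arr k = X.a) ∧ (∃ k < m, arr k = X.b) ∧ X.hi ≤ m ∧ (X.hi - X.lo) * 2 ^ j ≤ m ∧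
    (X.lo < X.hi → X.a = arr (X.lo - 1) ∧ X.b = arr (min X.hi (m - 1)))

/-- The cut at the midpoint of the extent. -/
noncomputable def midCut (δ : ℝ) (X : Box) : Option Cut :=
  if δ < X.b - X.a then some ⟨(X.a + X.b) / 2, X.hi, X.lo⟩ else none

/-- The invariant of the second phase; `T j` holds for the ends of the extents after `j`
iterations. -/
def MidInv (T : ℕ → ℝ → Prop) (δ D : ℝ) (j : ℕ) (X : Box) : Prop :=
  T j X.a ∧ T j X.b ∧ X.hi ≤ X.lo ∧ (X.b - X.a ≤ δ ∨ (X.b - X.a) * 2 ^ j ≤ D)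

theorem pickData_runs (A : Array ℝ) (X : Box) :
    RunsIn (pickData A X) (medianCut (fun k => A.getD k 0) X) 1 6 := by
  by_cases h : X.lo < X.hi
  · refine ⟨6, by norm_num, le_rfl, fun s => ?_⟩
    simp [pickData, medianCut, h, run_tick, run_ltN, run_addN, run_halfN, run_readA]
  · refine ⟨2, by norm_num, by norm_num, fun s => ?_⟩
    simp [pickData, medianCut, h, run_tick, run_ltN]

theorem pickMid_runs (δ : ℝ) (X : Box) : RunsIn (pickMid δ X) (midCut δ X) 1 6 := by
  by_cases h : δ < X.b - X.a
  · refine ⟨5, by norm_num, by norm_num, fun s => ?_⟩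
    simp [pickMid, midCut, h, run_tick, run_ltR, run_addR, run_halfR, run_subR]
  · refine ⟨3, by norm_num, by norm_num, fun s => ?_⟩
    simp [pickMid, midCut, h, run_tick, run_ltR, run_subR]

theorem medianCut_phase {E : List Cell} {arr : ℕ → ℝ} {m : ℕ}
    (harr : ∀ i k, i < k → k < m → arr i < arr k)
    (hval : ∀ e ∈ E, ∃ k < m, arr k = e.1.1) :
    Phase E arr (medianCut arr) (MedianInv arr m) := by
  have hmono : ∀ i k, i ≤ k → k < m → arr i ≤ arr k := fun i k hik hk => by
    rcases hik.eq_or_lt with rfl | h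
    exacts [le_rfl, (harr i k h hk).le]
  have hinj : ∀ i k, i < m → k < m → arr i < arr k → i < k := fun i k hi hk h => by
    by_contra! h'
    exact absurd (hmono k i h' hi) (not_le.2 h)
  have hcut : ∀ X c, medianCut arr X = some c → X.lo < X.hi ∧
      c = ⟨arr ((X.lo + X.hi) / 2), (X.lo + X.hi) / 2, (X.lo + X.hi) / 2 + 1⟩ := by
    intro X c h
    unfold medianCut at h
    split_ifs at h with hlt
    exact ⟨hlt, (Option.some.inj h).symm⟩
  have hpow : ∀ (j d d' : ℕ), 2 * d' ≤ d → d * 2 ^ j ≤ m → d' * 2 ^ (j + 1) ≤ m := by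
    intro j d d' h1 h2
    calc d' * 2 ^ (j + 1) = 2 * d' * 2 ^ j := by ring
      _ ≤ d * 2 ^ j := Nat.mul_le_mul_right _ h1
      _ ≤ m := h2
  refine ⟨?_, ?_, ?_, ?_, ?_, ?_, ?_⟩
  · rintro X Y ⟨ha, hb, hl, hh⟩
    simp [medianCut, hl, hh]
  · rintro j X Y ⟨ha, hb, hl, hh⟩ hX
    simpa [MedianInv, ha, hb, hl, hh] using hX
  · rintro j X c ⟨-, -, hm, -, h⟩ hc
    obtain ⟨hlt, rfl⟩ := hcut X c hc
    obtain ⟨ha, hb⟩ := h hlt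
    refine ⟨?_, ?_, fun heq e he => ?_, fun heq e he => ?_, fun k h1 h2 h3 => ?_,
      fun k h1 h2 h3 => ?_⟩
    · rw [ha]; exact hmono _ _ (by omega) (by omega)
    · rw [hb]; exact hmono _ _ (by omega) (by omega)
    -- The median equals the lower end only if both have rank `0`. For `lo = 0` truncated
    -- subtraction makes `lo - 1` equal to `0`: the end is the minimum of the data, itself a
    -- candidate at the start.
    · obtain ⟨k, hk, hk'⟩ := hval e he
      rw [← hk']
      refine hmono _ _ ?_ hk
      by_contra! hlt'
      refine absurd heq (ne_of_gt ?_)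
      rw [ha]
      exact harr _ _ (by omega) (by omega)
    · obtain ⟨k, hk, hk'⟩ := hval e he
      rw [← hk']
      refine hmono _ _ ?_ (by omega)
      by_contra! hlt'
      refine absurd heq (ne_of_lt ?_)
      rw [hb]
      exact harr _ _ (by omega) (by omega)
    · exact hinj k ((X.lo + X.hi) / 2) (by omega) (by omega) h3
    · exact hinj _ _ (by omega) (by omega) h3
  · rintro j X c ⟨h1, h2, hm, hj, h⟩ hc -
    obtain ⟨hlt, rfl⟩ := hcut X c hc
    obtain ⟨ha, hb⟩ := h hlt
    refine ⟨h1, ⟨_, by omega, rfl⟩, by dsimp only; omega, hpow j _ _ (by dsimp only; omega) hj,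
      fun h' => ⟨ha, ?_⟩⟩
    dsimp only at h' ⊢
    rw [min_eq_left (by omega)]
  · rintro j X c ⟨h1, h2, hm, hj, h⟩ hc
    obtain ⟨hlt, rfl⟩ := hcut X c hc
    -- A point extent gets the empty range `lo = hi = 0`, so the conditions about its candidates are
    -- trivial.
    exact ⟨⟨_, by omega, rfl⟩, ⟨_, by omega, rfl⟩, Nat.zero_le _, by simp, by simp⟩
  · rintro j X c ⟨h1, h2, hm, hj, h⟩ hc -
    obtain ⟨hlt, rfl⟩ := hcut X c hc
    obtain ⟨ha, hb⟩ := h hlt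
    exact ⟨⟨_, by omega, rfl⟩, h2, hm, hpow j _ _ (by dsimp only; omega) hj,
      fun h' => ⟨by simp, hb⟩⟩
  · rintro j X ⟨h1, h2, hm, hj, h⟩ hc
    have hlt : ¬ X.lo < X.hi := fun hlt => by simp [medianCut, hlt] at hc
    exact ⟨h1, h2, hm, hpow j _ _ (by omega) hj, fun h' => absurd h' hlt⟩

/-- The cut is strictly inside the extent, so the conditions at its ends are vacuous, and the
candidates are passed on unchanged. The predicate `T` follows the arithmetic form of the ends under
averaging. -/
theorem midCut_phase (E : List Cell) (arr : ℕ → ℝ) {T : ℕ → ℝ → Prop} {δ D : ℝ} (hδ : 0 < δ)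
    (hT : ∀ j x, T j x → T (j + 1) x) (hT' : ∀ j x y, T j x → T j y → T (j + 1) ((x + y) / 2)) :
    Phase E arr (midCut δ) (MidInv T δ D) := by
  have hcut : ∀ X c, midCut δ X = some c → δ < X.b - X.a ∧
      c = ⟨(X.a + X.b) / 2, X.hi, X.lo⟩ := by
    intro X c h
    unfold midCut at h
    split_ifs at h with hlt
    exact ⟨hlt, (Option.some.inj h).symm⟩
  refine ⟨?_, ?_, ?_, ?_, ?_, ?_, ?_⟩
  · rintro X Y ⟨ha, hb, hl, hh⟩
    simp [midCut, ha, hb, hl, hh]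
  · rintro j X Y ⟨ha, hb, hl, hh⟩ hX
    simpa [MidInv, ha, hb, hl, hh] using hX
  · rintro j X c - hc
    obtain ⟨hlt, rfl⟩ := hcut X c hc
    refine ⟨by dsimp only; linarith, by dsimp only; linarith, fun h => ?_, fun h => ?_,
      fun k _ h _ => h, fun k h _ _ => h⟩ <;> dsimp only at h <;> linarith
  · rintro j X c ⟨h1, h2, h3, h4⟩ hc -
    obtain ⟨hlt, rfl⟩ := hcut X c hc
    have h4 := h4.resolve_left (by linarith)
    refine ⟨hT j _ h1, hT' j _ _ h1 h2, h3, Or.inr ?_⟩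
    calc ((X.a + X.b) / 2 - X.a) * 2 ^ (j + 1) = (X.b - X.a) * 2 ^ j := by ring
      _ ≤ D := h4
  · rintro j X c ⟨h1, h2, h3, h4⟩ hc
    obtain ⟨hlt, rfl⟩ := hcut X c hc
    exact ⟨hT' j _ _ h1 h2, hT' j _ _ h1 h2, le_rfl, Or.inl (by simpa using hδ.le)⟩
  · rintro j X c ⟨h1, h2, h3, h4⟩ hc -
    obtain ⟨hlt, rfl⟩ := hcut X c hc
    have h4 := h4.resolve_left (by linarith)
    refine ⟨hT' j _ _ h1 h2, hT j _ h2, h3, Or.inr ?_⟩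
    calc (X.b - (X.a + X.b) / 2) * 2 ^ (j + 1) = (X.b - X.a) * 2 ^ j := by ring
      _ ≤ D := h4
  · rintro j X ⟨h1, h2, h3, h4⟩ hc
    have hlt : ¬ δ < X.b - X.a := fun hlt => by simp [midCut, hlt] at hc
    exact ⟨hT j _ h1, hT j _ h2, h3, Or.inl (not_lt.1 hlt)⟩

/-! ### The algorithm -/

/-- The output for the blocks `L`. -/
def outputOf (L : List Item) : List (ℝ × ℝ) :=
  (L.map Prod.fst).flatMap fun X => List.replicate X.len (X.a, X.b)

/-- Single vertices have constant regression value, and the limit regression lies between the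
smallest and the largest data value. All ranks are candidates at the start. -/
theorem initial_state {E : List Cell} {arr : ℕ → ℝ} {m : ℕ}
    (harr : ∀ i k, i < k → k < m → arr i < arr k)
    (hval : ∀ e ∈ E, ∃ k < m, arr k = e.1.1)
    (hbd : ∀ a b, (∀ e ∈ E, a ≤ e.1.1 ∧ e.1.1 ≤ b) → ∀ e ∈ E, a ≤ e.2 ∧ e.2 ≤ b) :
    State E arr (MedianInv arr m) 0
      (E.map fun e => (⟨1, arr 0, arr (m - 1), 0, m⟩, [e])) := by
  have hmono : ∀ i k, i ≤ k → k < m → arr i ≤ arr k := fun i k hik hk => by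
    rcases hik.eq_or_lt with rfl | h
    exacts [le_rfl, (harr i k h hk).le]
  have hbd' := hbd (arr 0) (arr (m - 1)) fun e he => by
    obtain ⟨k, hk, hk'⟩ := hval e he
    rw [← hk']
    exact ⟨hmono _ _ (Nat.zero_le _) hk, hmono _ _ (by omega) (by omega)⟩
  refine ⟨fun p hp => ?_, ?_, ?_⟩
  · obtain ⟨e, he, rfl⟩ := List.mem_map.1 hp
    obtain ⟨k, hk, -⟩ := hval e he
    refine ⟨⟨by simp, by simpa using he, by simp, hmono _ _ (Nat.zero_le _) (by omega), by simp,
      by simpa using hbd' e he, ?_⟩, ⟨0, by omega, rfl⟩, ⟨m - 1, by omega, rfl⟩, le_rfl, by simp,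
      fun _ => ⟨rfl, ?_⟩⟩
    · intro e' he' ⟨e'', he'', h⟩
      obtain ⟨k, hk, hk'⟩ := hval e'' he''
      exact Or.inr ⟨k, Nat.zero_le _, hk, hk'.trans h⟩
    · dsimp only
      rw [min_eq_right (by omega)]
  · rw [List.pairwise_map]
    exact List.pairwise_of_forall fun _ _ => Or.inr ⟨rfl, rfl, rfl, rfl⟩
  · rw [List.map_map, ← List.flatMap_def]
    exact List.flatMap_singleton' E

/-- The two phases are joined. `T` is a free parameter: it is trivial for correctness and for the
upper bound, and expresses dyadicity for the lower bound, where `k`, the number of halving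
iterations, matters. -/
theorem strictAlg_runs {E : List Cell} (hE : StableCells E)
    (hbd : ∀ a b, (∀ e ∈ E, a ≤ e.1.1 ∧ e.1.1 ≤ b) → ∀ e ∈ E, a ≤ e.2 ∧ e.2 ≤ b)
    {δ U : ℝ} (hδ : 0 < δ) (hU : ∀ e ∈ E, |e.1.1| ≤ U) {T : ℕ → ℝ → Prop}
    (hT₀ : ∀ e ∈ E, T 0 e.1.1)
    (hT : ∀ j x, T j x → T (j + 1) x) (hT' : ∀ j x y, T j x → T j y → T (j + 1) ((x + y) / 2))
    (N : ℕ) (hN : 2 * U ≤ δ * 2 ^ N) :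
    ∃ (arr : ℕ → ℝ) (k : ℕ) (L : List Item), State E arr (MidInv T δ (2 * U)) k L ∧
      (∀ p ∈ L, p.1.b - p.1.a ≤ δ) ∧
      RunsIn (strictAlg (E.map Prod.fst) δ) (outputOf L)
        (E.length * Nat.log 2 E.length + k * E.length)
        (8 * E.length * Nat.clog 2 E.length +
          (Nat.log 2 E.length + N + 3) * (86 * E.length + 5) + 6 * E.length + 10) := by
  have h1 := values_runs (E.map Prod.fst)
  obtain ⟨zs, h2, hz1, hz2, hz3⟩ := sortDistinct_runs ((E.map Prod.fst).map Prod.fst)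
  have h3 := fillArray_runs zs #[]
  set A : Array ℝ := #[] ++ zs.toArray with hA
  set arr : ℕ → ℝ := fun k => A.getD k 0 with harrdef
  have hsize : A.size = zs.length := by simp [hA]
  have hget : ∀ k (hk : k < zs.length), arr k = zs[k] := by
    intro k hk
    simp [harrdef, hA, Array.getD, hk]
  simp only [List.length_map] at h1 h2 hz2
  have harr : ∀ i k, i < k → k < A.size → arr i < arr k := by
    intro i k hik hk
    rw [hsize] at hk
    rw [hget i (by omega), hget k hk]
    exact List.pairwise_iff_getElem.1 hz1 i k _ _ hik
  have hval : ∀ e ∈ E, ∃ k < A.size, arr k = e.1.1 := by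
    intro e he
    have : e.1.1 ∈ zs := (hz3 _).2 (List.mem_map.2 ⟨e.1, List.mem_map.2 ⟨e, he, rfl⟩, rfl⟩)
    obtain ⟨k, hk, hk'⟩ := List.mem_iff_getElem.1 this
    exact ⟨k, by omega, by rw [hget k hk, hk']⟩
  have hval' : ∀ k < A.size, ∃ e ∈ E, e.1.1 = arr k := by
    intro k hk
    rw [hsize] at hk
    have := (hz3 _).1 (List.getElem_mem hk)
    obtain ⟨r, hr, hr'⟩ := List.mem_map.1 this
    obtain ⟨e, he, rfl⟩ := List.mem_map.1 hr
    exact ⟨e, he, by rw [hr', hget k hk]⟩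
  have hL₀ := initial_state harr hval hbd
  have h4 := initBoxes_runs (arr 0) (arr (A.size - 1)) A.size (E.map Prod.fst)
  rw [List.length_map, show List.replicate E.length (⟨1, arr 0, arr (A.size - 1), 0, A.size⟩ : Box)
    = (E.map fun e => ((⟨1, arr 0, arr (A.size - 1), 0, A.size⟩ : Box), [e])).map Prod.fst by
      rw [List.map_map]; simp [Function.comp_def]] at h4
  obtain ⟨k₁, L₁, hk₁, hL₁, hnone₁, h5⟩ := iterations_runs hE (medianCut_phase harr hval)
    -- A non-empty candidate range after `j` iterations needs `2 ^ j` distinct values, while there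
    -- are at most `E.length < 2 ^ (log + 1)`.
    (pickData_runs A) (Nat.log 2 E.length + 1) (fun X hX => by
      obtain ⟨-, -, -, hj, -⟩ := hX
      have hlt := Nat.lt_pow_succ_log_self (b := 2) (by norm_num) E.length
      refine if_neg fun hlt' => ?_
      have : 1 * 2 ^ (0 + (Nat.log 2 E.length + 1)) ≤ A.size :=
        (Nat.mul_le_mul_right _ (by omega)).trans hj
      rw [zero_add, one_mul] at this
      omega) hL₀
  -- The counter restarts at `0` for the second phase. After the first phase the ends are still data
  -- values, so they satisfy `T 0` and are at most `2 * U` apart.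
  have hL₁' : State E arr (MidInv T δ (2 * U)) 0 L₁ := by
    refine ⟨fun p hp => ⟨(hL₁.ok p hp).fits, ?_⟩, hL₁.prec, hL₁.cov⟩
    obtain ⟨⟨i, hi, hi'⟩, ⟨i', hi2, hi2'⟩, -, -, -⟩ := (hL₁.ok p hp).inv
    obtain ⟨e, he, hee⟩ := hval' i hi
    obtain ⟨e', he', hee'⟩ := hval' i' hi2
    have hn := hnone₁ p hp
    have b1 := abs_le.1 (hU e he)
    have b2 := abs_le.1 (hU e' he')
    refine ⟨?_, ?_, ?_, Or.inr ?_⟩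
    · rw [← hi', ← hee]; exact hT₀ e he
    · rw [← hi2', ← hee']; exact hT₀ e' he'
    · by_contra! h
      simp [medianCut, h] at hn
    · rw [← hi', ← hee, ← hi2', ← hee']; linarith
  obtain ⟨k, L, hk, hL, hnone, h6⟩ := iterations_runs hE
    (midCut_phase E arr (D := 2 * U) hδ hT hT') (pickMid_runs δ) N (fun X hX => by
      obtain ⟨-, -, -, hj⟩ := hX
      refine if_neg fun hlt => ?_
      have hj := hj.resolve_left (by linarith)
      rw [zero_add] at hj
      have : δ * 2 ^ N < (X.b - X.a) * 2 ^ N := mul_lt_mul_of_pos_right hlt (by positivity)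
      linarith) hL₁'
  rw [zero_add] at hL
  have h7 := output_runs (L.map Prod.fst)
  have hlens : ((L.map Prod.fst).map fun X => X.len).sum = E.length := by
    rw [← hL.cov, List.length_flatten, List.map_map, List.map_map]
    congr 1
    exact List.map_congr_left fun p hp => (hL.ok p hp).fits.len
  rw [hlens, List.length_map] at h7
  have hlenL := hL.length_le
  refine ⟨arr, k, L, hL, fun p hp => ?_, ?_⟩
  · by_contra! h
    have := hnone p hp
    simp [midCut, h] at this
  · have hrd : ∀ i, RunsIn (readA A i) (arr i) 1 1 := fun i => RunsIn.of_run 1 fun _ => rfl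
    have hpr : RunsIn (predN A.size) (A.size - 1) 1 1 := RunsIn.of_run 1 fun _ => rfl
    refine (RunsIn.tick_bind (h1.bind (h2.bind (h3.bind ((hrd 0).bind (hpr.bind
      ((hrd (A.size - 1)).bind (h4.bind (h5.bind (h6.bind h7)))))))))).mono ?_ ?_
    · omega
    · have e : (Nat.log 2 E.length + N + 3) * (86 * E.length + 5) =
          (Nat.log 2 E.length + 1 + 1) * (86 * E.length + 5) +
          (N + 1) * (86 * E.length + 5) := by ring
      rw [e]
      omega

/-! ### Correctness -/

/-- The output repeats each extent once per vertex of its block, so it is aligned entry by entry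
with the list of vertices. -/
theorem forall₂_outputOf {R : Cell → ℝ × ℝ → Prop} (L : List Item)
    (h : ∀ p ∈ L, p.1.len = p.2.length ∧ ∀ e ∈ p.2, R e (p.1.a, p.1.b)) :
    List.Forall₂ R (L.map Prod.snd).flatten (outputOf L) := by
  induction L with
  | nil => exact List.Forall₂.nil
  | cons p L ih =>
    have ih := ih fun q hq => h q (List.mem_cons_of_mem _ hq)
    obtain ⟨hlen, hp⟩ := h p List.mem_cons_self
    have h1 : ∀ (seg : List Cell) (z : ℝ × ℝ), (∀ e ∈ seg, R e z) →
        List.Forall₂ R seg (List.replicate seg.length z) := by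
      intro seg z hseg
      induction seg with
      | nil => exact List.Forall₂.nil
      | cons e seg ih =>
        exact List.Forall₂.cons (hseg e List.mem_cons_self)
          (ih fun x hx => hseg x (List.mem_cons_of_mem _ hx))
    simp only [outputOf, List.map_cons, List.flatten_cons, List.flatMap_cons] at ih ⊢
    rw [hlen]
    exact List.rel_append (h1 p.2 _ hp) ih

theorem State.outputOf_pairwise {E : List Cell} {arr : ℕ → ℝ} {J : ℕ → Box → Prop} {j : ℕ}
    {L : List Item} (hL : State E arr J j L) :
    (outputOf L).Pairwise fun z z' => z.1 ≤ z'.1 ∧ z.2 ≤ z'.2 := by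
  rw [outputOf, List.pairwise_flatMap]
  refine ⟨fun X _ => ?_, ?_⟩
  · exact List.pairwise_replicate.2 (Or.inr ⟨le_rfl, le_rfl⟩)
  · rw [List.pairwise_map]
    refine hL.prec.imp_of_mem fun {p q} hp hq hpq z hz z' hz' => ?_
    rw [(List.mem_replicate.1 hz).2, (List.mem_replicate.1 hz').2]
    have h1 := (hL.ok p hp).fits.le
    have h2 := (hL.ok q hq).fits.le
    rcases hpq with h | h
    · exact ⟨h1.trans h, h.trans h2⟩
    · exact ⟨h.1.le, h.2.1.le⟩

/-- The vertices of a function together with the limit of its isotonic regressions. -/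
def cellsOf {n : ℕ} (f w g : Fin n → ℝ) : List Cell := List.ofFn fun i => ((f i, w i), g i)

theorem map_fst_cellsOf {n : ℕ} (f w g : Fin n → ℝ) :
    (cellsOf f w g).map Prod.fst = dataOf f w := by
  simp [cellsOf, dataOf, List.map_ofFn, Function.comp_def]

theorem length_cellsOf {n : ℕ} (f w g : Fin n → ℝ) : (cellsOf f w g).length = n := by
  simp [cellsOf]

theorem mem_cellsOf {n : ℕ} {f w g : Fin n → ℝ} {e : Cell} :
    e ∈ cellsOf f w g ↔ ∃ i, ((f i, w i), g i) = e := List.mem_ofFn' _ _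

/-- The run of the algorithm on an input. -/
theorem strictAlg_dataOf_runs {n : ℕ} {f w g : Fin n → ℝ} (hw : ∀ i, 0 < w i)
    (hst : IsStable f w g) (hbd : ∀ a b, (∀ i, a ≤ f i ∧ f i ≤ b) → ∀ i, a ≤ g i ∧ g i ≤ b)
    {δ : ℝ} (hδ : 0 < δ) {T : ℕ → ℝ → Prop} (hT₀ : ∀ i, T 0 (f i))
    (hT : ∀ j x, T j x → T (j + 1) x) (hT' : ∀ j x y, T j x → T j y → T (j + 1) ((x + y) / 2))
    (N : ℕ) (hN : 2 * ‖f‖ ≤ δ * 2 ^ N) :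
    ∃ (arr : ℕ → ℝ) (k : ℕ) (L : List Item),
      State (cellsOf f w g) arr (MidInv T δ (2 * ‖f‖)) k L ∧ (∀ p ∈ L, p.1.b - p.1.a ≤ δ) ∧
      RunsIn (strictAlg (dataOf f w) δ) (outputOf L) (n * Nat.log 2 n + k * n)
        (8 * n * Nat.clog 2 n + (Nat.log 2 n + N + 3) * (86 * n + 5) + 6 * n + 10) := by
  have h := strictAlg_runs (E := cellsOf f w g) (hst.stableCells hw) (δ := δ) (U := ‖f‖)
    (T := T) (by
      intro a b hab e he
      obtain ⟨i, rfl⟩ := mem_cellsOf.1 he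
      exact hbd a b (fun i => hab _ (mem_cellsOf.2 ⟨i, rfl⟩)) i) hδ (by
      intro e he
      obtain ⟨i, rfl⟩ := mem_cellsOf.1 he
      exact norm_le_pi_norm f i) (by
      intro e he
      obtain ⟨i, rfl⟩ := mem_cellsOf.1 he
      exact hT₀ i) hT hT' N hN
  rwa [map_fst_cellsOf, length_cellsOf] at h

theorem exists_two_pow_ge {δ : ℝ} (hδ : 0 < δ) (x : ℝ) : ∃ N : ℕ, x ≤ δ * 2 ^ N := by
  obtain ⟨N, hN⟩ := pow_unbounded_of_one_lt (x / δ) (one_lt_two : (1 : ℝ) < 2)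
  exact ⟨N, by rw [div_lt_iff₀ hδ] at hN; linarith⟩

theorem strictAlg_correct {n : ℕ} {f w g : Fin n → ℝ} (hw : ∀ i, 0 < w i)
    (hst : IsStable f w g) (hbd : ∀ a b, (∀ i, a ≤ f i ∧ f i ≤ b) → ∀ i, a ≤ g i ∧ g i ≤ b)
    {δ : ℝ} (hδ : 0 < δ) : ∃ (lower upper : Fin n → ℝ) (t : ℕ),
      HaltsWith (strictAlg (dataOf f w) δ) (List.ofFn fun i => (lower i, upper i)) t ∧
      Monotone lower ∧ Monotone upper ∧
      (∀ i, lower i ≤ g i ∧ g i ≤ upper i ∧ upper i - lower i ≤ δ) ∧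
      (∀ i, g i ∈ Set.range f → lower i = g i ∧ upper i = g i) := by
  obtain ⟨N, hN⟩ := exists_two_pow_ge hδ (2 * ‖f‖)
  obtain ⟨arr, k, L, hL, hLδ, hrun⟩ := strictAlg_dataOf_runs hw hst hbd hδ (T := fun _ _ => True)
    (fun _ => trivial) (fun _ _ _ => trivial) (fun _ _ _ _ _ => trivial) N hN
  obtain ⟨t, -, -, ht⟩ := hrun.haltsWith
  have hout := forall₂_outputOf (R := fun e z => z.1 ≤ e.2 ∧ e.2 ≤ z.2 ∧ z.2 - z.1 ≤ δ ∧
    (e.2 ∈ Set.range f → z.1 = z.2)) L (fun p hp => by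
      have hf := (hL.ok p hp).fits
      refine ⟨hf.len, fun e he => ⟨(hf.mem e he).1, (hf.mem e he).2, hLδ p hp, ?_⟩⟩
      rintro ⟨i, hi⟩
      -- No candidates remain in the second phase (`hi ≤ lo`), so a regression value that is a data
      -- value lies in a point extent.
      refine (hf.cand e he ⟨_, mem_cellsOf.2 ⟨i, rfl⟩, hi⟩).resolve_right ?_
      rintro ⟨m, h1, h2, -⟩
      have := (hL.ok p hp).inv.2.2.1
      omega)
  have hpw := hL.outputOf_pairwise
  rw [hL.cov] at hout
  set out := outputOf L
  have hlen : out.length = n := by rw [← hout.length_eq, length_cellsOf]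
  subst hlen
  refine ⟨fun i => out[i].1, fun i => out[i].2, t, ?_, ?_, ?_, ?_⟩
  · have : (List.ofFn fun i : Fin out.length => (out[i].1, out[i].2)) = out := by
      exact List.ofFn_getElem
    rw [this]; exact ht
  · intro i i' hii
    rcases hii.eq_or_lt with rfl | hlt
    · exact le_rfl
    · exact (List.pairwise_iff_getElem.1 hpw i i' i.2 i'.2 hlt).1
  · intro i i' hii
    rcases hii.eq_or_lt with rfl | hlt
    · exact le_rfl
    · exact (List.pairwise_iff_getElem.1 hpw i i' i.2 i'.2 hlt).2
  · have hall : ∀ i : Fin out.length, out[i].1 ≤ g i ∧ g i ≤ out[i].2 ∧ out[i].2 - out[i].1 ≤ δ ∧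
        (g i ∈ Set.range f → out[i].1 = out[i].2) := by
      intro i
      have := (List.forall₂_iff_get.1 hout).2 i (by rw [length_cellsOf]; exact i.2) i.2
      simpa [cellsOf] using this
    refine ⟨fun i => ⟨(hall i).1, (hall i).2.1, (hall i).2.2.1⟩, fun i hi => ?_⟩
    obtain ⟨h1, h2, -, h3⟩ := hall i
    have h3 := h3 hi
    dsimp only
    exact ⟨le_antisymm h1 (by rw [h3]; exact h2), le_antisymm (by rw [← h3]; exact h1) h2⟩

/-! ### The upper bound for the running time -/

theorem HaltsWith.unique {α : Type} {c : RAM α} {x x' : α} {t t' : ℕ} (h : HaltsWith c x t)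
    (h' : HaltsWith c x' t') : t = t' := by
  unfold HaltsWith at h h'
  rw [h] at h'
  exact congrArg Prod.snd (Option.some.inj h')

theorem strictAlg_time_le {n : ℕ} (hn : 2 ≤ n) {f w : Fin n → ℝ} {δ : ℝ} (hw : ∀ i, 0 < w i)
    (hδ : 0 < δ) {out : List (ℝ × ℝ)} {t : ℕ} (h : HaltsWith (strictAlg (dataOf f w) δ) out t) :
    (t : ℝ) ≤ 700 / Real.log 2 * (n * Real.log (max (n : ℝ) (‖f‖ / δ))) := by
  obtain ⟨g, -, hst, hbd⟩ := exists_strictDownOne f w hw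
  set M := max (n : ℝ) (‖f‖ / δ) with hM
  set x := Real.logb 2 M with hx
  have hn2 : (2 : ℝ) ≤ n := by exact_mod_cast hn
  have hnM : (n : ℝ) ≤ M := le_max_left _ _
  have hM2 : 2 ≤ M := hn2.trans hnM
  have hx1 : 1 ≤ x := by
    rw [hx, Real.le_logb_iff_rpow_le one_lt_two (by linarith), Real.rpow_one]; exact hM2
  -- The ends start at most `2 * ‖f‖` apart, hence one halving beyond the logarithm of `‖f‖ / δ`.
  set N := ⌈x + 1⌉₊ with hNdef
  have hN : 2 * ‖f‖ ≤ δ * 2 ^ N := by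
    have h1 : x + 1 ≤ N := Nat.le_ceil _
    have h2 : (2 : ℝ) ^ (x + 1) ≤ 2 ^ N := by
      rw [← Real.rpow_natCast]; exact Real.rpow_le_rpow_of_exponent_le one_le_two h1
    rw [Real.rpow_add_one two_ne_zero, hx, Real.rpow_logb two_pos (by norm_num) (by linarith)] at h2
    have h3 : ‖f‖ / δ ≤ M := le_max_right _ _
    rw [div_le_iff₀ hδ] at h3
    nlinarith
  have hNx : (N : ℝ) ≤ 3 * x := by
    have := (Nat.ceil_lt_add_one (by linarith : 0 ≤ x + 1)).le
    rw [← hNdef] at this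
    linarith
  have hlogn : Real.logb 2 n ≤ x :=
    Real.logb_le_logb_of_le one_lt_two (by linarith) hnM
  have hlog : (Nat.log 2 n : ℝ) ≤ x := by
    have := Real.natLog_le_logb n 2
    push_cast at this
    linarith
  have hclog : (Nat.clog 2 n : ℝ) ≤ 2 * x := by
    have h1 := Real.natCeil_logb_natCast 2 n
    push_cast at h1
    have h2 := (Nat.ceil_lt_add_one (Real.logb_nonneg one_lt_two (by linarith : (1 : ℝ) ≤ n))).le
    rw [h1] at h2
    linarith
  obtain ⟨arr, k, L, -, -, hrun⟩ := strictAlg_dataOf_runs hw hst hbd hδ (T := fun _ _ => True)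
    (fun _ => trivial) (fun _ _ _ => trivial) (fun _ _ _ _ _ => trivial) N hN
  obtain ⟨t', -, ht', hh⟩ := hrun.haltsWith
  rw [← h.unique hh] at ht'
  have ht : (t : ℝ) ≤ 8 * n * Nat.clog 2 n + (Nat.log 2 n + N + 3) * (86 * n + 5) + 6 * n + 10 := by
    exact_mod_cast ht'
  have e1 : (8 : ℝ) * n * Nat.clog 2 n ≤ 8 * n * (2 * x) :=
    mul_le_mul_of_nonneg_left hclog (by linarith)
  -- Since `x ≥ 1`, the first factor is at most `x + 3 * x + 3 * x`. The main terms add up to `(16 +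
  -- 637) * n * x`, which leaves room in `700` for `6 * n + 10`.
  have e2 : ((Nat.log 2 n : ℝ) + N + 3) * (86 * n + 5) ≤ (7 * x) * (91 * n) :=
    mul_le_mul (by linarith) (by linarith) (by linarith) (by linarith)
  have e3 : (n : ℝ) ≤ n * x := by nlinarith
  have e4 : 700 / Real.log 2 * (n * Real.log M) = 700 * (n * x) := by
    rw [hx, ← Real.log_div_log]; ring
  rw [e4]
  nlinarith

/-! ### The lower bound for the running time -/

theorem eqSum_eq_zero {S : List (ℝ × ℝ)} {y : ℝ} (h : ∀ r ∈ S, r.1 ≠ y) : eqSum S y = 0 := by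
  unfold eqSum
  refine List.sum_eq_zero fun x hx => ?_
  obtain ⟨r, hr, rfl⟩ := List.mem_map.1 hx
  exact if_neg (h r hr)

theorem lt_limMean_of_signSum {S : List (ℝ × ℝ)} (hS : S ≠ []) (hw : ∀ r ∈ S, 0 < r.2) {y : ℝ}
    (h0 : ∀ r ∈ S, r.1 ≠ y) (h : signSum S y < 0) : y < limMean S := by
  refine lt_limMean_of_reflect hS hw (reflect_ruleLT_iff.2 (Or.inl ?_))
  rw [eqSum_eq_zero h0]
  linarith

/-- At `U / 3` the weights balance, two against one plus one, and so do the products: `(2U/3)^2 =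
(U/3) * (4U/3)`. -/
theorem limMean_third {U : ℝ} (hU : 0 < U) : limMean [(U, 2), (0, 1), (-U, 1)] = U / 3 := by
  refine RuleEQ.limMean_eq (by simp) (by simp) (Or.inr ⟨eqSum_eq_zero ?_, ?_, ?_⟩)
  · intro r hr
    simp only [List.mem_cons, List.not_mem_nil, or_false] at hr
    rcases hr with rfl | rfl | rfl <;> dsimp only <;> intro h <;> linarith
  · simp only [signSum, List.map_cons, List.map_nil, List.sum_cons, List.sum_nil]
    rw [sign_neg (by linarith), sign_pos (by linarith), sign_pos (by linarith)]
    norm_num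
  · simp only [logSum, List.map_cons, List.map_nil, List.sum_cons, List.sum_nil]
    rw [sign_neg (by linarith), sign_pos (by linarith), sign_pos (by linarith),
      abs_of_neg (by linarith), abs_of_pos (by linarith), abs_of_pos (by linarith)]
    have e1 : -(U / 3 - U) = 2 * (U / 3) := by ring
    have e2 : U / 3 - -U = 2 * (2 * (U / 3)) := by ring
    have h3 : U / 3 ≠ 0 := by positivity
    rw [e1, e2, sub_zero, Real.log_mul two_ne_zero (mul_ne_zero two_ne_zero h3),
      Real.log_mul two_ne_zero h3]
    simp
    ring

theorem exists_prefix_le {E : List Cell} (hE : E.Pairwise fun e e' => e.2 ≤ e'.2) (c : ℝ) :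
    ∃ Q R, E = Q ++ R ∧ (∀ e ∈ Q, e.2 ≤ c) ∧ ∀ e ∈ R, c < e.2 := by
  induction E with
  | nil => exact ⟨[], [], by simp, by simp, by simp⟩
  | cons e E ih =>
    rw [List.pairwise_cons] at hE
    by_cases h : e.2 ≤ c
    · obtain ⟨Q, R, rfl, hQ, hR⟩ := ih hE.2
      refine ⟨e :: Q, R, rfl, fun x hx => ?_, hR⟩
      rcases List.mem_cons.1 hx with rfl | hx
      exacts [h, hQ x hx]
    · refine ⟨[], e :: E, rfl, by simp, fun x hx => ?_⟩
      rcases List.mem_cons.1 hx with rfl | hx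
      · exact not_le.1 h
      · exact (not_le.1 h).trans_le (hE.1 x hx)

/-- A regression value that is not a dyadic multiple of `U`. -/
theorem StableCells.head_eq_third {U g₀ g₁ g₂ : ℝ} (hU : 0 < U) {R : List Cell}
    (hR : ∀ e ∈ R, e.1 = (U, 1))
    (hE : StableCells (((U, 2), g₀) :: ((0, 1), g₁) :: ((-U, 1), g₂) :: R)) : g₀ = U / 3 := by
  have h01 : g₀ ≤ g₁ := (List.pairwise_cons.1 hE.mono).1 ((0, 1), g₁) (by simp)
  have h12 : g₁ ≤ g₂ :=
    (List.pairwise_cons.1 (List.pairwise_cons.1 hE.mono).2).1 ((-U, 1), g₂) (by simp)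
  have hle : g₂ ≤ U / 3 := by
    -- The level set at which `g₂` is attained begins at the third, the second or the first vertex.
    -- Up to the third vertex it is a block with limit mean at most `-U`, `0` and `U / 3`
    -- respectively.
    rcases h12.lt_or_eq with h | rfl
    · refine (hE.le_mean [((U, 2), g₀), ((0, 1), g₁)] [((-U, 1), g₂)] R g₂ rfl (by simp)
        (by simp; exact ⟨by linarith, h⟩) (by simp)).trans (limMean_le (by simp) (by simp) ?_)
      simp; linarith
    · rcases h01.lt_or_eq with h | rfl
      · refine (hE.le_mean [((U, 2), g₀)] [((0, 1), g₁), ((-U, 1), g₁)] R g₁ rfl (by simp)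
          (by simpa using h) (by simp)).trans (limMean_le (by simp) (by simp) ?_)
        simp; constructor <;> linarith
      · have := hE.le_mean [] [((U, 2), g₀), ((0, 1), g₀), ((-U, 1), g₀)] R g₀ rfl (by simp)
          (by simp) (by simp)
        exact this.trans (limMean_third hU).le
  refine le_antisymm (by linarith) ?_
  -- The maximal prefix with values at most `g₀` has limit mean at most `g₀`. Every non-empty prefix
  -- of this input has limit mean at least `U / 3`.
  obtain ⟨Q, R', hQR, hQ, hR'⟩ := exists_prefix_le hE.mono g₀
  have key : Q ≠ [] → U / 3 ≤ cellMean Q → U / 3 ≤ g₀ := fun h1 h2 =>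
    h2.trans (hE.mean_le [] Q R' g₀ (by simpa using hQR) h1 hQ hR')
  have hs1 : (SignType.sign (U / 3 - U) : ℝ) = -1 := by rw [sign_neg (by linarith)]; simp
  have hs2 : (SignType.sign (U / 3 - 0) : ℝ) = 1 := by rw [sign_pos (by linarith)]; simp
  have hs3 : (SignType.sign (U / 3 - -U) : ℝ) = 1 := by rw [sign_pos (by linarith)]; simp
  match Q, hQR, key with
  | [], hQR, _ =>
    rw [List.nil_append] at hQR
    exact absurd (hR' _ (hQR ▸ List.mem_cons_self)) (lt_irrefl _)
  | [e₀], hQR, key =>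
    simp only [List.cons_append, List.cons.injEq] at hQR
    obtain ⟨rfl, -⟩ := hQR
    refine key (by simp) (le_limMean (by simp) (by simp) ?_)
    simp; linarith
  | [e₀, e₁], hQR, key =>
    simp only [List.cons_append, List.cons.injEq] at hQR
    obtain ⟨rfl, rfl, -⟩ := hQR
    refine key (by simp) (lt_limMean_of_signSum (by simp) (by simp) ?_ ?_).le
    · simp; constructor <;> intro h <;> linarith
    · simp [signSum, hs1]
      rw [sign_pos (by linarith)]; simp
  | [e₀, e₁, e₂], hQR, key =>
    simp only [List.cons_append, List.cons.injEq] at hQR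
    obtain ⟨rfl, rfl, rfl, -⟩ := hQR
    exact key (by simp) (limMean_third hU).ge
  -- The first three vertices balance at `U / 3`; any further vertex has value `U` and tips the
  -- weights upwards.
  | e₀ :: e₁ :: e₂ :: e₃ :: Q, hQR, key =>
    simp only [List.cons_append, List.cons.injEq] at hQR
    obtain ⟨rfl, rfl, rfl, rfl⟩ := hQR
    have hd : ∀ r ∈ (e₃ :: Q).map Prod.fst, r = (U, 1) := by
      intro r hr
      obtain ⟨e, he, rfl⟩ := List.mem_map.1 hr
      exact hR e (by simp at he ⊢; tauto)
    have hneg : signSum ((e₃ :: Q).map Prod.fst) (U / 3) < 0 := by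
      rw [← slope_zero]
      refine slope_neg_of_forall_gt (by simp) (fun r hr => ?_) (fun r hr => ?_) 0
      · rw [hd r hr]; norm_num
      · rw [hd r hr]; dsimp only; linarith
    have hmem : ∀ r ∈ ([((U, 2), g₀), ((0, 1), g₁), ((-U, 1), g₂)] ++ e₃ :: Q).map
        (Prod.fst : Cell → ℝ × ℝ), r = (U, 2) ∨ r = (0, 1) ∨ r = (-U, 1) ∨ r = (U, 1) := by
      intro r hr
      rw [List.map_append, List.mem_append] at hr
      rcases hr with hr | hr
      · simp at hr; tauto
      · exact Or.inr (Or.inr (Or.inr (hd r hr)))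
    refine key (by simp) (lt_limMean_of_signSum (by simp) (fun r hr => ?_) (fun r hr => ?_) ?_).le
    · rcases hmem r hr with rfl | rfl | rfl | rfl <;> norm_num
    · rcases hmem r hr with rfl | rfl | rfl | rfl <;> dsimp only <;> intro h <;> linarith
    · have e : signSum ((((U, 2), g₀) :: ((0, 1), g₁) :: ((-U, 1), g₂) :: e₃ :: Q).map
          (Prod.fst : Cell → ℝ × ℝ)) (U / 3) = 2 * (SignType.sign (U / 3 - U) : ℝ) +
          (1 * (SignType.sign (U / 3 - 0) : ℝ) + (1 * (SignType.sign (U / 3 - -U) : ℝ) +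
          signSum ((e₃ :: Q).map Prod.fst) (U / 3))) := by
        simp only [signSum, List.map_cons, List.sum_cons]
      rw [e, hs1, hs2, hs3]
      linarith

/-- The values of a slow input. -/
def slowValue (n : ℕ) (U : ℝ) (i : Fin n) : ℝ :=
  if (i : ℕ) = 1 then 0 else if (i : ℕ) = 2 then -U else U

/-- The weights of a slow input. -/
def slowWeight (n : ℕ) (i : Fin n) : ℝ := if (i : ℕ) = 0 then 2 else 1

theorem slowWeight_pos (n : ℕ) (i : Fin n) : 0 < slowWeight n i := by
  unfold slowWeight; split_ifs <;> norm_num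

theorem norm_slowValue {n : ℕ} (hn : 3 ≤ n) {U : ℝ} (hU : 0 ≤ U) : ‖slowValue n U‖ = U := by
  refine le_antisymm ((pi_norm_le_iff_of_nonneg hU).2 fun i => ?_) ?_
  · unfold slowValue
    split_ifs <;> simp [abs_of_nonneg hU, hU]
  · have := norm_le_pi_norm (slowValue n U) ⟨0, by omega⟩
    simpa [slowValue, abs_of_nonneg hU] using this

theorem slow_third {n : ℕ} (hn : 3 ≤ n) {U : ℝ} (hU : 0 < U) {g : Fin n → ℝ}
    (hst : IsStable (slowValue n U) (slowWeight n) g) : g ⟨0, by omega⟩ = U / 3 := by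
  obtain ⟨m, rfl⟩ := Nat.exists_eq_add_of_le' hn
  have h := hst.stableCells (slowWeight_pos _)
  rw [List.ofFn_succ, List.ofFn_succ, List.ofFn_succ] at h
  refine StableCells.head_eq_third hU (g₁ := g 1) (g₂ := g 2) (R := List.ofFn fun i : Fin m =>
    ((slowValue (m + 3) U i.succ.succ.succ, slowWeight (m + 3) i.succ.succ.succ),
      g i.succ.succ.succ)) ?_ ?_
  · intro e he
    obtain ⟨i, rfl⟩ := (List.mem_ofFn' _ _).1 he
    simp [slowValue, slowWeight]
  · simpa [slowValue, slowWeight, Nat.mod_eq_of_lt (show 2 < m + 3 by omega)] using h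

/-- As `3` does not divide a power of two, `U / 3` is not on the grid of multiples of `U / 2 ^ k`.
The ends that enclose it are distinct grid points, hence at least `U / 2 ^ k` apart. -/
theorem two_pow_ge_of_dyadic {U δ a b : ℝ} {k : ℕ} (hU : 0 < U) (ha : ∃ z : ℤ, a * 2 ^ k = U * z)
    (hb : ∃ z : ℤ, b * 2 ^ k = U * z) (h1 : a ≤ U / 3) (h2 : U / 3 ≤ b) (hd : b - a ≤ δ) :
    U ≤ δ * 2 ^ k := by
  obtain ⟨z, hz⟩ := ha
  obtain ⟨z', hz'⟩ := hb
  have hp : (0 : ℝ) < 2 ^ k := by positivity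
  have i1 : (3 : ℝ) * z ≤ 2 ^ k := by
    have : U * z ≤ U / 3 * 2 ^ k := by rw [← hz]; exact mul_le_mul_of_nonneg_right h1 hp.le
    by_contra! h
    nlinarith
  have i2 : (2 : ℝ) ^ k ≤ 3 * z' := by
    have : U / 3 * 2 ^ k ≤ U * z' := by rw [← hz']; exact mul_le_mul_of_nonneg_right h2 hp.le
    by_contra! h
    nlinarith
  have j1 : 3 * z ≤ 2 ^ k := by exact_mod_cast i1
  have j2 : 2 ^ k ≤ 3 * z' := by exact_mod_cast i2
  have hne : ∀ y : ℤ, 3 * y ≠ 2 ^ k := by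
    intro y hy
    have : (3 : ℤ) ∣ 2 ^ k := ⟨y, hy.symm⟩
    have := Int.prime_three.dvd_of_dvd_pow this
    omega
  have hlt : z + 1 ≤ z' := by
    have := hne z
    have := hne z'
    omega
  have hlt' : (z : ℝ) + 1 ≤ z' := by exact_mod_cast hlt
  have : (b - a) * 2 ^ k ≤ δ * 2 ^ k := mul_le_mul_of_nonneg_right hd hp.le
  nlinarith

theorem exists_slow_input {n : ℕ} (hn : 3 ≤ n) {U δ : ℝ} (hδ : 0 < δ) :
    ∃ out t, HaltsWith (strictAlg (dataOf (slowValue n U) (slowWeight n)) δ) out t ∧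
      1 / (2 * Real.log 2) * (n * Real.log (max (n : ℝ) (U / δ))) ≤ t := by
  obtain ⟨g, -, hst, hbd⟩ := exists_strictDownOne (slowValue n U) (slowWeight n) (slowWeight_pos n)
  obtain ⟨N, hN⟩ := exists_two_pow_ge hδ (2 * ‖slowValue n U‖)
  obtain ⟨arr, k, L, hL, hLδ, hrun⟩ := strictAlg_dataOf_runs (slowWeight_pos n) hst hbd hδ
    -- The data values are `0`, `U` and `-U`, and each averaging adds one binary digit.
    (T := fun j x => ∃ z : ℤ, x * 2 ^ j = U * z) (by
      intro i
      unfold slowValue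
      split_ifs
      · exact ⟨0, by simp⟩
      · exact ⟨-1, by simp⟩
      · exact ⟨1, by simp⟩) (by
      rintro j x ⟨z, hz⟩
      exact ⟨2 * z, by push_cast; rw [pow_succ, ← mul_assoc, hz]; ring⟩) (by
      rintro j x y ⟨z, hz⟩ ⟨z', hz'⟩
      exact ⟨z + z', by push_cast; rw [mul_add, ← hz, ← hz']; ring⟩) N hN
  obtain ⟨t, ht, -, hh⟩ := hrun.haltsWith
  refine ⟨_, t, hh, ?_⟩
  have ht' : (n : ℝ) * Nat.log 2 n + k * n ≤ t := by exact_mod_cast ht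
  have hlog2 : 0 < Real.log 2 := Real.log_pos one_lt_two
  have hn3 : (3 : ℝ) ≤ n := by exact_mod_cast hn
  have hmain : ∀ x : ℝ, 1 / (2 * Real.log 2) * (n * Real.log x) = n * (Real.logb 2 x / 2) := by
    intro x; rw [← Real.log_div_log]; field_simp
  rw [hmain]
  rcases le_total (U / δ) n with hle | hle
  · rw [max_eq_left hle]
    have h1 : 1 ≤ Nat.log 2 n := Nat.log_pos one_lt_two (by omega)
    have h2 : Real.logb 2 n ≤ Nat.log 2 n + 1 := by
      have := Nat.lt_floor_add_one (Real.logb 2 n)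
      have h3 := Real.natFloor_logb_natCast 2 n
      push_cast at h3
      rw [h3] at this
      exact this.le
    have h1' : (1 : ℝ) ≤ Nat.log 2 n := by exact_mod_cast h1
    -- Rounding down loses at most one, hence at most half of the logarithm plus rounding, since
    -- `Nat.log 2 n ≥ 1`: the logarithm is at most twice its integer part. Here sorting alone takes
    -- the required time.
    have h4 : (n : ℝ) * (Real.logb 2 n / 2) ≤ n * Nat.log 2 n :=
      mul_le_mul_of_nonneg_left (by linarith) (by linarith)
    have h5 : (0 : ℝ) ≤ k * n := by positivity
    linarith
  · rw [max_eq_right hle]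
    have hUpos : 0 < U := by
      have : 0 < U / δ := by linarith
      exact (div_pos_iff_of_pos_right hδ).1 this
    have hcell : (((slowValue n U ⟨0, by omega⟩, slowWeight n ⟨0, by omega⟩), g ⟨0, by omega⟩) : Cell)
        ∈ cellsOf (slowValue n U) (slowWeight n) g := mem_cellsOf.2 ⟨_, rfl⟩
    rw [← hL.cov] at hcell
    obtain ⟨seg, hseg, hmem⟩ := List.mem_flatten.1 hcell
    obtain ⟨p, hp, rfl⟩ := List.mem_map.1 hseg
    have hfm := (hL.ok p hp).fits.mem _ hmem
    rw [slow_third hn hUpos hst] at hfm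
    obtain ⟨hTa, hTb, -, -⟩ := (hL.ok p hp).inv
    have hpow := two_pow_ge_of_dyadic hUpos hTa hTb hfm.1 hfm.2 (hLδ p hp)
    -- The extent of the first vertex contains `U / 3`, which bounds the number of halving
    -- iterations from below; each of them takes at least `n` steps.
    have hk : Real.logb 2 (U / δ) ≤ k := by
      rw [Real.logb_le_iff_le_rpow one_lt_two (by positivity), Real.rpow_natCast,
        div_le_iff₀ hδ]
      linarith
    have h0 : 0 ≤ Real.logb 2 (U / δ) := Real.logb_nonneg one_lt_two (by linarith)
    have h4 : (n : ℝ) * (Real.logb 2 (U / δ) / 2) ≤ n * k :=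
      mul_le_mul_of_nonneg_left (by linarith) (by linarith)
    have h5 : (0 : ℝ) ≤ n * Nat.log 2 n := by positivity
    linarith

end StrictIso

theorem mainTheorem4 :
    -- The statistics kept for a block are those of its original data values; they are computed
    -- by reading the block, maintained under merging, and they decide the position of the block's
    -- limit mean relative to the splitting value.
    (∀ S : List (ℝ × ℝ), S ≠ [] → (∀ q ∈ S, 0 < q.2) →
      ∃ c : ℝ, (∀ c', IsMeanDownOne S c' ↔ c' = c) ∧
        ∀ y : ℝ,
          (∀ rest, ∃ t, HaltsWith (scan y S.length (S ++ rest) Stats.empty)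
            (Stats.of y S, rest) t) ∧
          (∀ S', ∃ t, HaltsWith (mergeStats (Stats.of y S) (Stats.of y S'))
            (Stats.of y (S ++ S')) t) ∧
          ∃ t, HaltsWith (locate (Stats.of y S)) (cmp c y) t) ∧
    -- Correctness.
    (∀ (n : ℕ) (f w : Fin n → ℝ) (δ : ℝ), (∀ i, 0 < w i) → 0 < δ →
      ∃ g : Fin n → ℝ, (∀ g', IsStrictDownOne f w g' ↔ g' = g) ∧
        ∃ (lower upper : Fin n → ℝ) (t : ℕ),
          HaltsWith (strictAlg (dataOf f w) δ) (List.ofFn fun i => (lower i, upper i)) t ∧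
          Monotone lower ∧ Monotone upper ∧
          (∀ i, lower i ≤ g i ∧ g i ≤ upper i ∧ upper i - lower i ≤ δ) ∧
          (∀ i, g i ∈ Set.range f → lower i = g i ∧ upper i = g i)) ∧
    -- Running time; the sup norm `‖f‖` is the largest absolute value of the data.
    (∃ C : ℝ, 0 < C ∧ ∀ (n : ℕ) (f w : Fin n → ℝ) (δ : ℝ), 2 ≤ n → (∀ i, 0 < w i) → 0 < δ →
      ∀ out t, HaltsWith (strictAlg (dataOf f w) δ) out t →
        (t : ℝ) ≤ C * (n * Real.log (max (n : ℝ) (‖f‖ / δ)))) ∧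
    (∃ c : ℝ, 0 < c ∧ ∀ (n : ℕ) (U δ : ℝ), 3 ≤ n → 0 ≤ U → 0 < δ →
      ∃ f w : Fin n → ℝ, (∀ i, 0 < w i) ∧ ‖f‖ = U ∧
        ∃ out t, HaltsWith (strictAlg (dataOf f w) δ) out t ∧
          c * (n * Real.log (max (n : ℝ) (U / δ))) ≤ t) := by
  refine ⟨fun S hS hw => ⟨limMean S, isMeanDownOne_iff hS hw, fun y => ⟨fun rest => ?_, fun S' => ?_,
    ?_⟩⟩, fun n f w δ hw hδ => ?_, ⟨700 / Real.log 2, div_pos (by norm_num)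
    (Real.log_pos one_lt_two), fun n f w δ hn hw hδ out t h => strictAlg_time_le hn hw hδ h⟩,
    ⟨1 / (2 * Real.log 2), ?_, fun n U δ hn hU hδ => ⟨slowValue n U, slowWeight n,
      slowWeight_pos n, norm_slowValue hn hU, exists_slow_input hn hδ⟩⟩⟩
  · obtain ⟨t, -, -, h⟩ := (scan_runs y S rest Stats.empty).haltsWith
    rw [Stats.empty_combine] at h
    exact ⟨t, h⟩
  · obtain ⟨t, -, -, h⟩ := (mergeStats_runs (Stats.of y S) (Stats.of y S')).haltsWith
    rw [← Stats.of_append] at h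
    exact ⟨t, h⟩
  · obtain ⟨t, -, -, h⟩ := (locate_runs hS hw y).haltsWith
    exact ⟨t, h⟩
  · obtain ⟨g, huniq, hst, hbd⟩ := exists_strictDownOne f w hw
    exact ⟨g, huniq, strictAlg_correct hw hst hbd hδ⟩
  · have := Real.log_pos one_lt_two
    positivity
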